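/- Let $d\ge 0$ and let $L:(0,1)\to(0,\infty)$ be an Osgood modulus of continuity: $1/L$ is integrable on $(z,1)$ for every $z\in(0,1)$, and $$\mathcal M(z):=\int_z^1\frac{dr}{L(r)}\longrightarrow\infty\qquad (z\to0^+).$$ Let $u:\mathbb R^d\times[0,\infty)\to\mathbb R^d$ be a measurable velocity field such that $t\mapsto u(x,t)$ is locally integrable on $[0,\infty)$ for each $x$, such that $u(\cdot,t)$ is divergence free in the sense of distributions for each $t>0$, and such that for some $C\in L^1_{loc}([0,\infty))$ $$|u(x,t)-u(y,t)|\le C(t)\,L(|x-y|)\qquad\text{for all } t>0 \text{ and all } x,y \text{ with } 0<|x-y|<1 .$$ For $f:\mathbb R^d\to\mathbb R$ and $\gamma\in\mathbb R$ define, with values in $[0,\infty]$, $$[f]_{\gamma,L}=\lim_{r\to0^+}\ \sup_{x,y:\,0<|x-y|<r}\frac{|f(x)-f(y)|}{\mathcal M(|x-y|)^\gamma},\qquad [f]_{x,\gamma,L}=\lim_{r\to0^+}\ \sup_{y:\,0<|x-y|<r}\frac{|f(x)-f(y)|}{\mathcal M(|x-y|)^\gamma}.$$ Then $u$ has a flow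 $\phi$: for each $x\in\mathbb R^d$ the integral equation $\phi(x,t)=x+\int_0^t u(\phi(x,s),s)\,ds$, $t\ge 0$, has a continuous solution, which is unique on every interval $[0,T]$, and for each $t\ge0$ the map $\phi_t=\phi(\cdot,t)$ is a measure preserving homeomorphism of $\mathbb R^d$. Moreover, for every $\theta_0\in L^1_{loc}(\mathbb R^d)$: (i) $\theta(x,t)=\theta_0(\phi_t^{-1}(x))$ is a weak solution of the transport equation $\partial_t\theta+u\cdot\nabla\theta=0$, $\theta|_{t=0}=\theta_0$, in the class $L^\infty_{loc}([0,\infty);L^1_{loc}(\mathbb R^d))$, that is, $\int_0^\infty\!\int_{\mathbb R^d}\theta\,(\partial_t\psi+u\cdot\nabla\psi)\,dx\,dt+\int_{\mathbb R^d}\theta_0\,\psi(\cdot,0)\,dx=0$ for all $\psi\in C_c^\infty(\mathbb R^d\times\mathbb R)$; and it is the only one: every weak solution in this class agrees with it almost everywhere, for almost every $t>0$; (ii) for every $\gamma\in\mathbb R$ and $t\ge0$ this solution (with its representative $\theta_0\circ\phi_t^{-1}$) satisfies $$[\theta(t)]_{\gamma,L}=[\theta_0]_{\gamma,L};$$ (iii)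 the localized seminorm is carried by the flow: for every $\gamma\in\mathbb R$, $t\ge0$ and $x\in\mathbb R^d$, $$[\theta(t)]_{\phi(x,t),\gamma,L}=[\theta_0]_{x,\gamma,L}.$$ -/

import Mathlib

open Set Filter Topology MeasureTheory
open scoped ENNReal ContDiff

namespace OsgoodTransport

noncomputable section

/-- The Euclidean space `ℝ^d`. -/
abbrev Sp (d : ℕ) : Type := EuclideanSpace ℝ (Fin d)

/-- `M(z) = ∫_z^1 dr / L(r)`. -/
def osgoodM (L : ℝ → ℝ) (z : ℝ) : ℝ := ∫ r in z..1, (L r)⁻¹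

/-- `L : (0,1) → (0,∞)` is an Osgood modulus: the function `M` is well defined (finite) on `(0,1)`
and `M(z) → ∞` as `z → 0⁺`. Only the values of `L` on `(0,1)` matter. -/
structure IsOsgoodModulus (L : ℝ → ℝ) : Prop where
  pos : ∀ r ∈ Ioo (0 : ℝ) 1, 0 < L r
  integrable : ∀ z ∈ Ioo (0 : ℝ) 1, IntervalIntegrable (fun r => (L r)⁻¹) volume z 1
  tendsto : Tendsto (osgoodM L) (𝓝[>] 0) atTop

/-- The difference quotient `|f(x) - f(y)| / M(|x-y|)^γ`. For `0 < |x-y| < 1` the denominator is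
positive when `L` is an Osgood modulus. -/
def quot {d : ℕ} (L : ℝ → ℝ) (γ : ℝ) (f : Sp d → ℝ) (x y : Sp d) : ℝ≥0∞ :=
  ENNReal.ofReal (|f x - f y| / osgoodM L ‖x - y‖ ^ γ)

/-- `sup_{x, y : 0 < |x-y| < r} |f(x) - f(y)| / M(|x-y|)^γ`. -/
def supQuot {d : ℕ} (L : ℝ → ℝ) (γ : ℝ) (f : Sp d → ℝ) (r : ℝ) : ℝ≥0∞ :=
  ⨆ (x : Sp d) (y : Sp d) (_ : 0 < ‖x - y‖ ∧ ‖x - y‖ < r), quot L γ f x y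

/-- `sup_{y : 0 < |x-y| < r} |f(x) - f(y)| / M(|x-y|)^γ`. -/
def supQuotAt {d : ℕ} (L : ℝ → ℝ) (γ : ℝ) (f : Sp d → ℝ) (x : Sp d) (r : ℝ) : ℝ≥0∞ :=
  ⨆ (y : Sp d) (_ : 0 < ‖x - y‖ ∧ ‖x - y‖ < r), quot L γ f x y

/-- `[f]_{γ,L}`: the limit as `r → 0⁺` of `supQuot`, with values in `[0,∞]`. As `supQuot` is
monotone in `r`, the limit is an infimum (see `tendsto_supQuot`). -/
def seminorm {d : ℕ} (L : ℝ → ℝ) (γ : ℝ) (f : Sp d → ℝ) : ℝ≥0∞ :=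
  ⨅ (r : ℝ) (_ : 0 < r), supQuot L γ f r

/-- `[f]_{x,γ,L}`: the limit as `r → 0⁺` of `supQuotAt`, with values in `[0,∞]`
(see `tendsto_supQuotAt`). -/
def seminormAt {d : ℕ} (L : ℝ → ℝ) (γ : ℝ) (f : Sp d → ℝ) (x : Sp d) : ℝ≥0∞ :=
  ⨅ (r : ℝ) (_ : 0 < r), supQuotAt L γ f x r

theorem supQuot_mono {d : ℕ} (L : ℝ → ℝ) (γ : ℝ) (f : Sp d → ℝ) : Monotone (supQuot L γ f) := by
  intro r s hrs
  refine iSup_mono fun x => iSup_mono fun y => iSup_le fun h => ?_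
  exact le_iSup_of_le ⟨h.1, h.2.trans_le hrs⟩ le_rfl

theorem supQuotAt_mono {d : ℕ} (L : ℝ → ℝ) (γ : ℝ) (f : Sp d → ℝ) (x : Sp d) :
    Monotone (supQuotAt L γ f x) := by
  intro r s hrs
  refine iSup_mono fun y => iSup_le fun h => ?_
  exact le_iSup_of_le ⟨h.1, h.2.trans_le hrs⟩ le_rfl

theorem tendsto_supQuot {d : ℕ} (L : ℝ → ℝ) (γ : ℝ) (f : Sp d → ℝ) :
    Tendsto (supQuot L γ f) (𝓝[>] 0) (𝓝 (seminorm L γ f)) := by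
  have h := (supQuot_mono L γ f).tendsto_nhdsGT 0
  rwa [sInf_image] at h

theorem tendsto_supQuotAt {d : ℕ} (L : ℝ → ℝ) (γ : ℝ) (f : Sp d → ℝ) (x : Sp d) :
    Tendsto (supQuotAt L γ f x) (𝓝[>] 0) (𝓝 (seminormAt L γ f x)) := by
  have h := (supQuotAt_mono L γ f x).tendsto_nhdsGT 0
  rwa [sInf_image] at h

/-- The vector field `v` is divergence free in the sense of distributions. -/
def IsDivFree {d : ℕ} (v : Sp d → Sp d) : Prop :=
  ∀ ψ : Sp d → ℝ, ContDiff ℝ ∞ ψ → HasCompactSupport ψ → ∫ x, fderiv ℝ ψ x (v x) = 0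

/-- The velocity field `u(x,t)` (written `u t x`), `t > 0`, has modulus of continuity `L` with
bounding function `C`. -/
def HasModulus {d : ℕ} (L C : ℝ → ℝ) (u : ℝ → Sp d → Sp d) : Prop :=
  ∀ t, 0 < t → ∀ x y, 0 < ‖x - y‖ → ‖x - y‖ < 1 → ‖u t x - u t y‖ ≤ C t * L ‖x - y‖

/-- `c` solves `c' = u(c,t)`, `c(0) = x` on `[0,T]` (in integrated form, as `u` need not be
continuous in time). -/
structure IsTrajectory {d : ℕ} (u : ℝ → Sp d → Sp d) (T : ℝ) (x : Sp d) (c : ℝ → Sp d) :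
    Prop where
  cont : ContinuousOn c (Icc 0 T)
  integrable : IntervalIntegrable (fun s => u s (c s)) volume 0 T
  eqn : ∀ t ∈ Icc 0 T, c t = x + ∫ s in (0 : ℝ)..t, u s (c s)

/-- `φ` is the flow of `u`: for each `x`, `t ↦ φ(x,t)` (written `φ t x`) is, on every `[0,T]`,
the unique solution of the ordinary differential equation started at `x`. -/
def IsFlow {d : ℕ} (u : ℝ → Sp d → Sp d) (φ : ℝ → Sp d → Sp d) : Prop :=
  ∀ T, 0 ≤ T → ∀ x, IsTrajectory u T x (fun t => φ t x) ∧
    ∀ c, IsTrajectory u T x c → ∀ t ∈ Icc 0 T, c t = φ t x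

/-- `θ` is a weak solution, in the class `L^∞_loc([0,∞); L^1_loc(ℝ^d))`, of
`∂ₜθ + u·∇θ = 0`, `θ|_{t=0} = θ₀`, for a divergence free `u`. For a test function `ψ` on `ℝ × ℝ^d`,
`fderiv ℝ ψ (t, x) (1, u t x)` is `∂ₜψ + u·∇ψ`. -/
structure IsWeakSolution {d : ℕ} (u : ℝ → Sp d → Sp d) (θ₀ : Sp d → ℝ) (θ : ℝ → Sp d → ℝ) :
    Prop where
  meas : AEStronglyMeasurable (fun p : ℝ × Sp d => θ p.1 p.2)
    (volume.restrict (Ioi (0 : ℝ) ×ˢ (univ : Set (Sp d))))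
  bound : ∀ T R : ℝ, ∃ K : ℝ, ∀ᵐ t ∂(volume.restrict (Ioo 0 T)),
    ∫⁻ x in Metric.ball (0 : Sp d) R, ‖θ t x‖ₑ ≤ ENNReal.ofReal K
  integrable : ∀ ψ : ℝ × Sp d → ℝ, ContDiff ℝ ∞ ψ → HasCompactSupport ψ →
    IntegrableOn (fun p : ℝ × Sp d => θ p.1 p.2 * fderiv ℝ ψ p (1, u p.1 p.2))
      (Ioi (0 : ℝ) ×ˢ (univ : Set (Sp d)))
  eqn : ∀ ψ : ℝ × Sp d → ℝ, ContDiff ℝ ∞ ψ → HasCompactSupport ψ →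
    (∫ p in Ioi (0 : ℝ) ×ˢ (univ : Set (Sp d)), θ p.1 p.2 * fderiv ℝ ψ p (1, u p.1 p.2))
      + ∫ x, θ₀ x * ψ (0, x) = 0

/-- The Lagrangian function `θ(x,t) = θ₀(φ⁻¹(x,t))`. -/
def lagrangian {d : ℕ} (φ : ℝ → Sp d ≃ₜ Sp d) (θ₀ : Sp d → ℝ) (t : ℝ) (x : Sp d) : ℝ :=
  θ₀ ((φ t).symm x)

end

end OsgoodTransport

/-! The engine is a two-sided form of Osgood's lemma. The field has an optimal spatial modulus `Λ`,
which is continuous, subadditive, and at most `L` on `(0,1)`. Put `A_ε(r) = ∫₀ʳ ds/(Λ(s)+ε)`. If `ρ`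
is the distance between two trajectories, then formally `|ρ'| ≤ C Λ(ρ)`, hence `|A_ε(ρ(t)) -
A_ε(ρ(s))| ≤ ∫ₛᵗ C` for every `ε > 0`. The regularization keeps `A_ε` finite at `0`, so trajectories
that might meet are allowed, and divergence of `M` becomes `A_ε(r) → ∞` as `ε → 0` for each fixed `r
> 0`. A distance with `A_ε(ρ) ≤ B` for small `ε` must therefore be small. This gives uniqueness,
convergence of a delayed Picard scheme, and equicontinuity of the flow maps and of their inverses.

Volume preservation and uniqueness of weak solutions come from one duality statement: for a weak
solution `θ` and `χ` continuous of compact support, `∫ θ(t) χ∘φ_t⁻¹ = ∫ θ₀ χ` for almost every `t`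
(`IsWeakSolution.ae_integral_transport`). The natural test function `χ∘φ_t⁻¹` is merely continuous,
so it is replaced by the sup-convolution `ψ(t,y) = sup_x (χ(x) - δ A_ε(|y - φ_t(x)|))`. This is
Lipschitz in `y`, it varies by at most `δ ∫ C` along trajectories by Osgood's lemma, and it is
uniformly close to `χ∘φ_t⁻¹` once `δ A_ε` is large away from `0`. Mollifying in space-time gives
smooth functions whose derivative along `(1,u)` is small in `L¹` in time, uniformly on balls
(`OsgoodField.exists_smooth_approx_transport`). That is precisely what pairs with `θ` in
`L^∞_loc(L¹_loc)`; neither derivatives of `θ` nor a commutator estimate are needed.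

With `θ = 1`, a weak solution because `u` is divergence free, duality says that the flow preserves
Lebesgue measure. With a general `θ` it then says `θ(t)∘φ_t = θ₀`. That `θ₀∘φ_t⁻¹` is itself a weak
solution follows by changing variables along the flow.

For the seminorms, `1/(L+ε) ≤ 1/(Λ+ε)` on `(0,1)`, and `ε → 0` in Osgood's estimate gives `|M(|φ_t x
- φ_t y|) - M(|x - y|)| ≤ ∫₀ᵗ C`. Since `M → ∞` at `0`, the ratio of the two values of `M` tends to
`1` uniformly as the distance shrinks, so every power `M^γ` is asymptotically unchanged by the flow
and by its inverse. -/

namespace OsgoodTransport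

/-! ### Regularized primitives and Osgood's comparison lemma -/

/-- The regularized primitive `r ↦ ∫₀ʳ ds / (Λ(s) + ε)` of the inverse of a modulus `Λ`. -/
noncomputable def regPrimitive (Λ : ℝ → ℝ) (ε r : ℝ) : ℝ := ∫ s in (0 : ℝ)..r, (Λ s + ε)⁻¹

section RegPrimitive

variable {Λ : ℝ → ℝ} {ε : ℝ}

theorem continuous_inv_add (hc : Continuous Λ) (h0 : ∀ r, 0 ≤ Λ r) (hε : 0 < ε) :
    Continuous fun s => (Λ s + ε)⁻¹ :=
  (hc.add continuous_const).inv₀ fun s => (add_pos_of_nonneg_of_pos (h0 s) hε).ne'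

@[simp] theorem regPrimitive_zero : regPrimitive Λ ε 0 = 0 := by simp [regPrimitive]

theorem regPrimitive_sub (hc : Continuous Λ) (h0 : ∀ r, 0 ≤ Λ r) (hε : 0 < ε) (r s : ℝ) :
    regPrimitive Λ ε r - regPrimitive Λ ε s = ∫ x in s..r, (Λ x + ε)⁻¹ :=
  intervalIntegral.integral_interval_sub_left
    ((continuous_inv_add hc h0 hε).intervalIntegrable _ _)
    ((continuous_inv_add hc h0 hε).intervalIntegrable _ _)

theorem abs_regPrimitive_sub_le (hc : Continuous Λ) (h0 : ∀ r, 0 ≤ Λ r) (hε : 0 < ε)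
    {r s m : ℝ} (hm : 0 < m) (h : ∀ x ∈ uIcc s r, m ≤ Λ x + ε) :
    |regPrimitive Λ ε r - regPrimitive Λ ε s| ≤ m⁻¹ * |r - s| := by
  rw [regPrimitive_sub hc h0 hε, ← Real.norm_eq_abs]
  refine intervalIntegral.norm_integral_le_of_norm_le_const fun x hx => ?_
  have hx' := h x (uIoc_subset_uIcc hx)
  rw [Real.norm_eq_abs, abs_of_nonneg (inv_nonneg.2 (hm.le.trans hx'))]
  exact inv_anti₀ hm hx'

theorem abs_regPrimitive_sub_le' (hc : Continuous Λ) (h0 : ∀ r, 0 ≤ Λ r) (hε : 0 < ε)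
    (r s : ℝ) : |regPrimitive Λ ε r - regPrimitive Λ ε s| ≤ ε⁻¹ * |r - s| :=
  abs_regPrimitive_sub_le hc h0 hε hε fun x _ => by linarith [h0 x]

theorem regPrimitive_mono (hc : Continuous Λ) (h0 : ∀ r, 0 ≤ Λ r) (hε : 0 < ε) :
    Monotone (regPrimitive Λ ε) := by
  intro s r hsr
  rw [← sub_nonneg, regPrimitive_sub hc h0 hε]
  exact intervalIntegral.integral_nonneg hsr fun x _ =>
    inv_nonneg.2 (add_nonneg (h0 x) hε.le)

theorem regPrimitive_nonneg (hc : Continuous Λ) (h0 : ∀ r, 0 ≤ Λ r) (hε : 0 < ε) {r : ℝ}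
    (hr : 0 ≤ r) : 0 ≤ regPrimitive Λ ε r := by
  simpa using regPrimitive_mono hc h0 hε hr

theorem regPrimitive_anti (hc : Continuous Λ) (h0 : ∀ r, 0 ≤ Λ r) (hε : 0 < ε) {ε' : ℝ}
    (h : ε ≤ ε') {r : ℝ} (hr : 0 ≤ r) : regPrimitive Λ ε' r ≤ regPrimitive Λ ε r := by
  refine intervalIntegral.integral_mono_on hr
    ((continuous_inv_add hc h0 (hε.trans_le h)).intervalIntegrable _ _)
    ((continuous_inv_add hc h0 hε).intervalIntegrable _ _) fun x _ => ?_
  exact inv_anti₀ (add_pos_of_nonneg_of_pos (h0 x) hε) (by linarith)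

theorem continuous_regPrimitive (hc : Continuous Λ) (h0 : ∀ r, 0 ≤ Λ r) (hε : 0 < ε) :
    Continuous (regPrimitive Λ ε) :=
  intervalIntegral.continuous_primitive
    (fun _ _ => (continuous_inv_add hc h0 hε).intervalIntegrable _ _) 0

/-- Osgood's comparison lemma. If the increments of `ρ` are bounded by those of the primitive of
`C (Λ ∘ ρ + ε)`, then the increments of `∫₀^ρ ds / (Λ(s) + 2ε)` are bounded by those of the
primitive of `C`. -/
theorem abs_regPrimitive_comp_sub_le (hc : Continuous Λ) (h0 : ∀ r, 0 ≤ Λ r) (hε : 0 < ε)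
    {C : ℝ → ℝ} (hC0 : ∀ t, 0 ≤ C t) (hC : ∀ a b, IntervalIntegrable C volume a b)
    {ρ : ℝ → ℝ} {a b : ℝ} (hab : a ≤ b) (hρ : ContinuousOn ρ (Icc a b))
    (h : ∀ s ∈ Icc a b, ∀ t ∈ Icc a b, s ≤ t →
      |ρ t - ρ s| ≤ ∫ σ in s..t, C σ * (Λ (ρ σ) + ε)) :
    |regPrimitive Λ (2 * ε) (ρ b) - regPrimitive Λ (2 * ε) (ρ a)| ≤ ∫ σ in a..b, C σ := by
  have hε2 : 0 < 2 * ε := by linarith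
  set A := regPrimitive Λ (2 * ε) with hA
  have hAc : Continuous A := continuous_regPrimitive hc h0 hε2
  let S : Set ℝ := {t | |A (ρ t) - A (ρ a)| ≤ ∫ σ in a..t, C σ}
  have hprim : Continuous fun t => ∫ σ in a..t, C σ := intervalIntegral.continuous_primitive hC a
  have hclosed : IsClosed (S ∩ Icc a b) := by
    have : S ∩ Icc a b = {t ∈ Icc a b | |A (ρ t) - A (ρ a)| ≤ ∫ σ in a..t, C σ} := by
      ext t; exact and_comm
    rw [this]
    exact isClosed_Icc.isClosed_le (((hAc.comp_continuousOn hρ).sub continuousOn_const).abs)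
      hprim.continuousOn
  have key : Icc a b ⊆ S := by
    -- Continuous induction replaces differentiation: `C` is only integrable, so the inequality is
    -- extended a little to the right of each point of `S`.
    refine hclosed.Icc_subset_of_forall_mem_nhdsWithin (by simp [S]) ?_
    rintro x ⟨hxS, hx⟩
    have hxI : x ∈ Icc a b := ⟨hx.1, hx.2.le⟩
    obtain ⟨δ₁, hδ₁, hΛ⟩ := Metric.continuousAt_iff.1 (hc.continuousAt (x := ρ x)) (ε / 2)
      (half_pos hε)
    obtain ⟨δ₂, hδ₂, hρx⟩ := Metric.continuousWithinAt_iff.1 (hρ x hxI) δ₁ hδ₁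
    have hmem : Ioo x (min b (x + δ₂)) ∈ 𝓝[>] x :=
      Ioo_mem_nhdsGT (lt_min hx.2 (by linarith))
    filter_upwards [hmem] with t ht
    have htb : t < b := ht.2.trans_le (min_le_left _ _)
    have htδ : t < x + δ₂ := ht.2.trans_le (min_le_right _ _)
    have htI : t ∈ Icc a b := ⟨hx.1.trans ht.1.le, htb.le⟩
    have hnear : ∀ σ ∈ Icc x t, |ρ σ - ρ x| < δ₁ := fun σ hσ => by
      have := @hρx σ ⟨hx.1.trans hσ.1, hσ.2.trans htb.le⟩
        (by rw [Real.dist_eq, abs_lt]; constructor <;> linarith [hσ.1, hσ.2])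
      rwa [Real.dist_eq] at this
    have hup : |ρ t - ρ x| ≤ (Λ (ρ x) + ε / 2 + ε) * ∫ σ in x..t, C σ := by
      refine (h x hxI t htI ht.1.le).trans ?_
      rw [← intervalIntegral.integral_const_mul]
      refine intervalIntegral.integral_mono_on ht.1.le ?_ ((hC _ _).const_mul _) fun σ hσ => ?_
      · refine (hC x t).mul_continuousOn ?_
        rw [uIcc_of_le ht.1.le]
        exact (hc.comp_continuousOn (hρ.mono (Icc_subset_Icc hx.1 htb.le))).add continuousOn_const
      · rw [mul_comm]
        have := @hΛ (ρ σ) (by rw [Real.dist_eq]; exact hnear σ hσ)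
        rw [Real.dist_eq, abs_lt] at this
        exact mul_le_mul_of_nonneg_right (by linarith) (hC0 σ)
    have hm : 0 < Λ (ρ x) + ε / 2 + ε := by linarith [h0 (ρ x)]
    -- Near `ρ x` the modulus oscillates by less than `ε/2`. So `Λ + ε` is at most `m = Λ (ρ x) +
    -- 3ε/2`, while `Λ + 2ε` is at least `m`, and the two factors cancel. This is the reason for
    -- passing from `ε` to `2ε`.
    have hlow := abs_regPrimitive_sub_le hc h0 hε2 (r := ρ t) (s := ρ x) hm fun y hy => by
      have hy' : |y - ρ x| < δ₁ :=
        (abs_sub_left_of_mem_uIcc hy).trans_lt (hnear t ⟨ht.1.le, le_rfl⟩)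
      have := @hΛ y (by rw [Real.dist_eq]; exact hy')
      rw [Real.dist_eq, abs_lt] at this
      linarith
    have hstep : |A (ρ t) - A (ρ x)| ≤ ∫ σ in x..t, C σ := by
      refine hlow.trans ((mul_le_mul_of_nonneg_left hup (inv_nonneg.2 hm.le)).trans_eq ?_)
      rw [← mul_assoc, inv_mul_cancel₀ hm.ne', one_mul]
    calc |A (ρ t) - A (ρ a)| ≤ |A (ρ t) - A (ρ x)| + |A (ρ x) - A (ρ a)| := abs_sub_le _ _ _
      _ ≤ (∫ σ in x..t, C σ) + ∫ σ in a..x, C σ := add_le_add hstep hxS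
      _ = ∫ σ in a..t, C σ := by
        rw [add_comm]; exact intervalIntegral.integral_add_adjacent_intervals (hC _ _) (hC _ _)
  exact key ⟨hab, le_rfl⟩

end RegPrimitive


/-! ### Fundamental theorem of calculus along absolutely continuous curves -/

section ChainRule

/-- A function whose increments are dominated by those of an absolutely continuous function is
absolutely continuous. -/
theorem absolutelyContinuousOnInterval_of_dist_le {X Y : Type*} [PseudoMetricSpace X]
    [PseudoMetricSpace Y] {f : ℝ → X} {g : ℝ → Y} {a b : ℝ}
    (hg : AbsolutelyContinuousOnInterval g a b)
    (h : ∀ s ∈ uIcc a b, ∀ t ∈ uIcc a b, dist (f s) (f t) ≤ dist (g s) (g t)) :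
    AbsolutelyContinuousOnInterval f a b := by
  rw [absolutelyContinuousOnInterval_iff] at hg ⊢
  intro ε hε
  obtain ⟨δ, hδ, hgδ⟩ := hg ε hε
  refine ⟨δ, hδ, fun E hE hEδ => (Finset.sum_le_sum fun i hi => ?_).trans_lt (hgδ E hE hEδ)⟩
  exact h _ (hE.1 i hi).1 _ (hE.1 i hi).2

/-- The fundamental theorem of calculus for the composition of a `C¹` function with the primitive
of an integrable function. -/
theorem integral_fderiv_comp_primitive {E : Type*} [NormedAddCommGroup E] [NormedSpace ℝ E]
    [FiniteDimensional ℝ E] {F : E → ℝ} (hF : ContDiff ℝ 1 F) {c w : ℝ → E} {a b : ℝ}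
    (hw : IntervalIntegrable w volume a b)
    (hc : ∀ t ∈ uIcc a b, c t = c a + ∫ s in a..t, w s) :
    ∫ t in a..b, fderiv ℝ F (c t) (w t) = F (c b) - F (c a) := by
  have hsub : ∀ s ∈ uIcc a b, ∀ t ∈ uIcc a b, c t - c s = ∫ σ in s..t, w σ := fun s hs t ht => by
    rw [hc t ht, hc s hs, add_sub_add_left_eq_sub]
    exact intervalIntegral.integral_interval_sub_left
      (hw.mono_set (uIcc_subset_uIcc left_mem_uIcc ht))
      (hw.mono_set (uIcc_subset_uIcc left_mem_uIcc hs))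
  have hcont : ContinuousOn c (uIcc a b) :=
    ((continuousOn_const (c := c a)).add
      (intervalIntegral.continuousOn_primitive_interval' hw left_mem_uIcc)).congr
      fun t ht => hc t ht
  obtain ⟨R, hR⟩ := (isCompact_uIcc.image_of_continuousOn hcont).isBounded.subset_closedBall 0
  -- The curve stays in a ball on which `F` is Lipschitz, so increments of `F ∘ c` are dominated by
  -- those of the primitive of `K ‖w‖`; hence `F ∘ c` is absolutely continuous.
  obtain ⟨K, hK⟩ := (hF.contDiffOn (s := Metric.closedBall (0 : E) R)).exists_lipschitzOnWith
    one_ne_zero (convex_closedBall _ _) (isCompact_closedBall _ _)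
  have hmem : ∀ t ∈ uIcc a b, c t ∈ Metric.closedBall (0 : E) R := fun t ht =>
    hR (mem_image_of_mem c ht)
  have hwn : IntervalIntegrable (fun s => (K : ℝ) * ‖w s‖) volume a b := hw.norm.const_mul _
  have hAC : AbsolutelyContinuousOnInterval (fun t => F (c t)) a b := by
    refine absolutelyContinuousOnInterval_of_dist_le
      (hwn.absolutelyContinuousOnInterval_intervalIntegral (c := a) left_mem_uIcc) fun s hs t ht => ?_
    refine (hK.dist_le_mul _ (hmem s hs) _ (hmem t ht)).trans ?_
    rw [dist_comm, dist_comm (∫ σ in a..s, _), dist_eq_norm, hsub s hs t ht, Real.dist_eq,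
      intervalIntegral.integral_interval_sub_left
        (hwn.mono_set (uIcc_subset_uIcc left_mem_uIcc ht))
        (hwn.mono_set (uIcc_subset_uIcc left_mem_uIcc hs)),
      intervalIntegral.integral_const_mul, abs_mul, NNReal.abs_eq]
    exact mul_le_mul_of_nonneg_left intervalIntegral.norm_integral_le_abs_integral_norm K.2
  rw [← hAC.integral_deriv_eq_sub]
  refine intervalIntegral.integral_congr_ae ?_
  -- `uIoc` already omits the left endpoint; discarding the right one makes `uIcc a b` a
  -- neighbourhood of `t`.
  have hne : ∀ᵐ t : ℝ, t ≠ max a b := by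
    simp [ae_iff]
  filter_upwards [hw.ae_hasDerivAt_integral, hne] with t ht htb htI
  have htI' : t ∈ uIcc a b := uIoc_subset_uIcc htI
  have hd := ht htI' a left_mem_uIcc
  have hnhds : uIcc a b ∈ 𝓝 t := by
    refine Icc_mem_nhds htI.1 (lt_of_le_of_ne htI.2 htb)
  have hcd : HasDerivAt c (w t) t :=
    (hd.const_add (c a)).congr_of_eventuallyEq (by
      filter_upwards [hnhds] with s hs using hc s hs)
  exact (((hF.differentiable one_ne_zero (c t)).hasFDerivAt.comp_hasDerivAt t hcd).deriv).symm

/-- `∫ₐᵇ g e^G = e^{G(b)} - 1` for `G = ∫ₐ g`. -/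
theorem integral_mul_exp_primitive {g : ℝ → ℝ} {a b : ℝ} (hg : IntervalIntegrable g volume a b) :
    ∫ t in a..b, g t * Real.exp (∫ s in a..t, g s) = Real.exp (∫ s in a..b, g s) - 1 := by
  have := integral_fderiv_comp_primitive (F := Real.exp) Real.contDiff_exp
    (c := fun t => ∫ s in a..t, g s) (w := g) (a := a) (b := b) hg (by simp)
  simpa [mul_comm] using this

theorem locallyIntegrable_of_forall_intervalIntegrable {g : ℝ → ℝ}
    (hg : ∀ a b, IntervalIntegrable g volume a b) : LocallyIntegrable g := fun x =>
  ⟨Ioc (x - 1) (x + 1), Ioc_mem_nhds (by linarith) (by linarith),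
    (intervalIntegrable_iff_integrableOn_Ioc_of_le (by linarith)).1 (hg _ _)⟩

end ChainRule

/-! ### Fields with a continuous Osgood modulus -/

/-- A velocity field on `ℝ × ℝ^d`, vanishing for nonpositive times, with a continuous Osgood
modulus of continuity `Λ` in space, up to a locally integrable factor `C` in time. -/
structure OsgoodField {d : ℕ} (u : ℝ → Sp d → Sp d) (C Λ : ℝ → ℝ) : Prop where
  modulus_cont : Continuous Λ
  modulus_nonneg : ∀ r, 0 ≤ Λ r
  modulus_zero : Λ 0 = 0
  modulus_growth : ∃ K, ∀ r, Λ r ≤ K * (1 + |r|)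
  osgood : ∀ r, 0 < r → ∀ B, ∃ ε, 0 < ε ∧ B ≤ regPrimitive Λ ε r
  bound_nonneg : ∀ t, 0 ≤ C t
  bound_int : ∀ a b, IntervalIntegrable C volume a b
  meas : Measurable fun p : ℝ × Sp d => u p.1 p.2
  int_zero : ∀ a b, IntervalIntegrable (fun t => u t 0) volume a b
  mod : ∀ t x y, ‖u t x - u t y‖ ≤ C t * Λ ‖x - y‖
  zero : ∀ t, t ≤ 0 → ∀ x, u t x = 0

namespace OsgoodField

variable {d : ℕ} {u : ℝ → Sp d → Sp d} {C Λ : ℝ → ℝ}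

/-- Comparison with the value at the origin and the linear growth of `Λ`. This rules out blow-up and
makes `u` integrable in time along continuous curves. -/
theorem exists_growth (F : OsgoodField u C Λ) : ∃ g : ℝ → ℝ, (∀ t, 0 ≤ g t) ∧
    (∀ a b, IntervalIntegrable g volume a b) ∧ ∀ t x, ‖u t x‖ ≤ g t * (1 + ‖x‖) := by
  obtain ⟨K, hK⟩ := F.modulus_growth
  have hK0 : 0 ≤ K := by simpa using (F.modulus_nonneg 0).trans (hK 0)
  refine ⟨fun t => ‖u t 0‖ + K * C t, fun t => ?_, fun a b => ?_, fun t x => ?_⟩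
  · exact add_nonneg (norm_nonneg _) (mul_nonneg hK0 (F.bound_nonneg t))
  · exact (F.int_zero a b).norm.add ((F.bound_int a b).const_mul K)
  · have h1 : ‖u t x‖ ≤ ‖u t 0‖ + ‖u t x - u t 0‖ := by
      simpa using norm_add_le (u t 0) (u t x - u t 0)
    have h2 := F.mod t x 0
    have h3 := mul_le_mul_of_nonneg_left (hK ‖x - 0‖) (F.bound_nonneg t)
    rw [sub_zero, abs_of_nonneg (norm_nonneg x)] at h3
    rw [sub_zero] at h2
    nlinarith [norm_nonneg (u t 0), norm_nonneg x, mul_nonneg (norm_nonneg (u t 0)) (norm_nonneg x)]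

theorem measurable_comp (F : OsgoodField u C Λ) {c : ℝ → Sp d} (hc : Measurable c) :
    Measurable fun s => u s (c s) :=
  F.meas.comp (measurable_id.prodMk hc)

theorem intervalIntegrable_comp (F : OsgoodField u C Λ) {c : ℝ → Sp d} (hc : Continuous c)
    (a b : ℝ) : IntervalIntegrable (fun s => u s (c s)) volume a b := by
  obtain ⟨g, hg0, hgi, hg⟩ := F.exists_growth
  have h1 : IntervalIntegrable (fun s => g s * (1 + ‖c s‖)) volume a b :=
    (hgi a b).mul_continuousOn (continuous_const.add hc.norm).continuousOn
  exact h1.mono_fun (F.measurable_comp hc.measurable).aestronglyMeasurable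
    (ae_of_all _ fun s => (hg s (c s)).trans (le_abs_self _))

end OsgoodField


/-! ### Existence of trajectories by a delayed Picard scheme -/

/-- The Picard operator with delay `h`. -/
noncomputable def delayedPicard {d : ℕ} (u : ℝ → Sp d → Sp d) (h : ℝ) (x : Sp d)
    (c : ℝ → Sp d) (t : ℝ) : Sp d :=
  x + ∫ s in (0 : ℝ)..t, u s (c (s - h))

/-- The iterates of the Picard operator with delay `h`, starting from a constant function. -/
noncomputable def delayedIter {d : ℕ} (u : ℝ → Sp d → Sp d) (h : ℝ) (x : Sp d) (j : ℕ) :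
    ℝ → Sp d :=
  (delayedPicard u h x)^[j] fun _ => x

namespace OsgoodField

variable {d : ℕ} {u : ℝ → Sp d → Sp d} {C Λ : ℝ → ℝ}

/-- Osgood's estimate for two approximate solutions of the ordinary differential equation. -/
theorem abs_regPrimitive_dist_sub_le (F : OsgoodField u C Λ) {η : ℝ} (hη : 0 < η)
    {c c' w w' : ℝ → Sp d} {a b : ℝ} (hab : a ≤ b)
    (hw : IntervalIntegrable w volume a b) (hw' : IntervalIntegrable w' volume a b)
    (hc : ∀ t ∈ Icc a b, c t = c a + ∫ s in a..t, w s)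
    (hc' : ∀ t ∈ Icc a b, c' t = c' a + ∫ s in a..t, w' s)
    (hwu : ∀ s ∈ Icc a b, ‖w s - u s (c s)‖ ≤ η * C s)
    (hwu' : ∀ s ∈ Icc a b, ‖w' s - u s (c' s)‖ ≤ η * C s) :
    |regPrimitive Λ (4 * η) ‖c b - c' b‖ - regPrimitive Λ (4 * η) ‖c a - c' a‖|
      ≤ ∫ s in a..b, C s := by
  have hcont : ∀ {c w : ℝ → Sp d}, IntervalIntegrable w volume a b →
      (∀ t ∈ Icc a b, c t = c a + ∫ s in a..t, w s) → ContinuousOn c (Icc a b) :=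
    fun {c w} hw hc => by
      have := (continuousOn_const (c := c a)).add
        (intervalIntegral.continuousOn_primitive_interval' hw left_mem_uIcc)
      rw [uIcc_of_le hab] at this
      exact this.congr fun t ht => hc t ht
  have hsub : ∀ {c w : ℝ → Sp d}, IntervalIntegrable w volume a b →
      (∀ t ∈ Icc a b, c t = c a + ∫ s in a..t, w s) →
      ∀ s ∈ Icc a b, ∀ t ∈ Icc a b, c t - c s = ∫ σ in s..t, w σ :=
    fun {c w} hw hc s hs t ht => by
      rw [hc t ht, hc s hs, add_sub_add_left_eq_sub]
      rw [← uIcc_of_le hab] at hs ht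
      exact intervalIntegral.integral_interval_sub_left
        (hw.mono_set (uIcc_subset_uIcc left_mem_uIcc ht))
        (hw.mono_set (uIcc_subset_uIcc left_mem_uIcc hs))
  have hρ : ContinuousOn (fun t => ‖c t - c' t‖) (Icc a b) :=
    ((hcont hw hc).sub (hcont hw' hc')).norm
  -- Each curve solves the equation up to `η C`, so the distance obeys the hypothesis of Osgood's
  -- lemma with `ε = 2η`; that lemma doubles it once more.
  have h4 : 4 * η = 2 * (2 * η) := by ring
  rw [h4]
  refine abs_regPrimitive_comp_sub_le (ρ := fun t => ‖c t - c' t‖) F.modulus_cont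
    F.modulus_nonneg (by linarith) F.bound_nonneg F.bound_int hab hρ fun s hs t ht hst => ?_
  have hst' : Icc s t ⊆ Icc a b := Icc_subset_Icc hs.1 ht.2
  have hIst : IntervalIntegrable (fun σ => C σ * (Λ ‖c σ - c' σ‖ + 2 * η)) volume s t := by
    refine (F.bound_int s t).mul_continuousOn ?_
    rw [uIcc_of_le hst]
    exact (F.modulus_cont.comp_continuousOn (hρ.mono hst')).add continuousOn_const
  calc |‖c t - c' t‖ - ‖c s - c' s‖| ≤ ‖(c t - c' t) - (c s - c' s)‖ := abs_norm_sub_norm_le _ _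
    _ = ‖∫ σ in s..t, (w σ - w' σ)‖ := by
      have hs' := hs
      have ht' := ht
      rw [← uIcc_of_le hab] at hs' ht'
      rw [intervalIntegral.integral_sub (hw.mono_set (uIcc_subset_uIcc hs' ht'))
        (hw'.mono_set (uIcc_subset_uIcc hs' ht')), ← hsub hw hc s hs t ht,
        ← hsub hw' hc' s hs t ht]
      congr 1
      abel
    _ ≤ ∫ σ in s..t, C σ * (Λ ‖c σ - c' σ‖ + 2 * η) := by
      refine intervalIntegral.norm_integral_le_of_norm_le hst (ae_of_all _ fun σ hσ => ?_) hIst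
      have hσ' : σ ∈ Icc a b := hst' (Ioc_subset_Icc_self hσ)
      have h1 := hwu σ hσ'
      have h2 := hwu' σ hσ'
      have h3 := F.mod σ (c σ) (c' σ)
      have h5 : w σ - w' σ = (w σ - u σ (c σ)) + (u σ (c σ) - u σ (c' σ)) - (w' σ - u σ (c' σ)) := by
        abel
      rw [h5]
      refine (norm_sub_le _ _).trans ((add_le_add (norm_add_le _ _) le_rfl).trans ?_)
      linarith

section Iter

variable (F : OsgoodField u C Λ) (h : ℝ) (x : Sp d)

theorem delayedIter_succ (j : ℕ) (t : ℝ) :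
    delayedIter u h x (j + 1) t = x + ∫ s in (0 : ℝ)..t, u s (delayedIter u h x j (s - h)) := by
  simp only [delayedIter, Function.iterate_succ_apply']
  rfl

include F

theorem continuous_delayedIter (j : ℕ) : Continuous (delayedIter u h x j) := by
  induction j with
  | zero => exact continuous_const
  | succ j ih =>
    have : delayedIter u h x (j + 1) = fun t =>
        x + ∫ s in (0 : ℝ)..t, u s (delayedIter u h x j (s - h)) :=
      funext fun t => delayedIter_succ h x j t
    rw [this]
    exact continuous_const.add (intervalIntegral.continuous_primitive
      (F.intervalIntegrable_comp (ih.comp (continuous_sub_right h))) 0)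

theorem integral_comp_of_nonpos (c : ℝ → Sp d) {t : ℝ} (ht : t ≤ 0) :
    ∫ s in (0 : ℝ)..t, u s (c s) = 0 := by
  rw [intervalIntegral.integral_congr (g := fun _ => (0 : Sp d)), intervalIntegral.integral_zero]
  intro s hs
  rw [uIcc_of_ge ht] at hs
  exact F.zero s hs.2 _

theorem delayedIter_of_nonpos (j : ℕ) {t : ℝ} (ht : t ≤ 0) : delayedIter u h x j t = x := by
  cases j with
  | zero => rfl
  | succ j =>
    rw [delayedIter_succ, F.integral_comp_of_nonpos (fun s => delayedIter u h x j (s - h)) ht,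
      add_zero]

/-- The delay means that values up to time `(j + 1) h` use the previous iterate only up to `j h`.
Each iteration thus settles one more interval of length `h`, and finitely many produce an exact
solution of the delay equation on a given interval. -/
theorem delayedIter_stable (j : ℕ) :
    ∀ t ≤ j * h, delayedIter u h x (j + 1) t = delayedIter u h x j t := by
  induction j with
  | zero =>
    intro t ht
    have ht' : t ≤ 0 := by simpa using ht
    rw [F.delayedIter_of_nonpos h x _ ht', F.delayedIter_of_nonpos h x _ ht']
  | succ j ih =>
    intro t ht
    rcases le_total t 0 with ht0 | ht0
    · rw [F.delayedIter_of_nonpos h x _ ht0, F.delayedIter_of_nonpos h x _ ht0]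
    rw [delayedIter_succ, delayedIter_succ h x j]
    congr 1
    refine intervalIntegral.integral_congr fun s hs => ?_
    rw [uIcc_of_le ht0] at hs
    rw [ih (s - h) (by push_cast at ht; linarith [hs.2])]

/-- Grönwall's bound by induction on the iterates: the right-hand side solves the majorizing
integral equation `B = 1 + ‖x‖ + ∫ g B`, and the delay only decreases the argument of an increasing
majorant. -/
theorem norm_delayedIter_le {g : ℝ → ℝ} (hg0 : ∀ t, 0 ≤ g t)
    (hgi : ∀ a b, IntervalIntegrable g volume a b) (hg : ∀ t x, ‖u t x‖ ≤ g t * (1 + ‖x‖))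
    (hh : 0 < h) (j : ℕ) : ∀ t, 0 ≤ t →
      1 + ‖delayedIter u h x j t‖ ≤ (1 + ‖x‖) * Real.exp (∫ s in (0 : ℝ)..t, g s) := by
  have hG0 : ∀ t, 0 ≤ t → 0 ≤ ∫ s in (0 : ℝ)..t, g s := fun t ht =>
    intervalIntegral.integral_nonneg ht fun s _ => hg0 s
  have hx : 0 ≤ 1 + ‖x‖ := by positivity
  have hbase : ∀ t, 0 ≤ t → 1 + ‖x‖ ≤ (1 + ‖x‖) * Real.exp (∫ s in (0 : ℝ)..t, g s) :=
    fun t ht => le_mul_of_one_le_right hx (Real.one_le_exp (hG0 t ht))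
  induction j with
  | zero => exact hbase
  | succ j ih =>
    intro t ht
    have hGc : Continuous fun t => ∫ s in (0 : ℝ)..t, g s :=
      intervalIntegral.continuous_primitive hgi 0
    have hbd : ∀ s ∈ Ioc 0 t, ‖u s (delayedIter u h x j (s - h))‖ ≤
        (1 + ‖x‖) * (g s * Real.exp (∫ σ in (0 : ℝ)..s, g σ)) := fun s hs => by
      have h1 : 1 + ‖delayedIter u h x j (s - h)‖ ≤
          (1 + ‖x‖) * Real.exp (∫ σ in (0 : ℝ)..s, g σ) := by
        rcases le_total 0 (s - h) with hs' | hs'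
        · refine (ih _ hs').trans (mul_le_mul_of_nonneg_left (Real.exp_le_exp.2 ?_) hx)
          exact intervalIntegral.integral_mono_interval le_rfl hs' (by linarith)
            (ae_of_all _ hg0) (hgi _ _)
        · rw [F.delayedIter_of_nonpos h x j hs']
          exact hbase s hs.1.le
      calc _ ≤ g s * (1 + ‖delayedIter u h x j (s - h)‖) := hg _ _
        _ ≤ g s * ((1 + ‖x‖) * Real.exp (∫ σ in (0 : ℝ)..s, g σ)) :=
          mul_le_mul_of_nonneg_left h1 (hg0 s)
        _ = _ := by ring
    have hint : IntervalIntegrable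
        (fun s => (1 + ‖x‖) * (g s * Real.exp (∫ σ in (0 : ℝ)..s, g σ))) volume 0 t :=
      ((hgi 0 t).mul_continuousOn (Real.continuous_exp.comp hGc).continuousOn).const_mul _
    have h2 := intervalIntegral.norm_integral_le_of_norm_le ht (ae_of_all _ hbd) hint
    rw [intervalIntegral.integral_const_mul, integral_mul_exp_primitive (hgi 0 t)] at h2
    rw [delayedIter_succ]
    have h3 := norm_add_le x (∫ s in (0 : ℝ)..t, u s (delayedIter u h x j (s - h)))
    linarith

/-- The iterates with small delay are approximate solutions. -/
theorem exists_delay_norm_sub_le {T η : ℝ} (hT : 0 ≤ T) (hη : 0 < η) :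
    ∃ h₀ > 0, ∀ h, 0 < h → h < h₀ → ∀ j : ℕ, T ≤ j * h → ∀ s ∈ Icc 0 T,
      ‖u s (delayedIter u h x j (s - h)) - u s (delayedIter u h x j s)‖ ≤ η * C s := by
  obtain ⟨g, hg0, hgi, hg⟩ := F.exists_growth
  have hGc : Continuous fun t => ∫ s in (0 : ℝ)..t, g s :=
    intervalIntegral.continuous_primitive hgi 0
  obtain ⟨r, hr, hΛ⟩ := Metric.continuousAt_iff.1 (F.modulus_cont.continuousAt (x := 0)) η hη
  set B := (1 + ‖x‖) * Real.exp (∫ s in (0 : ℝ)..T, g s) with hB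
  have hB0 : 0 < B := by positivity
  -- With `r / B` the increment of the iterate over one delay, at most `B ∫ g`, is below `r`, where
  -- the modulus is below `η`. The interval starts at `-1` to contain `s - h` for `h < 1`.
  obtain ⟨h₀, hh₀, hu⟩ := Metric.uniformContinuousOn_iff.1
    ((isCompact_Icc (a := -1) (b := T)).uniformContinuousOn_of_continuous hGc.continuousOn)
    (r / B) (by positivity)
  refine ⟨min h₀ 1, by positivity, fun h hh hh0 j hj s hs => ?_⟩
  have hh1 : h < 1 := hh0.trans_le (min_le_right _ _)
  have hhh₀ : h < h₀ := hh0.trans_le (min_le_left _ _)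
  have hbd : ∀ σ ≤ T, 1 + ‖delayedIter u h x j (σ - h)‖ ≤ B := fun σ hσ => by
    rcases le_total 0 (σ - h) with h0 | h0
    · refine (F.norm_delayedIter_le h x hg0 hgi hg hh j _ h0).trans
        (mul_le_mul_of_nonneg_left (Real.exp_le_exp.2 ?_) (by positivity))
      exact intervalIntegral.integral_mono_interval le_rfl h0 (by linarith)
        (ae_of_all _ hg0) (hgi _ _)
    · rw [F.delayedIter_of_nonpos h x j h0]
      refine le_mul_of_one_le_right (by positivity) (Real.one_le_exp ?_)
      exact intervalIntegral.integral_nonneg hT fun s _ => hg0 s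
  have hdiff : ‖delayedIter u h x j (s - h) - delayedIter u h x j s‖ < r := by
    have e1 : delayedIter u h x j s - delayedIter u h x j (s - h) =
        ∫ σ in (s - h)..s, u σ (delayedIter u h x j (σ - h)) := by
      rw [← F.delayedIter_stable h x j s (hs.2.trans hj),
        ← F.delayedIter_stable h x j (s - h) (by linarith [hs.2]), delayedIter_succ,
        delayedIter_succ, add_sub_add_left_eq_sub]
      have hi := F.intervalIntegrable_comp
        ((F.continuous_delayedIter h x j).comp (continuous_sub_right h))
      exact intervalIntegral.integral_interval_sub_left (hi _ _) (hi _ _)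
    rw [norm_sub_rev, e1]
    have h1 := intervalIntegral.norm_integral_le_of_norm_le (μ := volume) (a := s - h) (b := s)
      (f := fun σ => u σ (delayedIter u h x j (σ - h))) (g := fun σ => B * g σ)
      (by linarith) (ae_of_all _ fun σ hσ => ?_) ((hgi _ _).const_mul B)
    · refine h1.trans_lt ?_
      rw [intervalIntegral.integral_const_mul]
      have h2 := hu s ⟨by linarith [hs.1], hs.2⟩ (s - h) ⟨by linarith [hs.1], by linarith [hs.2]⟩
        (by rw [Real.dist_eq, sub_sub_cancel, abs_of_pos hh]; exact hhh₀)
      rw [Real.dist_eq, intervalIntegral.integral_interval_sub_left (hgi _ _) (hgi _ _),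
        lt_div_iff₀ hB0] at h2
      rw [mul_comm]
      exact (mul_le_mul_of_nonneg_right (le_abs_self _) hB0.le).trans_lt h2
    · refine (hg _ _).trans ?_
      rw [mul_comm B]
      exact mul_le_mul_of_nonneg_left (hbd σ (hσ.2.trans hs.2)) (hg0 σ)
  refine (F.mod s _ _).trans ?_
  rw [mul_comm]
  refine mul_le_mul_of_nonneg_right ?_ (F.bound_nonneg s)
  have := @hΛ ‖delayedIter u h x j (s - h) - delayedIter u h x j s‖
    (by rw [Real.dist_eq, sub_zero, abs_of_nonneg (norm_nonneg _)]; exact hdiff)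
  rw [F.modulus_zero, Real.dist_eq, sub_zero] at this
  exact (le_abs_self _).trans this.le

/-- Osgood's criterion: a distance whose image under all the regularized primitives is bounded
by `B` up to small errors is small. -/
theorem exists_forall_lt_of_regPrimitive_le {r : ℝ} (hr : 0 < r) (B : ℝ) :
    ∃ ε > 0, ∀ ε', 0 < ε' → ε' ≤ ε → ∀ s, 0 ≤ s → regPrimitive Λ ε' s ≤ B → s < r := by
  obtain ⟨ε, hε, hB⟩ := F.osgood r hr (B + 1)
  refine ⟨ε, hε, fun ε' hε' hle s _ hsB => lt_of_not_ge fun hrs => ?_⟩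
  have h1 := regPrimitive_mono F.modulus_cont F.modulus_nonneg hε' hrs
  have h2 := regPrimitive_anti F.modulus_cont F.modulus_nonneg hε' hle hr.le
  linarith

/-- Existence of solutions of the ordinary differential equation. -/
theorem exists_solution : ∃ c : ℝ → Sp d, Continuous c ∧
    ∀ t, c t = x + ∫ s in (0 : ℝ)..t, u s (c s) := by
  let H : ℕ → ℝ := fun n => 1 / ((n : ℝ) + 1)
  have hH0 : ∀ n, 0 < H n := fun n => by positivity
  -- With delay `1 / (n + 1)`, this many iterations settle the solution up to time `n + 1`, so every
  -- bounded interval is eventually covered.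
  let J : ℕ → ℕ := fun n => (n + 1) ^ 2
  have hJH : ∀ n, (J n : ℝ) * H n = n + 1 := fun n => by
    simp only [J, H]; push_cast; field_simp
  let c : ℕ → ℝ → Sp d := fun n => delayedIter u (H n) x (J n)
  have hcc : ∀ n, Continuous (c n) := fun n => F.continuous_delayedIter _ x _
  have hc0 : ∀ n t, t ≤ 0 → c n t = x := fun n t ht => F.delayedIter_of_nonpos _ x _ ht
  let w : ℕ → ℝ → Sp d := fun n s => u s (c n (s - H n))
  have hwi : ∀ n a b, IntervalIntegrable (w n) volume a b := fun n =>
    F.intervalIntegrable_comp ((hcc n).comp (continuous_sub_right _))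
  have happrox : ∀ T η, 0 ≤ T → 0 < η → ∃ N : ℕ, ∀ n ≥ N,
      (∀ t ≤ T, c n t = x + ∫ s in (0 : ℝ)..t, w n s) ∧
      ∀ s ∈ Icc 0 T, ‖w n s - u s (c n s)‖ ≤ η * C s := fun T η hT hη => by
    obtain ⟨h₀, hh₀, hh⟩ := F.exists_delay_norm_sub_le x hT hη
    obtain ⟨N₁, hN₁⟩ := exists_nat_one_div_lt hh₀
    obtain ⟨N₂, hN₂⟩ := exists_nat_ge T
    refine ⟨max N₁ N₂, fun n hn => ?_⟩
    have hnT : T ≤ J n * H n := by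
      rw [hJH]
      have : (N₂ : ℝ) ≤ n := by exact_mod_cast (le_max_right _ _).trans hn
      linarith
    refine ⟨fun t ht => ?_, hh (H n) (hH0 n) ((one_div_le_one_div_of_le (by positivity) ?_).trans_lt
      hN₁) (J n) hnT⟩
    · rw [← delayedIter_succ]
      exact (F.delayedIter_stable (H n) x (J n) t (ht.trans hnT)).symm
    · have : (N₁ : ℝ) ≤ n := by exact_mod_cast (le_max_left _ _).trans hn
      linarith
  have hcauchy : ∀ T r, 0 ≤ T → 0 < r → ∃ N, ∀ n ≥ N, ∀ m ≥ N, ∀ t ≤ T,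
      ‖c n t - c m t‖ < r := fun T r hT hr => by
    -- Two approximants start at the same point, so `A_ε` of their distance is at most `∫ C`.
    -- Defects `(ε / 4) C` are what the comparison allows at level `ε`.
    obtain ⟨ε, hε, hεr⟩ := F.exists_forall_lt_of_regPrimitive_le hr (∫ s in (0 : ℝ)..T, C s)
    obtain ⟨N, hN⟩ := happrox T (ε / 4) hT (by positivity)
    refine ⟨N, fun n hn m hm t ht => ?_⟩
    rcases le_total t 0 with ht0 | ht0
    · rw [hc0 n t ht0, hc0 m t ht0]; simpa using hr
    refine hεr ε hε le_rfl _ (norm_nonneg _) ?_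
    have hsub : Icc 0 t ⊆ Icc 0 T := Icc_subset_Icc_right ht
    have := F.abs_regPrimitive_dist_sub_le (η := ε / 4) (by positivity) ht0 (hwi n _ _)
      (hwi m _ _) (c := c n) (c' := c m)
      (fun s hs => by rw [hc0 n 0 le_rfl]; exact (hN n hn).1 s (hsub hs).2)
      (fun s hs => by rw [hc0 m 0 le_rfl]; exact (hN m hm).1 s (hsub hs).2)
      (fun s hs => (hN n hn).2 s (hsub hs)) (fun s hs => (hN m hm).2 s (hsub hs))
    rw [hc0 n 0 le_rfl, hc0 m 0 le_rfl, sub_self, norm_zero, regPrimitive_zero, sub_zero,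
      mul_div_cancel₀ _ (by norm_num : (4 : ℝ) ≠ 0)] at this
    refine (le_abs_self _).trans (this.trans ?_)
    exact intervalIntegral.integral_mono_interval le_rfl ht0 ht (ae_of_all _ F.bound_nonneg)
      (F.bound_int _ _)
  have hlim : ∀ t, ∃ l, Tendsto (fun n => c n t) atTop (𝓝 l) := fun t => by
    refine cauchySeq_tendsto_of_complete (Metric.cauchySeq_iff.2 fun r hr => ?_)
    obtain ⟨N, hN⟩ := hcauchy (max t 0) r (le_max_right _ _) hr
    exact ⟨N, fun n hn m hm => by rw [dist_eq_norm]; exact hN n hn m hm t (le_max_left _ _)⟩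
  choose l hl using hlim
  have hunif : ∀ T r, 0 ≤ T → 0 < r → ∃ N, ∀ n ≥ N, ∀ t ≤ T, ‖c n t - l t‖ ≤ r :=
    fun T r hT hr => by
      obtain ⟨N, hN⟩ := hcauchy T r hT hr
      refine ⟨N, fun n hn t ht => ?_⟩
      refine le_of_tendsto ((tendsto_const_nhds.sub (hl t)).norm) ?_
      filter_upwards [eventually_ge_atTop N] with m hm using (hN n hn m hm t ht).le
  have hlc : Continuous l := by
    have : TendstoLocallyUniformly c l atTop := by
      rw [Metric.tendstoLocallyUniformly_iff]
      intro r hr t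
      refine ⟨Iio (max t 0 + 1), Iio_mem_nhds (by linarith [le_max_left t 0]), ?_⟩
      obtain ⟨N, hN⟩ := hunif (max t 0 + 1) (r / 2) (by positivity) (half_pos hr)
      filter_upwards [eventually_ge_atTop N] with n hn s hs
      rw [dist_comm, dist_eq_norm]
      exact (hN n hn s (le_of_lt hs)).trans_lt (half_lt_self hr)
    exact this.continuous (Frequently.of_forall hcc)
  refine ⟨l, hlc, fun t => ?_⟩
  rcases le_total t 0 with ht | ht
  · rw [F.integral_comp_of_nonpos l ht, add_zero]
    refine tendsto_nhds_unique (hl t) ?_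
    simp only [hc0 _ t ht]
    exact tendsto_const_nhds
  refine tendsto_nhds_unique (hl t) (tendsto_iff_norm_sub_tendsto_zero.2 ?_)
  have hI0 : 0 ≤ ∫ s in (0 : ℝ)..t, C s :=
    intervalIntegral.integral_nonneg ht fun s _ => F.bound_nonneg s
  rw [Metric.tendsto_atTop]
  intro r hr
  -- One `q C` pays for the defect of the delay equation, another for replacing `c n` by its limit
  -- inside `u`; the total `2 q ∫ C` stays below `r`.
  set q := r / (2 * (1 + ∫ s in (0 : ℝ)..t, C s)) with hq
  have hq0 : 0 < q := by positivity
  obtain ⟨N₁, hN₁⟩ := happrox t q ht hq0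
  obtain ⟨δ, hδ, hΛ⟩ := Metric.continuousAt_iff.1 (F.modulus_cont.continuousAt (x := 0)) q hq0
  obtain ⟨N₂, hN₂⟩ := hunif t (δ / 2) ht (half_pos hδ)
  refine ⟨max N₁ N₂, fun n hn => ?_⟩
  obtain ⟨h1, h2⟩ := hN₁ n ((le_max_left _ _).trans hn)
  have h3 := hN₂ n ((le_max_right _ _).trans hn)
  rw [Real.dist_eq, sub_zero, abs_norm, h1 t le_rfl, add_sub_add_left_eq_sub,
    ← intervalIntegral.integral_sub (hwi n _ _) (F.intervalIntegrable_comp hlc _ _)]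
  have h4 := intervalIntegral.norm_integral_le_of_norm_le (μ := volume) (a := 0) (b := t)
    (f := fun s => w n s - u s (l s)) (g := fun s => 2 * q * C s) ht
    (ae_of_all _ fun s hs => ?_) ((F.bound_int _ _).const_mul _)
  · rw [intervalIntegral.integral_const_mul] at h4
    refine h4.trans_lt ?_
    rw [hq]
    have : 2 * (r / (2 * (1 + ∫ s in (0 : ℝ)..t, C s))) * ∫ s in (0 : ℝ)..t, C s =
        r * ((∫ s in (0 : ℝ)..t, C s) / (1 + ∫ s in (0 : ℝ)..t, C s)) := by
      field_simp
    rw [this]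
    refine mul_lt_of_lt_one_right hr ((div_lt_one (by linarith)).2 (by linarith))
  · have h5 := h2 s (Ioc_subset_Icc_self hs)
    have h6 := F.mod s (c n s) (l s)
    have h7 : Λ ‖c n s - l s‖ ≤ q := by
      have := @hΛ ‖c n s - l s‖ (by
        rw [Real.dist_eq, sub_zero, abs_norm]; linarith [h3 s hs.2])
      rw [F.modulus_zero, Real.dist_eq, sub_zero] at this
      exact (le_abs_self _).trans this.le
    have h8 := mul_le_mul_of_nonneg_left h7 (F.bound_nonneg s)
    calc ‖w n s - u s (l s)‖ ≤ ‖w n s - u s (c n s)‖ + ‖u s (c n s) - u s (l s)‖ :=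
          norm_sub_le_norm_sub_add_norm_sub _ _ _
      _ ≤ 2 * q * C s := by linarith

end Iter

end OsgoodField


/-! ### The flow and its inverse -/

namespace OsgoodField

variable {d : ℕ} {u : ℝ → Sp d → Sp d} {C Λ : ℝ → ℝ}

/-- Both curves solve the equation without defect from the same point, so `A_ε` of their distance is
at most `∫ C` for all `ε`, which forces the distance to vanish. -/
theorem eq_of_isTrajectory (F : OsgoodField u C Λ) {T : ℝ} {x : Sp d} {c c' : ℝ → Sp d}
    (hc : IsTrajectory u T x c) (hc' : IsTrajectory u T x c') : ∀ t ∈ Icc 0 T, c t = c' t := by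
  intro t ht
  have hT : 0 ≤ T := ht.1.trans ht.2
  have h0 : ∀ {c : ℝ → Sp d}, IsTrajectory u T x c → c 0 = x := fun h => by
    simpa using h.eqn 0 ⟨le_rfl, hT⟩
  have hmono : ∀ {c : ℝ → Sp d}, IsTrajectory u T x c →
      IntervalIntegrable (fun s => u s (c s)) volume 0 t := fun h =>
    h.integrable.mono_set (by rw [uIcc_of_le hT, uIcc_of_le ht.1]; exact Icc_subset_Icc_right ht.2)
  rw [← sub_eq_zero, ← norm_le_zero_iff]
  refine le_of_forall_pos_lt_add fun r hr => ?_
  rw [zero_add]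
  obtain ⟨ε, hε, hεr⟩ := F.exists_forall_lt_of_regPrimitive_le hr (∫ s in (0 : ℝ)..t, C s)
  have hC : ∀ s ∈ Icc 0 t, 0 ≤ ε / 4 * C s := fun s _ =>
    mul_nonneg (by positivity) (F.bound_nonneg s)
  have := F.abs_regPrimitive_dist_sub_le (η := ε / 4) (by positivity) ht.1 (hmono hc) (hmono hc')
    (c := c) (c' := c')
    (fun s hs => by rw [h0 hc]; exact hc.eqn s ⟨hs.1, hs.2.trans ht.2⟩)
    (fun s hs => by rw [h0 hc']; exact hc'.eqn s ⟨hs.1, hs.2.trans ht.2⟩)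
    (by simpa using hC) (by simpa using hC)
  rw [h0 hc, h0 hc', sub_self, norm_zero, regPrimitive_zero, sub_zero,
    mul_div_cancel₀ _ (by norm_num : (4 : ℝ) ≠ 0)] at this
  exact hεr ε hε le_rfl _ (norm_nonneg _) ((le_abs_self _).trans this)

/-- The flow map of an Osgood field, started at time `0`. -/
noncomputable def flowMap (F : OsgoodField u C Λ) (t : ℝ) (x : Sp d) : Sp d :=
  (F.exists_solution x).choose t

theorem continuous_flowMap_time (F : OsgoodField u C Λ) (x : Sp d) :
    Continuous fun t => F.flowMap t x :=
  (F.exists_solution x).choose_spec.1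

theorem flowMap_eq (F : OsgoodField u C Λ) (t : ℝ) (x : Sp d) :
    F.flowMap t x = x + ∫ s in (0 : ℝ)..t, u s (F.flowMap s x) :=
  (F.exists_solution x).choose_spec.2 t

theorem flowMap_integrable (F : OsgoodField u C Λ) (x : Sp d) (a b : ℝ) :
    IntervalIntegrable (fun s => u s (F.flowMap s x)) volume a b :=
  F.intervalIntegrable_comp (F.continuous_flowMap_time x) a b

theorem flowMap_sub (F : OsgoodField u C Λ) (s t : ℝ) (x : Sp d) :
    F.flowMap t x - F.flowMap s x = ∫ σ in s..t, u σ (F.flowMap σ x) := by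
  rw [F.flowMap_eq t, F.flowMap_eq s, add_sub_add_left_eq_sub]
  exact intervalIntegral.integral_interval_sub_left (F.flowMap_integrable x _ _)
    (F.flowMap_integrable x _ _)

theorem flowMap_of_nonpos (F : OsgoodField u C Λ) {t : ℝ} (ht : t ≤ 0) (x : Sp d) :
    F.flowMap t x = x := by
  rw [F.flowMap_eq, F.integral_comp_of_nonpos (fun s => F.flowMap s x) ht, add_zero]

theorem isTrajectory_flowMap (F : OsgoodField u C Λ) (T : ℝ) (x : Sp d) :
    IsTrajectory u T x fun t => F.flowMap t x where
  cont := (F.continuous_flowMap_time x).continuousOn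
  integrable := F.flowMap_integrable x _ _
  eqn t _ := F.flowMap_eq t x

/-- The right-hand side depends neither on `ε` nor on the starting points, and the absolute value
makes the estimate serve the inverse flow as well. -/
theorem abs_regPrimitive_flowMap_sub_le (F : OsgoodField u C Λ) {ε : ℝ} (hε : 0 < ε) {s t : ℝ}
    (hst : s ≤ t) (x y : Sp d) :
    |regPrimitive Λ ε ‖F.flowMap t x - F.flowMap t y‖ -
      regPrimitive Λ ε ‖F.flowMap s x - F.flowMap s y‖| ≤ ∫ σ in s..t, C σ := by
  have hC : ∀ σ ∈ Icc s t, 0 ≤ ε / 4 * C σ := fun σ _ =>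
    mul_nonneg (by positivity) (F.bound_nonneg σ)
  have := F.abs_regPrimitive_dist_sub_le (η := ε / 4) (by positivity) hst
    (F.flowMap_integrable x s t) (F.flowMap_integrable y s t)
    (c := fun t => F.flowMap t x) (c' := fun t => F.flowMap t y)
    (fun σ _ => by rw [← F.flowMap_sub, add_sub_cancel])
    (fun σ _ => by rw [← F.flowMap_sub, add_sub_cancel])
    (by simpa using hC) (by simpa using hC)
  rwa [mul_div_cancel₀ _ (by norm_num : (4 : ℝ) ≠ 0)] at this

theorem abs_regPrimitive_flowMap_sub_le_zero (F : OsgoodField u C Λ) {ε : ℝ} (hε : 0 < ε)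
    {t T : ℝ} (hT : 0 ≤ T) (ht : t ≤ T) (x y : Sp d) :
    |regPrimitive Λ ε ‖F.flowMap t x - F.flowMap t y‖ - regPrimitive Λ ε ‖x - y‖| ≤
      ∫ σ in (0 : ℝ)..T, C σ := by
  rcases le_total t 0 with h | h
  · rw [F.flowMap_of_nonpos h, F.flowMap_of_nonpos h, sub_self, abs_zero]
    exact intervalIntegral.integral_nonneg hT fun s _ => F.bound_nonneg s
  · have := F.abs_regPrimitive_flowMap_sub_le hε h x y
    rw [F.flowMap_of_nonpos le_rfl, F.flowMap_of_nonpos le_rfl] at this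
    exact this.trans (intervalIntegral.integral_mono_interval le_rfl h ht
      (ae_of_all _ F.bound_nonneg) (F.bound_int _ _))

/-- The flow maps and their inverses are uniformly equicontinuous on bounded time intervals. -/
theorem exists_flowMap_modulus (F : OsgoodField u C Λ) {T r : ℝ} (hT : 0 ≤ T) (hr : 0 < r) :
    ∃ δ > 0, ∀ t ≤ T, ∀ x y,
      (‖x - y‖ < δ → ‖F.flowMap t x - F.flowMap t y‖ < r) ∧
      (‖F.flowMap t x - F.flowMap t y‖ < δ → ‖x - y‖ < r) := by
  obtain ⟨ε, hε, hεr⟩ := F.exists_forall_lt_of_regPrimitive_le hr ((∫ s in (0 : ℝ)..T, C s) + 1)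
  -- The integrand is at most `1 / ε`, so distances below `ε` cost at most `1`. This is the extra
  -- `1` in the bound above, and `ε` itself can serve as `δ`.
  have hlt : ∀ z : Sp d, ‖z‖ < ε → regPrimitive Λ ε ‖z‖ ≤ 1 := fun z hz => by
    have := abs_regPrimitive_sub_le' F.modulus_cont F.modulus_nonneg hε ‖z‖ 0
    rw [regPrimitive_zero, sub_zero, sub_zero, abs_norm] at this
    refine (le_abs_self _).trans (this.trans ?_)
    rw [inv_mul_le_iff₀ hε]; linarith
  refine ⟨ε, hε, fun t ht x y => ?_⟩
  have h := abs_le.1 (F.abs_regPrimitive_flowMap_sub_le_zero hε hT ht x y)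
  refine ⟨fun hxy => ?_, fun hxy => ?_⟩
  · have := hlt _ hxy
    exact hεr ε hε le_rfl _ (norm_nonneg _) (by linarith)
  · have := hlt _ hxy
    exact hεr ε hε le_rfl _ (norm_nonneg _) (by linarith)

theorem flowMap_injective (F : OsgoodField u C Λ) (t : ℝ) : Function.Injective (F.flowMap t) := by
  intro x y hxy
  rw [← sub_eq_zero, ← norm_le_zero_iff]
  refine le_of_forall_pos_lt_add fun r hr => ?_
  obtain ⟨δ, hδ, h⟩ := F.exists_flowMap_modulus (le_max_right t 0) hr
  rw [zero_add]
  exact (h t (le_max_left _ _) x y).2 (by rw [hxy, sub_self, norm_zero]; exact hδ)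

/-- The time reversal of an Osgood field. -/
theorem reverse (F : OsgoodField u C Λ) (T : ℝ) :
    OsgoodField (fun s y => if 0 < s then -u (T - s) y else 0) (fun s => C (T - s)) Λ where
  modulus_cont := F.modulus_cont
  modulus_nonneg := F.modulus_nonneg
  modulus_zero := F.modulus_zero
  modulus_growth := F.modulus_growth
  osgood := F.osgood
  bound_nonneg t := F.bound_nonneg _
  bound_int a b := by simpa using (F.bound_int (T - a) (T - b)).comp_sub_left T
  meas := by
    refine Measurable.ite (measurableSet_lt measurable_const measurable_fst) ?_ measurable_const
    exact (F.meas.comp ((measurable_const.sub measurable_fst).prodMk measurable_snd)).neg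
  int_zero a b := by
    have h1 : IntervalIntegrable (fun s => -u (T - s) 0) volume a b := by
      have := ((F.int_zero (T - a) (T - b)).comp_sub_left T).neg
      simp only [sub_sub_cancel] at this
      exact this
    rw [intervalIntegrable_iff] at h1 ⊢
    exact Integrable.indicator (s := Ioi 0) h1 measurableSet_Ioi
  mod t x y := by
    by_cases h : 0 < t
    · simp only [h, if_true, neg_sub_neg]
      rw [norm_sub_rev]
      exact F.mod _ _ _
    · simp only [h, if_false, sub_self, norm_zero]
      exact mul_nonneg (F.bound_nonneg _) (F.modulus_nonneg _)
  zero t ht x := by simp [not_lt.2 ht]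

/-- A trajectory of the time-reversed field from `y`, read backwards, solves the original equation
and ends at `y`; by uniqueness it is the flow line of its own starting point. -/
theorem flowMap_surjective (F : OsgoodField u C Λ) (T : ℝ) :
    Function.Surjective (F.flowMap T) := by
  intro y
  rcases le_total T 0 with hT | hT
  · exact ⟨y, F.flowMap_of_nonpos hT y⟩
  have hF := F.reverse T
  set b : ℝ → Sp d := fun s => hF.flowMap s y with hb
  have hbc : Continuous b := hF.continuous_flowMap_time y
  have htraj : IsTrajectory u T (b T) fun t => b (T - t) := by
    refine ⟨(hbc.comp (continuous_const.sub continuous_id)).continuousOn,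
      F.intervalIntegrable_comp (hbc.comp (continuous_const.sub continuous_id)) _ _,
      fun t ht => ?_⟩
    have h1 : b T - b (T - t) = ∫ s in (T - t)..T, -u (T - s) (b s) := by
      rw [hb, hF.flowMap_sub]
      refine intervalIntegral.integral_congr_ae (ae_of_all _ fun s hs => ?_)
      rw [uIoc_of_le (by linarith [ht.1])] at hs
      have : 0 < s := by linarith [hs.1, ht.2]
      simp [this]
    have h2 := intervalIntegral.integral_comp_sub_left (a := T - t) (b := T)
      (fun s => u s (b (T - s))) T
    simp only [sub_sub_cancel, sub_self] at h2
    rw [intervalIntegral.integral_neg, h2] at h1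
    change b (T - t) = b T + ∫ s in (0 : ℝ)..t, u s (b (T - s))
    have h3 : ∫ s in (0 : ℝ)..t, u s (b (T - s)) = b (T - t) - b T := by
      rw [← neg_sub (b T), h1, neg_neg]
    rw [h3, add_sub_cancel]
  refine ⟨b T, ?_⟩
  rw [F.eq_of_isTrajectory (F.isTrajectory_flowMap T (b T)) htraj T ⟨hT, le_rfl⟩, sub_self, hb]
  exact hF.flowMap_of_nonpos le_rfl y

theorem flowMap_bijective (F : OsgoodField u C Λ) (t : ℝ) : Function.Bijective (F.flowMap t) :=
  ⟨F.flowMap_injective t, F.flowMap_surjective t⟩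

/-- The flow of an Osgood field, as a family of homeomorphisms. -/
noncomputable def flow (F : OsgoodField u C Λ) (t : ℝ) : Sp d ≃ₜ Sp d where
  toEquiv := Equiv.ofBijective (F.flowMap t) (F.flowMap_bijective t)
  continuous_toFun := by
    change Continuous (F.flowMap t)
    refine Metric.continuous_iff.2 fun x r hr => ?_
    obtain ⟨δ, hδ, h⟩ := F.exists_flowMap_modulus (le_max_right t 0) hr
    refine ⟨δ, hδ, fun y hy => ?_⟩
    rw [dist_eq_norm] at hy ⊢
    exact (h t (le_max_left _ _) y x).1 hy
  continuous_invFun := by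
    refine Metric.continuous_iff.2 fun x r hr => ?_
    obtain ⟨δ, hδ, h⟩ := F.exists_flowMap_modulus (le_max_right t 0) hr
    refine ⟨δ, hδ, fun y hy => ?_⟩
    obtain ⟨x', rfl⟩ := F.flowMap_surjective t x
    obtain ⟨y', rfl⟩ := F.flowMap_surjective t y
    rw [dist_eq_norm] at hy ⊢
    have h1 : ∀ z, (Equiv.ofBijective (F.flowMap t) (F.flowMap_bijective t)).invFun
        (F.flowMap t z) = z :=
      fun z => (Equiv.ofBijective (F.flowMap t) (F.flowMap_bijective t)).symm_apply_apply z
    rw [h1, h1]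
    exact (h t (le_max_left _ _) y' x').2 hy

@[simp] theorem flow_apply (F : OsgoodField u C Λ) (t : ℝ) (x : Sp d) :
    F.flow t x = F.flowMap t x := rfl

theorem continuous_flow (F : OsgoodField u C Λ) :
    Continuous fun p : ℝ × Sp d => F.flow p.1 p.2 := by
  refine continuous_iff_continuousAt.2 fun ⟨t₀, x₀⟩ => ?_
  rw [Metric.continuousAt_iff']
  intro r hr
  obtain ⟨δ, hδ, h⟩ := F.exists_flowMap_modulus (T := max t₀ 0 + 1) (by positivity) (half_pos hr)
  have h1 := Metric.continuousAt_iff'.1 ((F.continuous_flowMap_time x₀).continuousAt (x := t₀)) _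
    (half_pos hr)
  have h2 : ∀ᶠ p : ℝ × Sp d in 𝓝 (t₀, x₀), p.1 < max t₀ 0 + 1 :=
    continuous_fst.continuousAt.eventually (Iio_mem_nhds (by
      simpa using (le_max_left t₀ 0).trans_lt (lt_add_one _)))
  have h3 : ∀ᶠ p : ℝ × Sp d in 𝓝 (t₀, x₀), ‖p.2 - x₀‖ < δ := by
    have : Continuous fun p : ℝ × Sp d => ‖p.2 - x₀‖ := by fun_prop
    exact this.continuousAt.eventually (Iio_mem_nhds (by simpa using hδ))
  filter_upwards [continuous_fst.continuousAt.eventually h1, h2, h3] with p hp1 hp2 hp3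
  have h4 := (h p.1 hp2.le p.2 x₀).1 hp3
  rw [dist_eq_norm] at hp1 ⊢
  simp only [flow_apply]
  calc ‖F.flowMap p.1 p.2 - F.flowMap t₀ x₀‖
      ≤ ‖F.flowMap p.1 p.2 - F.flowMap p.1 x₀‖ + ‖F.flowMap p.1 x₀ - F.flowMap t₀ x₀‖ :=
        norm_sub_le_norm_sub_add_norm_sub _ _ _
    _ < r / 2 + r / 2 := add_lt_add h4 hp1
    _ = r := add_halves r

/-- If `y` is close to `φ_t(x₀)`, the backward half of `exists_flowMap_modulus` puts `φ_t⁻¹(y)`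
close to `x₀`, uniformly in `t`. Joint continuity of the flow supplies the first closeness. -/
theorem continuous_flow_symm (F : OsgoodField u C Λ) :
    Continuous fun p : ℝ × Sp d => (F.flow p.1).symm p.2 := by
  refine continuous_iff_continuousAt.2 fun ⟨t₀, y₀⟩ => ?_
  rw [Metric.continuousAt_iff']
  intro r hr
  obtain ⟨δ, hδ, h⟩ := F.exists_flowMap_modulus (T := max t₀ 0 + 1) (by positivity) hr
  obtain ⟨x₀, rfl⟩ := (F.flow t₀).surjective y₀
  have h1 : ∀ᶠ p : ℝ × Sp d in 𝓝 (t₀, F.flow t₀ x₀), ‖p.2 - F.flow p.1 x₀‖ < δ := by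
    have : Continuous fun p : ℝ × Sp d => ‖p.2 - F.flow p.1 x₀‖ :=
      (continuous_snd.sub (F.continuous_flow.comp (continuous_fst.prodMk continuous_const))).norm
    exact this.continuousAt.eventually (Iio_mem_nhds (by simpa using hδ))
  have h2 : ∀ᶠ p : ℝ × Sp d in 𝓝 (t₀, F.flow t₀ x₀), p.1 < max t₀ 0 + 1 :=
    continuous_fst.continuousAt.eventually (Iio_mem_nhds (by
      simpa using (le_max_left t₀ 0).trans_lt (lt_add_one _)))
  filter_upwards [h1, h2] with p hp1 hp2
  obtain ⟨x, hx⟩ := (F.flow p.1).surjective p.2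
  rw [← hx] at hp1 ⊢
  simp only [Homeomorph.symm_apply_apply]
  rw [dist_eq_norm]
  exact (h p.1 hp2.le x x₀).2 hp1

end OsgoodField


/-! ### Sup-convolution of transported functions -/

namespace OsgoodField

variable {d : ℕ} {u : ℝ → Sp d → Sp d} {C Λ : ℝ → ℝ}

/-- The sup-convolution of the function `χ ∘ φ_t⁻¹` with respect to the cost
`δ ∫₀^{|y-z|} ds / (Λ(s) + ε)`. -/
noncomputable def supConv (F : OsgoodField u C Λ) (χ : Sp d → ℝ) (δ ε t : ℝ) (y : Sp d) : ℝ :=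
  ⨆ x, (χ x - δ * regPrimitive Λ ε ‖y - F.flow t x‖)

section SupConv

variable (F : OsgoodField u C Λ) {χ : Sp d → ℝ} {m δ ε : ℝ}
include F

theorem sub_le_bound (hm : ∀ x, |χ x| ≤ m) (hδ : 0 < δ) (hε : 0 < ε) (t : ℝ) (y x : Sp d) :
    χ x - δ * regPrimitive Λ ε ‖y - F.flow t x‖ ≤ m := by
  have h1 := mul_nonneg hδ.le
    (regPrimitive_nonneg F.modulus_cont F.modulus_nonneg hε (norm_nonneg (y - F.flow t x)))
  linarith [(le_abs_self _).trans (hm x)]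

theorem le_supConv (hm : ∀ x, |χ x| ≤ m) (hδ : 0 < δ) (hε : 0 < ε) (t : ℝ) (y x : Sp d) :
    χ x - δ * regPrimitive Λ ε ‖y - F.flow t x‖ ≤ F.supConv χ δ ε t y :=
  le_ciSup (f := fun x => χ x - δ * regPrimitive Λ ε ‖y - F.flow t x‖)
    ⟨m, forall_mem_range.2 (F.sub_le_bound hm hδ hε t y)⟩ x

theorem comp_symm_le_supConv (hm : ∀ x, |χ x| ≤ m) (hδ : 0 < δ) (hε : 0 < ε) (t : ℝ) (y : Sp d) :
    χ ((F.flow t).symm y) ≤ F.supConv χ δ ε t y := by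
  simpa using F.le_supConv hm hδ hε t y ((F.flow t).symm y)

theorem abs_supConv_sub_le (hm : ∀ x, |χ x| ≤ m) (hδ : 0 < δ) (hε : 0 < ε) (t : ℝ)
    (y y' : Sp d) : |F.supConv χ δ ε t y - F.supConv χ δ ε t y'| ≤ δ * ε⁻¹ * ‖y - y'‖ := by
  have key : ∀ y y', F.supConv χ δ ε t y ≤ F.supConv χ δ ε t y' + δ * ε⁻¹ * ‖y - y'‖ :=
    fun y y' => by
      refine ciSup_le fun x => ?_
      have h1 := F.le_supConv hm hδ hε t y' x
      have h2 := abs_regPrimitive_sub_le' F.modulus_cont F.modulus_nonneg hε ‖y - F.flow t x‖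
        ‖y' - F.flow t x‖
      have h3 : |‖y - F.flow t x‖ - ‖y' - F.flow t x‖| ≤ ‖y - y'‖ := by
        simpa using abs_norm_sub_norm_le (y - F.flow t x) (y' - F.flow t x)
      have h4 : -(ε⁻¹ * ‖y - y'‖) ≤
          regPrimitive Λ ε ‖y - F.flow t x‖ - regPrimitive Λ ε ‖y' - F.flow t x‖ :=
        (abs_le.1 (h2.trans (mul_le_mul_of_nonneg_left h3 (inv_nonneg.2 hε.le)))).1
      have h5 := mul_le_mul_of_nonneg_left h4 hδ.le
      linarith
  have h1 := key y y'
  have h2 := key y' y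
  rw [norm_sub_rev] at h2
  exact abs_le.2 ⟨by linarith, by linarith⟩

/-- When the base point moves with the flow, Osgood's estimate says that the cost of each competitor
changes by at most `δ ∫ C`. This is the reason for the choice of cost. -/
theorem abs_supConv_flow_sub_le (hm : ∀ x, |χ x| ≤ m) (hδ : 0 < δ) (hε : 0 < ε) {s t : ℝ}
    (hst : s ≤ t) (x : Sp d) :
    |F.supConv χ δ ε t (F.flow t x) - F.supConv χ δ ε s (F.flow s x)| ≤ δ * ∫ σ in s..t, C σ := by
  have h := fun x' => abs_le.1 (F.abs_regPrimitive_flowMap_sub_le hε hst x x')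
  have h1 : F.supConv χ δ ε t (F.flow t x) ≤
      F.supConv χ δ ε s (F.flow s x) + δ * ∫ σ in s..t, C σ := by
    refine ciSup_le fun x' => ?_
    have h2 := F.le_supConv hm hδ hε s (F.flow s x) x'
    have h3 := mul_le_mul_of_nonneg_left (h x').1 hδ.le
    simp only [flow_apply] at *
    linarith
  have h2 : F.supConv χ δ ε s (F.flow s x) ≤
      F.supConv χ δ ε t (F.flow t x) + δ * ∫ σ in s..t, C σ := by
    refine ciSup_le fun x' => ?_
    have h2 := F.le_supConv hm hδ hε t (F.flow t x) x'
    have h3 := mul_le_mul_of_nonneg_left (h x').2 hδ.le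
    simp only [flow_apply] at *
    linarith
  exact abs_le.2 ⟨by linarith, by linarith⟩

/-- Competitors at distance at least `R` pay `2m`, so their value is at most `-m`, which is at most
`χ (φ_t⁻¹ y)`. Only nearby competitors matter. -/
theorem supConv_le (hm : ∀ x, |χ x| ≤ m) (hδ : 0 < δ) (hε : 0 < ε) {R b t : ℝ} {y : Sp d}
    (hR : 0 < R) (hA : 2 * m ≤ δ * regPrimitive Λ ε R)
    (h : ∀ x, ‖y - F.flow t x‖ < R → χ x ≤ b) : F.supConv χ δ ε t y ≤ b := by
  refine ciSup_le fun x => ?_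
  rcases lt_or_ge ‖y - F.flow t x‖ R with hx | hx
  · have h1 := mul_nonneg hδ.le
      (regPrimitive_nonneg F.modulus_cont F.modulus_nonneg hε (norm_nonneg (y - F.flow t x)))
    linarith [h x hx]
  · have h1 := mul_le_mul_of_nonneg_left
      (regPrimitive_mono F.modulus_cont F.modulus_nonneg hε hx) hδ.le
    have h2 := h ((F.flow t).symm y) (by simpa using hR)
    linarith [(abs_le.1 (hm x)).2, (abs_le.1 (hm ((F.flow t).symm y))).1]

/-- A function which is uniformly Lipschitz in space and almost constant along the trajectories
is continuous. -/
theorem continuous_of_lipschitz_of_flow {ψ : ℝ → Sp d → ℝ} {K : ℝ}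
    (hK : ∀ t y y', |ψ t y - ψ t y'| ≤ K * ‖y - y'‖)
    (hψ : ∀ s t, s ≤ t → ∀ x, |ψ t (F.flow t x) - ψ s (F.flow s x)| ≤ δ * ∫ σ in s..t, C σ) :
    Continuous fun p : ℝ × Sp d => ψ p.1 p.2 := by
  refine continuous_iff_continuousAt.2 fun ⟨t₀, y₀⟩ => ?_
  obtain ⟨x₀, rfl⟩ := (F.flow t₀).surjective y₀
  rw [ContinuousAt, tendsto_iff_norm_sub_tendsto_zero]
  have hprim : Continuous fun t => ∫ σ in t₀..t, C σ :=
    intervalIntegral.continuous_primitive F.bound_int t₀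
  have hlim : Continuous fun p : ℝ × Sp d =>
      K * ‖p.2 - F.flow p.1 x₀‖ + |δ| * |∫ σ in t₀..p.1, C σ| :=
    (continuous_const.mul (continuous_snd.sub
      (F.continuous_flow.comp (continuous_fst.prodMk continuous_const))).norm).add
      (continuous_const.mul (hprim.comp continuous_fst).abs)
  have hz := hlim.tendsto (t₀, F.flow t₀ x₀)
  simp only [sub_self, norm_zero, mul_zero, intervalIntegral.integral_same, abs_zero,
    add_zero] at hz
  refine squeeze_zero (fun _ => norm_nonneg _) (fun p => ?_) hz
  have h1 := hK p.1 p.2 (F.flow p.1 x₀)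
  have h2 : |ψ p.1 (F.flow p.1 x₀) - ψ t₀ (F.flow t₀ x₀)| ≤ |δ| * |∫ σ in t₀..p.1, C σ| := by
    rw [← abs_mul]
    rcases le_total t₀ p.1 with h | h
    · exact (hψ t₀ p.1 h x₀).trans (le_abs_self _)
    · rw [abs_sub_comm, intervalIntegral.integral_symm, mul_neg, abs_neg]
      exact (hψ p.1 t₀ h x₀).trans (le_abs_self _)
  calc ‖ψ p.1 p.2 - ψ t₀ (F.flow t₀ x₀)‖
      ≤ |ψ p.1 p.2 - ψ p.1 (F.flow p.1 x₀)| + |ψ p.1 (F.flow p.1 x₀) - ψ t₀ (F.flow t₀ x₀)| :=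
        abs_sub_le _ _ _
    _ ≤ _ := add_le_add h1 h2

/-- The images of a compact set under the flow stay in a fixed ball on bounded time intervals. -/
theorem exists_flow_image_subset {S : Set (Sp d)} (hS : IsCompact S) (T : ℝ) :
    ∃ R > 0, ∀ t ≤ T, ∀ x ∈ S, ‖F.flow t x‖ ≤ R := by
  obtain ⟨R, hR⟩ := (((isCompact_Icc (a := 0) (b := max T 0)).prod hS).image
    F.continuous_flow).isBounded.subset_closedBall 0
  refine ⟨max R 1, by positivity, fun t ht x hx => ?_⟩
  have h1 : F.flow t x = F.flow (max t 0) x := by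
    rcases le_total t 0 with h | h
    · rw [max_eq_right h, flow_apply, flow_apply, F.flowMap_of_nonpos h,
        F.flowMap_of_nonpos le_rfl]
    · rw [max_eq_left h]
  have h2 := hR (mem_image_of_mem (fun p : ℝ × Sp d => F.flow p.1 p.2)
    (show (max t 0, x) ∈ Icc 0 (max T 0) ×ˢ S from
      ⟨⟨le_max_right _ _, max_le_max_right _ ht⟩, hx⟩))
  rw [h1]
  exact (mem_closedBall_zero_iff.1 h2).trans (le_max_left _ _)

/-- Approximation of a transported function by functions that are Lipschitz in space and almost
constant along the trajectories. -/
theorem exists_approx_transport (hχ : Continuous χ) (hχc : HasCompactSupport χ) {T : ℝ}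
    (hT : 0 ≤ T) : ∃ R > 0, ∀ δ > 0, ∀ κ > 0, ∃ (ψ : ℝ → Sp d → ℝ) (K : ℝ), 0 ≤ K ∧
      (∀ t y y', |ψ t y - ψ t y'| ≤ K * ‖y - y'‖) ∧
      (∀ s t, s ≤ t → ∀ x, |ψ t (F.flow t x) - ψ s (F.flow s x)| ≤ δ * ∫ σ in s..t, C σ) ∧
      (∀ t ≤ T, ∀ y, |ψ t y - χ ((F.flow t).symm y)| ≤ κ) ∧
      ∀ t ≤ T, ∀ y, R ≤ ‖y‖ → ψ t y = 0 ∧ χ ((F.flow t).symm y) = 0 := by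
  obtain ⟨R₁, hR₁, hR⟩ := F.exists_flow_image_subset hχc T
  obtain ⟨m, hm⟩ := hχ.bounded_above_of_compact_support hχc
  have hm : ∀ x, |χ x| ≤ m := hm
  -- The supremum only looks within distance `min r₀ 1` of `y`, so the support grows by at most `1`,
  -- whatever `δ` and `κ` are.
  refine ⟨R₁ + 1, by positivity, fun δ hδ κ hκ => ?_⟩
  obtain ⟨r, hr, hχu⟩ := Metric.uniformContinuous_iff.1
    (hχc.uniformContinuous_of_continuous hχ) κ hκ
  obtain ⟨r₀, hr₀, hmod⟩ := F.exists_flowMap_modulus hT hr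
  have hR₀ : 0 < min r₀ 1 := by positivity
  -- Here the Osgood condition enters: however small `δ` is, some `ε` makes `δ A_ε` exceed `2m` at
  -- the localization radius. The price is the Lipschitz constant `δ / ε`.
  obtain ⟨ε, hε, hA⟩ := F.osgood _ hR₀ (2 * m / δ)
  rw [div_le_iff₀' hδ] at hA
  have hzero : ∀ t ≤ T, ∀ x, R₁ < ‖F.flow t x‖ → χ x = 0 := fun t ht x hx => by
    by_contra hne
    exact absurd (hR t ht x (subset_tsupport _ hne)) (not_le.2 hx)
  refine ⟨F.supConv χ δ ε, δ * ε⁻¹, by positivity, F.abs_supConv_sub_le hm hδ hε,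
    fun s t hst x => F.abs_supConv_flow_sub_le hm hδ hε hst x, fun t ht y => ?_,
    fun t ht y hy => ?_⟩
  · have h1 := F.comp_symm_le_supConv hm hδ hε t y
    have h2 : F.supConv χ δ ε t y ≤ χ ((F.flow t).symm y) + κ := by
      refine F.supConv_le hm hδ hε hR₀ hA fun x hx => ?_
      have h3 := (hmod t ht ((F.flow t).symm y) x).2 (by
        rw [← flow_apply, ← flow_apply, Homeomorph.apply_symm_apply]
        exact hx.trans_le (min_le_left _ _))
      have h4 := hχu (a := (F.flow t).symm y) (b := x) (by rw [dist_eq_norm]; exact h3)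
      rw [Real.dist_eq, abs_lt] at h4
      linarith
    exact abs_le.2 ⟨by linarith, by linarith⟩
  · have h0 : χ ((F.flow t).symm y) = 0 := hzero t ht _ (by
      rw [Homeomorph.apply_symm_apply]; linarith)
    refine ⟨le_antisymm (F.supConv_le hm hδ hε hR₀ hA fun x hx => ?_) ?_, h0⟩
    · refine (hzero t ht x ?_).le
      have h1 : ‖y - F.flow t x‖ < 1 := hx.trans_le (min_le_right _ _)
      have h2 := norm_sub_norm_le y (F.flow t x)
      linarith
    · rw [← h0]
      exact F.comp_symm_le_supConv hm hδ hε t y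

end SupConv

end OsgoodField


/-! ### Space-time mollification -/

section Mollify

variable {d : ℕ}

/-- The product of two normalized bump functions, in time and in space. -/
noncomputable def bumpKernel (b : ContDiffBump (0 : ℝ)) (b' : ContDiffBump (0 : Sp d))
    (p : ℝ × Sp d) : ℝ :=
  b.normed volume p.1 * b'.normed volume p.2

/-- Space-time mollification. -/
noncomputable def mollify (b : ContDiffBump (0 : ℝ)) (b' : ContDiffBump (0 : Sp d))
    (ψ : ℝ × Sp d → ℝ) : ℝ × Sp d → ℝ :=
  convolution (bumpKernel b b') ψ (ContinuousLinearMap.lsmul ℝ ℝ) volume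

variable {b : ContDiffBump (0 : ℝ)} {b' : ContDiffBump (0 : Sp d)} {h : ℝ} {ψ : ℝ × Sp d → ℝ}

theorem bumpKernel_nonneg (p : ℝ × Sp d) : 0 ≤ bumpKernel b b' p :=
  mul_nonneg (b.nonneg_normed _) (b'.nonneg_normed _)

theorem contDiff_bumpKernel : ContDiff ℝ ∞ (bumpKernel b b') :=
  (b.contDiff_normed.comp contDiff_fst).mul (b'.contDiff_normed.comp contDiff_snd)

theorem hasCompactSupport_bumpKernel : HasCompactSupport (bumpKernel b b') := by
  refine HasCompactSupport.intro (b.hasCompactSupport_normed (μ := volume).isCompact.prod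
    (b'.hasCompactSupport_normed (μ := volume)).isCompact) fun p hp => ?_
  rw [mem_prod, not_and_or] at hp
  rcases hp with hp | hp
  · rw [bumpKernel, image_eq_zero_of_notMem_tsupport hp, zero_mul]
  · rw [bumpKernel, image_eq_zero_of_notMem_tsupport hp, mul_zero]

theorem integral_bumpKernel : ∫ p, bumpKernel b b' p = 1 := by
  have := integral_prod_mul (μ := (volume : Measure ℝ)) (ν := (volume : Measure (Sp d)))
    (b.normed volume) (b'.normed volume)
  rw [b.integral_normed, b'.integral_normed, one_mul] at this
  exact this

theorem integral_bumpKernel_mul_fst (J : ℝ → ℝ) :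
    ∫ p, bumpKernel b b' p * J p.1 = ∫ τ, b.normed volume τ * J τ := by
  have := integral_prod_mul (μ := (volume : Measure ℝ)) (ν := (volume : Measure (Sp d)))
    (fun τ => b.normed volume τ * J τ) (b'.normed volume)
  rw [b'.integral_normed, mul_one] at this
  rw [← this]
  exact integral_congr_ae (ae_of_all _ fun p => mul_right_comm _ _ _)

theorem support_bumpKernel_subset (hb : b.rOut ≤ h) (hb' : b'.rOut ≤ h) :
    Function.support (bumpKernel b b') ⊆ Metric.ball 0 h := by
  intro p hp
  rw [Function.mem_support, bumpKernel, mul_ne_zero_iff] at hp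
  have h1 : p.1 ∈ Metric.ball (0 : ℝ) b.rOut := by
    rw [← b.support_normed_eq (μ := volume)]; exact hp.1
  have h2 : p.2 ∈ Metric.ball (0 : Sp d) b'.rOut := by
    rw [← b'.support_normed_eq (μ := volume)]; exact hp.2
  rw [mem_ball_zero_iff] at h1 h2 ⊢
  exact max_lt (h1.trans_le hb) (h2.trans_le hb')

instance isAddHaarMeasure_volume_prod :
    (volume : Measure (ℝ × Sp d)).IsAddHaarMeasure :=
  inferInstanceAs (((volume : Measure ℝ).prod (volume : Measure (Sp d))).IsAddHaarMeasure)

theorem contDiff_mollify (hψ : Continuous ψ) : ContDiff ℝ ∞ (mollify b b' ψ) :=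
  hasCompactSupport_bumpKernel.contDiff_convolution_left _ contDiff_bumpKernel
    hψ.locallyIntegrable

theorem abs_mollify_sub_le (hψ : Continuous ψ) (hb : b.rOut ≤ h) (hb' : b'.rOut ≤ h) {κ : ℝ}
    {p : ℝ × Sp d} (z : ℝ) (hκ : ∀ q ∈ Metric.ball p h, |ψ q - z| ≤ κ) :
    |mollify b b' ψ p - z| ≤ κ := by
  have h0 : 0 < h := b.rOut_pos.trans_le hb
  have hκ0 : 0 ≤ κ := (abs_nonneg _).trans (hκ p (Metric.mem_ball_self h0))
  rw [← Real.dist_eq]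
  exact dist_convolution_le hκ0 (support_bumpKernel_subset hb hb')
    bumpKernel_nonneg integral_bumpKernel hψ.aestronglyMeasurable fun q hq => hκ q hq

theorem integrable_bumpKernel_mul {f : ℝ × Sp d → ℝ} (hf : Continuous f) :
    Integrable fun q => bumpKernel b b' q * f q :=
  (contDiff_bumpKernel.continuous.mul hf).integrable_of_hasCompactSupport
    hasCompactSupport_bumpKernel.mul_right

/-- A bound on increments that depends only on the time lag survives averaging, with the space bump
integrating to one. -/
theorem abs_mollify_sub_le_integral (hψ : Continuous ψ) (hb : b.rOut ≤ h) (hb' : b'.rOut ≤ h)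
    {J : ℝ → ℝ} (hJ : Continuous J) (p p' : ℝ × Sp d)
    (h1 : ∀ q ∈ Metric.ball (0 : ℝ × Sp d) h, |ψ (p' - q) - ψ (p - q)| ≤ J q.1) :
    |mollify b b' ψ p' - mollify b b' ψ p| ≤ ∫ τ, b.normed volume τ * J τ := by
  have hi : ∀ p, Integrable fun q => bumpKernel b b' q * ψ (p - q) := fun p =>
    integrable_bumpKernel_mul (hψ.comp (continuous_const.sub continuous_id))
  have e : mollify b b' ψ p' - mollify b b' ψ p =
      ∫ q, bumpKernel b b' q * (ψ (p' - q) - ψ (p - q)) := by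
    simp only [mul_sub]
    rw [integral_sub (hi p') (hi p)]
    rfl
  rw [e, ← integral_bumpKernel_mul_fst (b' := b'), ← Real.norm_eq_abs]
  refine norm_integral_le_of_norm_le (integrable_bumpKernel_mul (hJ.comp continuous_fst))
    (ae_of_all _ fun q => ?_)
  rw [norm_mul, Real.norm_of_nonneg (bumpKernel_nonneg q)]
  by_cases hq : bumpKernel b b' q = 0
  · rw [hq, zero_mul, zero_mul]
  · exact mul_le_mul_of_nonneg_left (h1 q (support_bumpKernel_subset hb hb' hq))
      (bumpKernel_nonneg q)

/-- The derivative of a mollified primitive is the mollification of the integrand. -/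
theorem hasDerivAt_mollify_primitive (b : ContDiffBump (0 : ℝ)) {G : ℝ → ℝ}
    (hG : ∀ a b, IntervalIntegrable G volume a b) (t : ℝ) :
    HasDerivAt (fun s => ∫ τ, b.normed volume τ * ∫ σ in (0 : ℝ)..(s - τ), G σ)
      (∫ τ, b.normed volume τ * G (t - τ)) t := by
  set ρ := b.normed (volume : Measure ℝ) with hρ
  have hρc : ContDiff ℝ 1 ρ := b.contDiff_normed
  set P : ℝ → ℝ := fun s => ∫ σ in (0 : ℝ)..s, G σ with hP
  have hPc : Continuous P := intervalIntegral.continuous_primitive hG 0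
  -- `G` is only integrable, so the derivative falls on the bump first and is moved back by
  -- integration by parts for absolutely continuous functions. The formula thus holds at every `t`.
  have h1 : HasDerivAt (convolution ρ P (ContinuousLinearMap.lsmul ℝ ℝ) volume)
      (convolution (deriv ρ) P (ContinuousLinearMap.lsmul ℝ ℝ) volume t) t :=
    (b.hasCompactSupport_normed (μ := volume)).hasDerivAt_convolution_left _ hρc
      hPc.locallyIntegrable t
  have hsupp : ∀ {f : ℝ → ℝ}, (∀ τ, τ ∉ Ioc (-b.rOut) b.rOut → f τ = 0) →
      ∫ τ, f τ = ∫ τ in (-b.rOut)..b.rOut, f τ := fun {f} hf => by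
    rw [intervalIntegral.integral_of_le (by linarith [b.rOut_pos])]
    exact (setIntegral_eq_integral_of_forall_compl_eq_zero hf).symm
  have hts : tsupport ρ = Icc (-b.rOut) b.rOut := by
    rw [hρ, b.tsupport_normed_eq, Real.closedBall_eq_Icc, zero_sub, zero_add]
  have hρ0 : ∀ τ, τ ∉ Ioo (-b.rOut) b.rOut → ρ τ = 0 := fun τ hτ => by
    by_contra hne
    have : τ ∈ Function.support ρ := hne
    rw [hρ, b.support_normed_eq, Real.ball_eq_Ioo, zero_sub, zero_add] at this
    exact hτ this
  have hρ'0 : ∀ τ, τ ∉ Ioc (-b.rOut) b.rOut → deriv ρ τ = 0 := fun τ hτ => by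
    by_cases hτ' : τ ∈ Icc (-b.rOut) b.rOut
    -- The endpoint belongs to the closed support, but the nonnegative bump vanishes there and so
    -- has a minimum.
    · have hmin : IsLocalMin ρ τ := by
        have : ρ τ = 0 := hρ0 τ fun h => hτ (Ioo_subset_Ioc_self h)
        exact Eventually.of_forall fun s => by rw [this]; exact b.nonneg_normed s
      exact hmin.deriv_eq_zero
    · rw [← hts] at hτ'
      exact image_eq_zero_of_notMem_tsupport fun h => hτ' (tsupport_deriv_subset h)
  have h2 : ∫ τ, ρ τ * G (t - τ) = convolution (deriv ρ) P (ContinuousLinearMap.lsmul ℝ ℝ) volume t := by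
    change _ = ∫ τ, deriv ρ τ * P (t - τ)
    rw [hsupp fun τ hτ => by rw [hρ0 τ fun h => hτ (Ioo_subset_Ioc_self h), zero_mul],
      hsupp fun τ hτ => by rw [hρ'0 τ hτ, zero_mul]]
    have hGt : ∀ a b, IntervalIntegrable (fun τ => G (t - τ)) volume a b := fun a b => by
      simpa using (hG (t - a) (t - b)).comp_sub_left t
    set r := b.rOut with hr
    set g : ℝ → ℝ := fun τ => ∫ s in (-r)..τ, G (t - s) with hg
    -- The constant `P (t + r)` drops out after multiplication by `deriv ρ`, whose integral is zero.
    have hgP : ∀ τ, P (t - τ) = P (t + r) - g τ := fun τ => by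
      simp only [hg, hP]
      rw [intervalIntegral.integral_comp_sub_left, sub_neg_eq_add,
        ← intervalIntegral.integral_interval_sub_left (hG 0 (t + r)) (hG 0 (t - τ)),
        sub_sub_cancel]
    have hρA : AbsolutelyContinuousOnInterval ρ (-r) r :=
      hρc.contDiffOn.absolutelyContinuousOnInterval
    have hgA : AbsolutelyContinuousOnInterval g (-r) r :=
      (hGt (-r) r).absolutelyContinuousOnInterval_intervalIntegral left_mem_uIcc
    have hpar := hρA.integral_mul_deriv_eq_deriv_mul hgA
    rw [hρ0 r fun h => lt_irrefl _ h.2, hρ0 (-r) fun h => lt_irrefl _ h.1] at hpar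
    have hint := hρA.integral_deriv_eq_sub
    rw [hρ0 r fun h => lt_irrefl _ h.2, hρ0 (-r) fun h => lt_irrefl _ h.1] at hint
    have hder : ∫ τ in (-r)..r, ρ τ * deriv g τ = ∫ τ in (-r)..r, ρ τ * G (t - τ) := by
      refine intervalIntegral.integral_congr_ae ?_
      filter_upwards [(hGt (-r) r).ae_hasDerivAt_integral] with τ hτ hτI
      rw [(hτ (uIoc_subset_uIcc hτI) (-r) left_mem_uIcc).deriv]
    have hρ'c : Continuous (deriv ρ) := hρc.continuous_deriv le_rfl
    have hi1 : IntervalIntegrable (fun τ => deriv ρ τ * P (t + r)) volume (-r) r :=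
      (hρ'c.mul continuous_const).intervalIntegrable _ _
    simp only [hgP, mul_sub]
    rw [← hder, hpar, intervalIntegral.integral_sub hi1
      (hρA.intervalIntegrable_deriv.mul_continuousOn hgA.continuousOn),
      intervalIntegral.integral_mul_const, hint]
    ring
  rw [h2]
  exact h1

end Mollify

/-! ### The derivative of a mollification along the field -/

namespace OsgoodField

variable {d : ℕ} {u : ℝ → Sp d → Sp d} {C Λ : ℝ → ℝ} (F : OsgoodField u C Λ)
include F

theorem intervalIntegrable_apply (x : Sp d) (a b : ℝ) :
    IntervalIntegrable (fun t => u t x) volume a b :=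
  F.intervalIntegrable_comp continuous_const a b

/-- Increments along a straight line of a function which is almost constant along trajectories. -/
theorem abs_sub_le_of_transport {ψ : ℝ → Sp d → ℝ} {K δ lam : ℝ} (hK0 : 0 ≤ K)
    (hK : ∀ t y y', |ψ t y - ψ t y'| ≤ K * ‖y - y'‖)
    (hψ : ∀ s t, s ≤ t → ∀ x, |ψ t (F.flow t x) - ψ s (F.flow s x)| ≤ δ * ∫ σ in s..t, C σ)
    {s k : ℝ} (hk : 0 ≤ k) (y v x : Sp d)
    (hlam : ∀ σ ∈ Icc s (s + k), Λ ‖y - F.flow σ x‖ ≤ lam) :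
    |ψ (s + k) (F.flow s x + k • v) - ψ s (F.flow s x)| ≤
      ∫ σ in s..(s + k), ((δ + K * lam) * C σ + K * ‖v - u σ y‖) := by
  have hsk : s ≤ s + k := by linarith
  have hi := F.flowMap_integrable x s (s + k)
  have hvi : IntervalIntegrable (fun σ => v - u σ y) volume s (s + k) :=
    intervalIntegrable_const.sub (F.intervalIntegrable_apply y _ _)
  have hCi := F.bound_int s (s + k)
  -- The straight line is compared with the trajectory leaving from the same point. Freezing `u` at
  -- the fixed point `y` costs `lam * C` and leaves a bound in which `x` no longer appears.
  have e : F.flow s x + k • v - F.flow (s + k) x =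
      ∫ σ in s..(s + k), (v - u σ (F.flowMap σ x)) := by
    rw [intervalIntegral.integral_sub intervalIntegrable_const hi, ← F.flowMap_sub,
      intervalIntegral.integral_const, add_sub_cancel_left]
    simp only [flow_apply]
    abel
  have h1 : ‖F.flow s x + k • v - F.flow (s + k) x‖ ≤
      ∫ σ in s..(s + k), (lam * C σ + ‖v - u σ y‖) := by
    rw [e]
    refine intervalIntegral.norm_integral_le_of_norm_le hsk (ae_of_all _ fun σ hσ => ?_)
      ((hCi.const_mul _).add hvi.norm)
    have h2 := F.mod σ y (F.flowMap σ x)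
    have h3 := mul_le_mul_of_nonneg_left (hlam σ (Ioc_subset_Icc_self hσ)) (F.bound_nonneg σ)
    simp only [flow_apply] at h3
    have h4 := norm_sub_le_norm_sub_add_norm_sub v (u σ y) (u σ (F.flowMap σ x))
    linarith
  have h2 := hK (s + k) (F.flow s x + k • v) (F.flow (s + k) x)
  have h3 := hψ s (s + k) hsk x
  have h4 := mul_le_mul_of_nonneg_left h1 hK0
  have e2 : ∫ σ in s..(s + k), ((δ + K * lam) * C σ + K * ‖v - u σ y‖) =
      K * (∫ σ in s..(s + k), (lam * C σ + ‖v - u σ y‖)) + δ * ∫ σ in s..(s + k), C σ := by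
    rw [← intervalIntegral.integral_const_mul, ← intervalIntegral.integral_const_mul,
      ← intervalIntegral.integral_add (((hCi.const_mul _).add hvi.norm).const_mul _)
        (hCi.const_mul _)]
    exact intervalIntegral.integral_congr fun σ _ => by ring
  rw [e2]
  refine (abs_sub_le _ (ψ (s + k) (F.flow (s + k) x)) _).trans (add_le_add (h2.trans h4) h3)

/-- The trajectories are uniformly equicontinuous in time on compact sets. -/
theorem exists_norm_flow_sub_lt (t h : ℝ) (hh : 0 < h) (y : Sp d) :
    ∃ k₀ > 0, ∀ s x, |s - t| ≤ h → ‖F.flow s x - y‖ ≤ h → ∀ σ ∈ Icc s (s + k₀),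
      ‖F.flow s x - F.flow σ x‖ < h := by
  -- `f ((s, z), k)` is the position at time `s + k` of the trajectory that is at `z` at time `s`.
  let f : (ℝ × Sp d) × ℝ → Sp d := fun p => F.flow (p.1.1 + p.2) ((F.flow p.1.1).symm p.1.2)
  have hf : Continuous f :=
    F.continuous_flow.comp (((continuous_fst.comp continuous_fst).add continuous_snd).prodMk
      (F.continuous_flow_symm.comp continuous_fst))
  have hS : IsCompact ((Metric.closedBall t h ×ˢ Metric.closedBall y h) ×ˢ Icc (0 : ℝ) 1) :=
    ((isCompact_closedBall t h).prod (isCompact_closedBall y h)).prod isCompact_Icc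
  obtain ⟨k₀, hk₀, hu⟩ := Metric.uniformContinuousOn_iff.1
    (hS.uniformContinuousOn_of_continuous hf.continuousOn) h hh
  refine ⟨min (k₀ / 2) 1, by positivity, fun s x hs hx σ hσ => ?_⟩
  have hσ1 : σ - s ≤ 1 := by linarith [hσ.2, min_le_right (k₀ / 2) 1]
  have hσ2 : σ - s ≤ k₀ / 2 := by linarith [hσ.2, min_le_left (k₀ / 2) 1]
  have hσ0 : 0 ≤ σ - s := by linarith [hσ.1]
  have hmem : (s, F.flow s x) ∈ Metric.closedBall t h ×ˢ Metric.closedBall y h :=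
    ⟨by rwa [Metric.mem_closedBall, Real.dist_eq], by rwa [Metric.mem_closedBall, dist_eq_norm]⟩
  have := hu ((s, F.flow s x), 0) ⟨hmem, le_rfl, zero_le_one⟩ ((s, F.flow s x), σ - s)
    ⟨hmem, hσ0, hσ1⟩ (by
      rw [Prod.dist_eq, dist_self, Real.dist_eq, zero_sub, abs_neg, abs_of_nonneg hσ0]
      exact max_lt hk₀ (by linarith))
  rw [dist_eq_norm] at this
  simp only [f, add_zero, Homeomorph.symm_apply_apply, add_sub_cancel] at this
  exact this

/-- The derivative of the mollification along the vector `(1, u)` is small. -/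
theorem abs_fderiv_mollify_le {ψ : ℝ → Sp d → ℝ} {K δ lam h : ℝ} (hK0 : 0 ≤ K)
    (hK : ∀ t y y', |ψ t y - ψ t y'| ≤ K * ‖y - y'‖)
    (hψ : ∀ s t, s ≤ t → ∀ x, |ψ t (F.flow t x) - ψ s (F.flow s x)| ≤ δ * ∫ σ in s..t, C σ)
    {b : ContDiffBump (0 : ℝ)} {b' : ContDiffBump (0 : Sp d)} (hb : b.rOut ≤ h) (hb' : b'.rOut ≤ h)
    (hlam : ∀ r, |r| ≤ 2 * h → Λ r ≤ lam) (t : ℝ) (y : Sp d) :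
    |fderiv ℝ (mollify b b' fun p => ψ p.1 p.2) (t, y) (1, u t y)| ≤
      ∫ τ, b.normed volume τ *
        ((δ + K * lam) * C (t - τ) + K * ‖u t y - u (t - τ) y‖) := by
  have hh : 0 < h := b.rOut_pos.trans_le hb
  -- With the direction `v` and the point `y` frozen, `G` below is a function of one time variable,
  -- whose mollified primitive can be differentiated.
  set v := u t y with hv
  set G : ℝ → ℝ := fun σ => (δ + K * lam) * C σ + K * ‖v - u σ y‖ with hG
  have hGi : ∀ a b, IntervalIntegrable G volume a b := fun a b =>
    ((F.bound_int a b).const_mul _).add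
      ((intervalIntegrable_const.sub (F.intervalIntegrable_apply y _ _)).norm.const_mul _)
  have hψc : Continuous fun p : ℝ × Sp d => ψ p.1 p.2 := F.continuous_of_lipschitz_of_flow hK hψ
  set Ψ := mollify b b' fun p => ψ p.1 p.2 with hΨ
  set P : ℝ → ℝ := fun s => ∫ σ in (0 : ℝ)..s, G σ with hP
  have hPc : Continuous P := intervalIntegral.continuous_primitive hGi 0
  set Q : ℝ → ℝ := fun s => ∫ τ, b.normed volume τ * P (s - τ) with hQ
  have hQd : HasDerivAt Q (∫ τ, b.normed volume τ * G (t - τ)) t :=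
    hasDerivAt_mollify_primitive b hGi t
  have hline : HasDerivAt (fun k : ℝ => ((t, y) : ℝ × Sp d) + k • ((1, v) : ℝ × Sp d)) (1, v) 0 := by
    simpa using ((hasDerivAt_id (0 : ℝ)).smul_const ((1, v) : ℝ × Sp d)).const_add (t, y)
  have hΨd : HasDerivAt (fun k : ℝ => Ψ ((t, y) + k • (1, v))) (fderiv ℝ Ψ (t, y) (1, v)) 0 := by
    have h1 : HasFDerivAt Ψ (fderiv ℝ Ψ (t, y)) ((t, y) + (0 : ℝ) • ((1, v) : ℝ × Sp d)) := by
      rw [zero_smul, add_zero]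
      exact ((contDiff_mollify hψc).differentiable (by simp) (t, y)).hasFDerivAt
    exact h1.comp_hasDerivAt (0 : ℝ) hline
  obtain ⟨k₀, hk₀, hflow⟩ := F.exists_norm_flow_sub_lt t h hh y
  have hinc : ∀ k, 0 < k → k < k₀ → |Ψ ((t, y) + k • (1, v)) - Ψ (t, y)| ≤ Q (t + k) - Q t := by
    intro k hk hkk
    have hρi : ∀ s, Integrable fun τ => b.normed volume τ * P (s - τ) := fun s =>
      ((b.contDiff_normed (n := 0)).continuous.mul
        (hPc.comp (continuous_const.sub continuous_id))).integrable_of_hasCompactSupport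
        (b.hasCompactSupport_normed).mul_right
    have e : Q (t + k) - Q t = ∫ τ, b.normed volume τ * (P (t + k - τ) - P (t - τ)) := by
      simp only [mul_sub]
      rw [integral_sub (hρi _) (hρi _)]
    rw [e]
    refine abs_mollify_sub_le_integral hψc hb hb'
      (J := fun τ => P (t + k - τ) - P (t - τ))
      ((hPc.comp (continuous_const.sub continuous_id)).sub
        (hPc.comp (continuous_const.sub continuous_id))) _ _ fun q hq => ?_
    rw [mem_ball_zero_iff, Prod.norm_def, max_lt_iff] at hq
    obtain ⟨x, hx⟩ := (F.flow (t - q.1)).surjective (y - q.2)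
    -- The mollifier shifts the starting point by less than `h`, and during a time below `k₀` the
    -- trajectory moves by less than `h`; hence the radius `2h` for `lam`.
    have h1 := F.abs_sub_le_of_transport hK0 hK hψ (lam := lam) (s := t - q.1) hk.le y v x
      fun σ hσ => hlam _ (by
        have h2 := hflow (t - q.1) x (by
          rw [sub_sub_cancel_left, abs_neg]; exact hq.1.le) (by
          rw [hx, sub_sub_cancel_left, norm_neg]; exact hq.2.le) σ ⟨hσ.1, by linarith [hσ.2]⟩
        have h3 := norm_sub_le_norm_sub_add_norm_sub y (y - q.2) (F.flow σ x)
        rw [hx] at h2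
        rw [sub_sub_cancel] at h3
        rw [abs_norm]
        linarith [hq.2])
    have e1 : P (t + k - q.1) - P (t - q.1) = ∫ σ in (t - q.1)..(t - q.1 + k), G σ := by
      rw [show t + k - q.1 = t - q.1 + k by ring]
      exact intervalIntegral.integral_interval_sub_left (hGi _ _) (hGi _ _)
    rw [e1]
    rw [hx] at h1
    have e2 : ((t, y) + k • (1, v) - q : ℝ × Sp d) = (t - q.1 + k, y - q.2 + k • v) := by
      ext1
      · simp; ring
      · simp; abel
    rw [e2]
    exact h1
  -- Only forward increments are controlled, so right-hand difference quotients are compared.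
  have hl := hΨd.tendsto_slope_zero_right
  have hr := hQd.tendsto_slope_zero_right
  refine le_of_tendsto_of_tendsto hl.abs hr ?_
  filter_upwards [Ioo_mem_nhdsGT hk₀] with k hk
  have h1 := hinc k hk.1 hk.2
  simp only [zero_add, zero_smul, add_zero, smul_eq_mul]
  rw [abs_mul, abs_of_pos (inv_pos.2 hk.1)]
  exact mul_le_mul_of_nonneg_left h1 (inv_pos.2 hk.1).le

end OsgoodField


/-! ### Small oscillation in time and smooth approximation -/

/-- Continuity of translations in `L¹` on a bounded interval. -/
theorem exists_integral_norm_sub_translate_le {E : Type*} [NormedAddCommGroup E] [NormedSpace ℝ E]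
    {f : ℝ → E} (hf : ∀ a b, IntervalIntegrable f volume a b) {T ν : ℝ} (hT : 0 ≤ T) (hν : 0 < ν) :
    ∃ h₀ > 0, ∀ τ, |τ| < h₀ → ∫ t in (0 : ℝ)..T, ‖f t - f (t - τ)‖ ≤ ν := by
  -- Truncation makes `f` globally integrable and is invisible on `[0, T]` for translations by less
  -- than `1`. Density of continuous functions of compact support then leaves three errors of size
  -- `ν / 4`.
  set f' : ℝ → E := (Ioc (-1) (T + 1)).indicator f with hf'
  have hf'i : Integrable f' :=
    ((intervalIntegrable_iff_integrableOn_Ioc_of_le (by linarith)).1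
      (hf (-1) (T + 1))).integrable_indicator measurableSet_Ioc
  obtain ⟨g, hgc, hg, hgcont, hgi⟩ :=
    hf'i.exists_hasCompactSupport_integral_sub_le (ε := ν / 4) (by positivity)
  obtain ⟨r, hr, hu⟩ := Metric.uniformContinuous_iff.1
    (hgc.uniformContinuous_of_continuous hgcont) (ν / (4 * (T + 1))) (by positivity)
  refine ⟨min r 1, by positivity, fun τ hτ => ?_⟩
  have hτ1 := abs_lt.1 (hτ.trans_le (min_le_right _ _))
  have hd : Integrable fun t => ‖f' t - g t‖ := (hf'i.sub hgi).norm
  have hd' : Integrable fun t => ‖f' (t - τ) - g (t - τ)‖ := hd.comp_sub_right τ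
  have hle : ∀ h : ℝ → ℝ, Integrable h → (∀ t, 0 ≤ h t) → ∫ t in (0 : ℝ)..T, h t ≤ ∫ t, h t :=
    fun h hh h0 => by
      rw [intervalIntegral.integral_of_le hT]
      exact setIntegral_le_integral hh (ae_of_all _ h0)
  have h1 := hle _ hd fun _ => norm_nonneg _
  have h2 := hle _ hd' fun _ => norm_nonneg _
  rw [integral_sub_right_eq_self (fun t => ‖f' t - g t‖) τ] at h2
  have hfτ : IntervalIntegrable (fun t => f (t - τ)) volume 0 T := by
    simpa using (hf (0 - τ) (T - τ)).comp_sub_right τ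
  calc ∫ t in (0 : ℝ)..T, ‖f t - f (t - τ)‖
      ≤ ∫ t in (0 : ℝ)..T, (‖f' t - g t‖ + ν / (4 * (T + 1)) + ‖f' (t - τ) - g (t - τ)‖) := by
        refine intervalIntegral.integral_mono_on hT ((hf 0 T).sub hfτ).norm
          ((hd.intervalIntegrable.add intervalIntegrable_const).add hd'.intervalIntegrable)
          fun t ht => ?_
        have e1 : f' t = f t := indicator_of_mem
          (s := Ioc (-1) (T + 1)) ⟨by linarith [ht.1], by linarith [ht.2]⟩ f
        have e2 : f' (t - τ) = f (t - τ) :=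
          indicator_of_mem (s := Ioc (-1) (T + 1)) ⟨by linarith [ht.1], by linarith [ht.2]⟩ f
        have h3 := hu (a := t) (b := t - τ) (by
          rw [Real.dist_eq, sub_sub_cancel]; exact hτ.trans_le (min_le_left _ _))
        rw [dist_eq_norm] at h3
        rw [← e1, ← e2]
        have h4 : f' t - f' (t - τ) =
            (f' t - g t) + (g t - g (t - τ)) - (f' (t - τ) - g (t - τ)) := by abel
        rw [h4]
        exact (norm_sub_le _ _).trans (add_le_add ((norm_add_le _ _).trans
          (add_le_add le_rfl h3.le)) le_rfl)
    _ = (∫ t in (0 : ℝ)..T, ‖f' t - g t‖) + T * (ν / (4 * (T + 1))) +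
          ∫ t in (0 : ℝ)..T, ‖f' (t - τ) - g (t - τ)‖ := by
        rw [intervalIntegral.integral_add
          (hd.intervalIntegrable.add intervalIntegrable_const) hd'.intervalIntegrable,
          intervalIntegral.integral_add hd.intervalIntegrable intervalIntegrable_const,
          intervalIntegral.integral_const, sub_zero, smul_eq_mul]
    _ ≤ ν / 4 + ν / 4 + ν / 4 := by
        refine add_le_add (add_le_add (h1.trans hg) ?_) (h2.trans hg)
        rw [mul_div_assoc', div_le_div_iff₀ (by positivity) (by norm_num)]
        nlinarith
    _ ≤ ν := by linarith

/-- Continuity of translations in `L¹` for a finite family of functions. -/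
theorem exists_integral_sum_norm_sub_translate_le {E ι : Type*} [NormedAddCommGroup E]
    [NormedSpace ℝ E] {f : ι → ℝ → E} (hf : ∀ i a b, IntervalIntegrable (f i) volume a b)
    (I : Finset ι) {T ν : ℝ} (hT : 0 ≤ T) (hν : 0 < ν) :
    ∃ h₀ > 0, ∀ τ, |τ| < h₀ → ∫ t in (0 : ℝ)..T, ∑ i ∈ I, ‖f i t - f i (t - τ)‖ ≤ ν := by
  classical
  have hfτ : ∀ i τ, IntervalIntegrable (fun t => ‖f i t - f i (t - τ)‖) volume 0 T := fun i τ => by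
    have : IntervalIntegrable (fun t => f i (t - τ)) volume 0 T := by
      simpa using (hf i (0 - τ) (T - τ)).comp_sub_right τ
    exact ((hf i 0 T).sub this).norm
  have hn : (0 : ℝ) < I.card + 1 := by positivity
  choose h₀ hh₀ hle using fun i =>
    exists_integral_norm_sub_translate_le (hf i) hT (div_pos hν hn)
  obtain ⟨h₁, hmin, hh₁⟩ := (((Finset.eventually_all I).2 fun i _ =>
    nhdsWithin_le_nhds (eventually_le_nhds (hh₀ i))).and
      (self_mem_nhdsWithin : Ioi (0 : ℝ) ∈ 𝓝[>] 0)).exists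
  refine ⟨h₁, hh₁, fun τ hτ => ?_⟩
  rw [intervalIntegral.integral_finsetSum fun i _ => hfτ i τ]
  refine (Finset.sum_le_sum fun i hi => hle i τ (hτ.trans_le (hmin i hi))).trans ?_
  rw [Finset.sum_const, nsmul_eq_mul, mul_div_assoc', div_le_iff₀ hn]
  nlinarith

namespace OsgoodField

variable {d : ℕ} {u : ℝ → Sp d → Sp d} {C Λ : ℝ → ℝ} (F : OsgoodField u C Λ)
include F

theorem locallyIntegrable_bound : LocallyIntegrable C :=
  locallyIntegrable_of_forall_intervalIntegrable F.bound_int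

theorem aemeasurable_bound : AEMeasurable C :=
  F.locallyIntegrable_bound.aestronglyMeasurable.aemeasurable

theorem aemeasurable_oscillation (a a' K : ℝ) (I : Finset (Sp d)) (b : ContDiffBump (0 : ℝ)) :
    AEMeasurable (fun p : ℝ × ℝ => ENNReal.ofReal (b.normed volume p.2 *
      (a * C (p.1 - p.2) + a' * C p.1 + K * ∑ y ∈ I, ‖u p.1 y - u (p.1 - p.2) y‖)))
      ((volume : Measure ℝ).prod volume) := by
  have h1 : AEMeasurable (fun p : ℝ × ℝ => C p.1) (volume.prod volume) :=
    F.aemeasurable_bound.comp_quasiMeasurePreserving Measure.quasiMeasurePreserving_fst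
  have h2 : AEMeasurable (fun p : ℝ × ℝ => C (p.1 - p.2)) (volume.prod volume) :=
    F.aemeasurable_bound.comp_quasiMeasurePreserving
      (quasiMeasurePreserving_sub_of_right_invariant volume volume)
  have h3 : Measurable fun p : ℝ × ℝ => ∑ y ∈ I, ‖u p.1 y - u (p.1 - p.2) y‖ :=
    Finset.measurable_sum _ fun y _ =>
      ((F.meas.comp (measurable_fst.prodMk measurable_const)).sub
        (F.meas.comp ((measurable_fst.sub measurable_snd).prodMk measurable_const))).norm
  have h4 : Measurable fun p : ℝ × ℝ => b.normed volume p.2 :=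
    (b.contDiff_normed (n := 0)).continuous.measurable.comp measurable_snd
  exact (h4.aemeasurable.mul (((h2.const_mul a).add (h1.const_mul a')).add
    (h3.aemeasurable.const_mul K))).ennreal_ofReal

/-- Uniform `L¹` estimate of the oscillation in time of an Osgood field. -/
theorem exists_lintegral_oscillation_le {a a' K T ν : ℝ} (ha : 0 ≤ a) (ha' : 0 ≤ a') (hK : 0 ≤ K)
    (I : Finset (Sp d)) (hT : 0 ≤ T) (hν : 0 < ν) :
    ∃ h₀ > 0, ∀ b : ContDiffBump (0 : ℝ), b.rOut ≤ h₀ →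
      ∫⁻ t in Ioo 0 T, ∫⁻ τ, ENNReal.ofReal (b.normed volume τ * (a * C (t - τ) + a' * C t +
        K * ∑ y ∈ I, ‖u t y - u (t - τ) y‖)) ≤
      ENNReal.ofReal ((a + a') * (∫ σ in (-1 : ℝ)..(T + 1), C σ) + ν) := by
  obtain ⟨h₁, hh₁, h₁le⟩ := exists_integral_sum_norm_sub_translate_le
    (fun y => F.intervalIntegrable_apply y) I hT (ν := ν / (K + 1)) (by positivity)
  refine ⟨min h₁ 1, by positivity, fun b hb => ?_⟩
  set ρ := b.normed (volume : Measure ℝ) with hρ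
  set g : ℝ → ℝ → ℝ := fun t τ => a * C (t - τ) + a' * C t +
        K * ∑ y ∈ I, ‖u t y - u (t - τ) y‖ with hg
  have hg0 : ∀ t τ, 0 ≤ g t τ := fun t τ => by
    have h1 := mul_nonneg ha (F.bound_nonneg (t - τ))
    have h2 := mul_nonneg ha' (F.bound_nonneg t)
    have h3 := mul_nonneg hK (Finset.sum_nonneg fun y (_ : y ∈ I) =>
      norm_nonneg (u t y - u (t - τ) y))
    simp only [hg]; linarith
  have hm : AEMeasurable (fun p : ℝ × ℝ => ENNReal.ofReal (ρ p.2 * g p.1 p.2))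
      ((volume.restrict (Ioo 0 T)).prod volume) := by
    have h := (F.aemeasurable_oscillation a a' K I b).restrict (s := Ioo 0 T ×ˢ univ)
    rw [← Measure.prod_restrict, Measure.restrict_univ] at h
    exact h
  have hbound : ∀ τ, |τ| < min h₁ 1 → ∫⁻ t in Ioo 0 T, ENNReal.ofReal (g t τ) ≤
      ENNReal.ofReal ((a + a') * (∫ σ in (-1 : ℝ)..(T + 1), C σ) + ν) := fun τ hτ => by
    have hτ1 := abs_lt.1 (hτ.trans_le (min_le_right _ _))
    have hCτ : IntervalIntegrable (fun t => C (t - τ)) volume 0 T := by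
      simpa using (F.bound_int (0 - τ) (T - τ)).comp_sub_right τ
    have hS : IntervalIntegrable (fun t => ∑ y ∈ I, ‖u t y - u (t - τ) y‖) volume 0 T := by
      have := IntervalIntegrable.sum (μ := volume) (a := 0) (b := T) I
        (f := fun y t => ‖u t y - u (t - τ) y‖) fun y _ => by
          have h2 : IntervalIntegrable (fun t => u (t - τ) y) volume 0 T := by
            simpa using (F.intervalIntegrable_apply y (0 - τ) (T - τ)).comp_sub_right τ
          exact ((F.intervalIntegrable_apply y 0 T).sub h2).norm
      rw [show (∑ y ∈ I, fun t => ‖u t y - u (t - τ) y‖) =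
        fun t => ∑ y ∈ I, ‖u t y - u (t - τ) y‖ from funext fun t => Finset.sum_apply _ _ _] at this
      exact this
    have hgi : IntervalIntegrable (fun t => g t τ) volume 0 T :=
      ((hCτ.const_mul _).add ((F.bound_int 0 T).const_mul _)).add (hS.const_mul _)
    have hgi' := (intervalIntegrable_iff_integrableOn_Ioo_of_le hT).1 hgi
    rw [← ofReal_integral_eq_lintegral_ofReal hgi' (ae_of_all _ fun t => hg0 t τ)]
    refine ENNReal.ofReal_le_ofReal ?_
    rw [← integral_Ioc_eq_integral_Ioo, ← intervalIntegral.integral_of_le hT,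
      intervalIntegral.integral_add ((hCτ.const_mul _).add ((F.bound_int 0 T).const_mul _))
        (hS.const_mul _),
      intervalIntegral.integral_add (hCτ.const_mul _) ((F.bound_int 0 T).const_mul _),
      intervalIntegral.integral_const_mul, intervalIntegral.integral_const_mul,
      intervalIntegral.integral_const_mul, intervalIntegral.integral_comp_sub_right]
    have h1 : ∫ σ in (0 - τ)..(T - τ), C σ ≤ ∫ σ in (-1 : ℝ)..(T + 1), C σ :=
      intervalIntegral.integral_mono_interval (by linarith) (by linarith) (by linarith)
        (ae_of_all _ F.bound_nonneg) (F.bound_int _ _)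
    have h2 : ∫ σ in (0 : ℝ)..T, C σ ≤ ∫ σ in (-1 : ℝ)..(T + 1), C σ :=
      intervalIntegral.integral_mono_interval (by linarith) hT (by linarith)
        (ae_of_all _ F.bound_nonneg) (F.bound_int _ _)
    have h3 := mul_le_mul_of_nonneg_left (h₁le τ (hτ.trans_le (min_le_left _ _))) hK
    have h4 : K * (ν / (K + 1)) ≤ ν := by
      rw [mul_div_assoc', div_le_iff₀ (by linarith)]; nlinarith
    nlinarith [mul_le_mul_of_nonneg_left h1 ha, mul_le_mul_of_nonneg_left h2 ha']
  -- By Tonelli the time integral can be bounded for each lag `τ` in the support of the bump, and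
  -- the bump then integrates to one.
  calc ∫⁻ t in Ioo 0 T, ∫⁻ τ, ENNReal.ofReal (ρ τ * g t τ)
      = ∫⁻ τ, ∫⁻ t in Ioo 0 T, ENNReal.ofReal (ρ τ * g t τ) := lintegral_lintegral_swap hm
    _ ≤ ∫⁻ τ, ENNReal.ofReal (ρ τ) *
          ENNReal.ofReal ((a + a') * (∫ σ in (-1 : ℝ)..(T + 1), C σ) + ν) := by
        refine lintegral_mono fun τ => ?_
        by_cases hτ : ρ τ = 0
        · simp [hτ]
        · have hτ' : τ ∈ Function.support ρ := hτ
          rw [hρ, b.support_normed_eq, mem_ball_zero_iff] at hτ'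
          simp only [ENNReal.ofReal_mul (b.nonneg_normed τ), hρ]
          rw [lintegral_const_mul' _ _ ENNReal.ofReal_ne_top]
          exact mul_le_mul_right (hbound τ (hτ'.trans_le hb)) _
    _ = _ := by
        rw [lintegral_mul_const' _ _ ENNReal.ofReal_ne_top,
          ← ofReal_integral_eq_lintegral_ofReal b.integrable_normed
            (ae_of_all _ fun τ => b.nonneg_normed τ), b.integral_normed, ENNReal.ofReal_one,
          one_mul]

/-- A transported function can be approximated by smooth functions whose derivative along the
vector field `(1, u)` is small in `L¹` in time, locally uniformly in space. -/
theorem exists_smooth_approx_transport {χ : Sp d → ℝ} (hχ : Continuous χ)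
    (hχc : HasCompactSupport χ) {T : ℝ} (hT : 0 ≤ T) :
    ∃ R > 0, (∀ t ≤ T, ∀ y, R ≤ ‖y‖ → χ ((F.flow t).symm y) = 0) ∧
      ∀ κ > 0, ∃ (Ψ : ℝ × Sp d → ℝ) (E : ℝ → ℝ≥0∞), ContDiff ℝ ∞ Ψ ∧
      (∀ t ∈ Icc (-T) T, ∀ y, |Ψ (t, y) - χ ((F.flow t).symm y)| ≤ κ) ∧
      (∀ t ≤ T, ∀ y, R ≤ ‖y‖ → Ψ (t, y) = 0) ∧
      AEMeasurable E ∧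
      (∀ t y, ‖y‖ ≤ R → ‖fderiv ℝ Ψ (t, y) (1, u t y)‖ₑ ≤ E t) ∧
      ∫⁻ t in Ioo 0 T, E t ≤ ENNReal.ofReal κ := by
  obtain ⟨R, hR, hψ⟩ := F.exists_approx_transport hχ hχc (T := T + 1) (by linarith)
  refine ⟨R + 1, by positivity, fun t ht y hy => ?_, fun κ hκ => ?_⟩
  · obtain ⟨ψ, K, -, -, -, -, h⟩ := hψ 1 one_pos 1 one_pos
    exact (h t (by linarith) y (by linarith)).2
  set CT := ∫ σ in (-1 : ℝ)..(T + 1), C σ with hCT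
  have hCT0 : 0 ≤ CT := intervalIntegral.integral_nonneg (by linarith) fun s _ => F.bound_nonneg s
  -- The order of choices matters: `δ` is small relative to `∫ C` alone and determines `ψ` with its
  -- possibly huge constant `K`; then come `μ`, the net and the mollification scale, all depending
  -- on `K`. Working up to time `T + 1` leaves room for mollification.
  obtain ⟨ψ, K, hK0, hK, htr, hclose, hsupp⟩ := hψ (κ / (4 * (CT + 1))) (by positivity) (κ / 2)
    (half_pos hκ)
  set δ := κ / (4 * (CT + 1)) with hδ
  set μ := κ / (4 * ((K + 1) * (CT + 1))) with hμ
  have hμ0 : 0 < μ := by positivity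
  have hψc : Continuous fun p : ℝ × Sp d => ψ p.1 p.2 := F.continuous_of_lipschitz_of_flow hK htr
  -- a finite net of the ball on which the field is almost constant in space
  obtain ⟨r, hr, hΛ⟩ := Metric.continuousAt_iff.1 (F.modulus_cont.continuousAt (x := 0)) (μ / 3)
    (by positivity)
  have hΛ' : ∀ s, |s| < r → Λ s ≤ μ / 3 := fun s hs => by
    have := @hΛ s (by rw [Real.dist_eq, sub_zero]; exact hs)
    rw [F.modulus_zero, Real.dist_eq, sub_zero] at this
    exact (le_abs_self _).trans this.le
  obtain ⟨I, -, hIcov⟩ := (isCompact_closedBall (0 : Sp d) (R + 1)).elim_nhds_subcover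
    (fun y => Metric.ball y r) fun y _ => Metric.ball_mem_nhds y hr
  -- the mollification parameter
  obtain ⟨h₁, hh₁, hosc⟩ := F.exists_lintegral_oscillation_le (a := δ + K * (μ / 3) + K * (μ / 3))
    (a' := K * (μ / 3)) (K := K) (by positivity) (by positivity) hK0 I hT (ν := κ / 4)
    (by positivity)
  have hcpt : IsCompact (Icc (-(T + 1)) (T + 1) ×ˢ Metric.closedBall (0 : Sp d) (R + 2)) :=
    isCompact_Icc.prod (isCompact_closedBall _ _)
  obtain ⟨h₂, hh₂, hunif⟩ : ∃ h₂ > 0, ∀ t ∈ Icc (-T) T, ∀ y,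
      ∀ q ∈ Metric.ball ((t, y) : ℝ × Sp d) h₂, |ψ q.1 q.2 - ψ t y| ≤ κ / 2 := by
    obtain ⟨h₂, hh₂, hu⟩ := Metric.uniformContinuousOn_iff.1
      (hcpt.uniformContinuousOn_of_continuous hψc.continuousOn) (κ / 2) (by positivity)
    refine ⟨min h₂ 1, by positivity, fun t ht y q hq => ?_⟩
    have hq' := hq
    rw [Metric.mem_ball, dist_eq_norm, Prod.norm_def, max_lt_iff] at hq'
    obtain ⟨hq1, hq2⟩ := hq'
    simp only [Prod.fst_sub, Prod.snd_sub, Real.norm_eq_abs] at hq1 hq2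
    have hq3 := abs_lt.1 (hq1.trans_le (min_le_right _ _))
    have hq4 := hq2.trans_le (min_le_right h₂ 1)
    rcases le_total ‖y‖ (R + 1) with hy | hy
    · have h4 := norm_sub_norm_le q.2 y
      have h5 := hu q ⟨⟨by linarith [ht.1], by linarith [ht.2]⟩,
        mem_closedBall_zero_iff.2 (by linarith)⟩ (t, y) ⟨⟨by linarith [ht.1], by linarith [ht.2]⟩,
        mem_closedBall_zero_iff.2 (by linarith)⟩
        ((Metric.mem_ball.1 hq).trans_le (min_le_left _ _))
      exact (Real.dist_eq _ _ ▸ h5).le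
    · have h4 := norm_sub_norm_le y q.2
      rw [norm_sub_rev] at h4
      rw [(hsupp q.1 (by linarith [ht.2]) q.2 (by linarith)).1,
        (hsupp t (by linarith [ht.2]) y (by linarith)).1, sub_zero, abs_zero]
      positivity
  set h := min (min h₁ h₂) (min (r / 3) 1) with hh
  have hh0 : 0 < h := by positivity
  let b : ContDiffBump (0 : ℝ) := ⟨h / 2, h, by positivity, half_lt_self hh0⟩
  let b' : ContDiffBump (0 : Sp d) := ⟨h / 2, h, by positivity, half_lt_self hh0⟩
  set Ψ := mollify b b' fun p => ψ p.1 p.2 with hΨ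
  have hball : ∀ t y, Metric.ball ((t, y) : ℝ × Sp d) h ⊆ Metric.ball (t, y) h₂ := fun t y =>
    Metric.ball_subset_ball ((min_le_left _ _).trans (min_le_right _ _))
  refine ⟨Ψ, fun t => ∫⁻ τ, ENNReal.ofReal (b.normed volume τ *
    ((δ + K * (μ / 3) + K * (μ / 3)) * C (t - τ) + K * (μ / 3) * C t +
        K * ∑ y ∈ I, ‖u t y - u (t - τ) y‖)), contDiff_mollify hψc, fun t ht y => ?_,
    fun t ht y hy => ?_, ?_, fun t y hy => ?_, ?_⟩
  · have h1 := abs_mollify_sub_le hψc (b := b) (b' := b') le_rfl le_rfl (p := (t, y)) (ψ t y)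
      fun q hq => hunif t ht y q (hball t y hq)
    have h2 := hclose t (by linarith [ht.2]) y
    have h3 := abs_sub_le (Ψ (t, y)) (ψ t y) (χ ((F.flow t).symm y))
    linarith
  · have h1 := abs_mollify_sub_le hψc (b := b) (b' := b') le_rfl le_rfl (p := (t, y)) 0 (κ := 0)
      fun q hq => by
        rw [Metric.mem_ball, dist_eq_norm, Prod.norm_def, max_lt_iff] at hq
        have hq1 := abs_lt.1 hq.1
        have hq2 : ‖q.2 - y‖ < h := hq.2
        have h1 : h ≤ 1 := (min_le_right _ _).trans (min_le_right _ _)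
        simp only [Prod.fst_sub] at hq1
        have h4 := norm_sub_norm_le y q.2
        rw [norm_sub_rev] at h4
        rw [(hsupp q.1 (by linarith) q.2 (by linarith)).1, sub_zero, abs_zero]
    rw [sub_zero] at h1
    exact abs_nonpos_iff.1 h1
  · exact (F.aemeasurable_oscillation _ _ _ _ _).lintegral_prod_right'
  · have h1 := F.abs_fderiv_mollify_le hK0 hK htr (b := b) (b' := b') (h := h) le_rfl le_rfl
      (lam := μ / 3) (fun s hs => hΛ' s (hs.trans_lt (by
        have : h ≤ r / 3 := (min_le_right _ _).trans (min_le_left _ _)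
        linarith))) t y
    obtain ⟨z, hz, hyz⟩ := mem_iUnion₂.1 (hIcov (mem_closedBall_zero_iff.2 hy))
    have hyz' : Λ ‖y - z‖ ≤ μ / 3 := hΛ' _ (by rw [abs_norm, ← dist_eq_norm]; exact hyz)
    -- Passing from `y` to a net point at both times costs `μ / 3` times `C t` and `C s`; the
    -- remaining oscillation is a finite sum independent of `y`, so its mollification can be small
    -- in `L¹` uniformly in `y`.
    have hpt : ∀ s, ‖u t y - u s y‖ ≤
        μ / 3 * C t + μ / 3 * C s + ∑ y ∈ I, ‖u t y - u s y‖ := fun s => by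
      have e : u t y - u s y = (u t y - u t z) + (u t z - u s z) - (u s y - u s z) := by abel
      have h2 := F.mod t y z
      have h3 := F.mod s y z
      have h4 := mul_le_mul_of_nonneg_left hyz' (F.bound_nonneg t)
      have h5 := mul_le_mul_of_nonneg_left hyz' (F.bound_nonneg s)
      have h6 := Finset.single_le_sum (f := fun y => ‖u t y - u s y‖)
        (fun y _ => norm_nonneg _) hz
      have h7 := norm_sub_le (u t y - u t z + (u t z - u s z)) (u s y - u s z)
      have h8 := norm_add_le (u t y - u t z) (u t z - u s z)
      rw [← e] at h7
      linarith
    have hnn : ∀ τ, 0 ≤ b.normed volume τ *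
        ((δ + K * (μ / 3)) * C (t - τ) + K * ‖u t y - u (t - τ) y‖) := fun τ =>
      mul_nonneg (b.nonneg_normed τ) (add_nonneg (mul_nonneg (by positivity) (F.bound_nonneg _))
        (mul_nonneg hK0 (norm_nonneg _)))
    calc ‖fderiv ℝ Ψ (t, y) (1, u t y)‖ₑ
        ≤ ‖∫ τ, b.normed volume τ *
            ((δ + K * (μ / 3)) * C (t - τ) + K * ‖u t y - u (t - τ) y‖)‖ₑ := by
          rw [← ofReal_norm, ← ofReal_norm]
          exact ENNReal.ofReal_le_ofReal (h1.trans (le_abs_self _))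
      _ ≤ ∫⁻ τ, ‖b.normed volume τ *
            ((δ + K * (μ / 3)) * C (t - τ) + K * ‖u t y - u (t - τ) y‖)‖ₑ :=
          enorm_integral_le_lintegral_enorm _
      _ ≤ _ := lintegral_mono fun τ => by
          rw [← ofReal_norm, Real.norm_of_nonneg (hnn τ)]
          refine ENNReal.ofReal_le_ofReal (mul_le_mul_of_nonneg_left ?_ (b.nonneg_normed τ))
          have h2 := mul_le_mul_of_nonneg_left (hpt (t - τ)) hK0
          linarith
  · refine (hosc b ((min_le_left _ _).trans (min_le_left _ _))).trans (ENNReal.ofReal_le_ofReal ?_)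
    -- The three terms `K * (μ / 3)` come from the transport estimate and from the net at the two
    -- times. With `δ` and the oscillation they give at most `κ / 4` three times.
    have h1 : (δ + K * (μ / 3) + K * (μ / 3) + K * (μ / 3)) * CT = δ * CT + K * μ * CT := by ring
    have h2 : δ * CT ≤ κ / 4 := by
      rw [hδ, div_mul_eq_mul_div, div_le_div_iff₀ (by positivity) (by norm_num)]
      nlinarith
    have h3 : K * μ * CT ≤ κ / 4 := by
      rw [hμ, mul_div_assoc', div_mul_eq_mul_div, div_le_div_iff₀ (by positivity) (by norm_num)]
      nlinarith [mul_nonneg hK0 hCT0, mul_nonneg hκ.le (mul_nonneg hK0 hCT0),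
        mul_nonneg hκ.le hK0, mul_nonneg hκ.le hCT0]
    rw [h1]
    linarith

end OsgoodField


/-! ### Weak solutions: preliminaries -/

/-- If the distributional derivative of `q` on `(0,∞)` vanishes and `q` has initial value `Q`, then
`q = Q` almost everywhere. -/
theorem ae_eq_of_forall_integral_deriv {q : ℝ → ℝ} {Q : ℝ}
    (hq : ∀ T, IntegrableOn q (Ioo 0 T))
    (h : ∀ β : ℝ → ℝ, ContDiff ℝ ∞ β → HasCompactSupport β →
      (∫ t in Ioi (0 : ℝ), deriv β t * q t) + β 0 * Q = 0) :
    ∀ᵐ t ∂(volume.restrict (Ioi (0 : ℝ))), q t = Q := by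
  rw [ae_restrict_iff' measurableSet_Ioi]
  have hloc : LocallyIntegrableOn (fun t => q t - Q) (Ioi 0) := by
    refine LocallyIntegrableOn.sub (fun t ht => ?_) ((locallyIntegrable_const Q).locallyIntegrableOn _)
    exact ⟨Ioo 0 (t + 1), mem_nhdsWithin_of_mem_nhds (Ioo_mem_nhds ht (lt_add_one t)), hq _⟩
  have key := isOpen_Ioi.ae_eq_zero_of_integral_contDiff_smul_eq_zero hloc fun g hg hgc hgU => ?_
  · filter_upwards [key] with t ht ht0
    exact sub_eq_zero.1 (ht ht0)
  obtain ⟨b, hb⟩ := hgc.isCompact.isBounded.subset_closedBall 0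
  have hgb : ∀ t, b < |t| → g t = 0 := fun t ht => by
    refine image_eq_zero_of_notMem_tsupport fun hmem => ?_
    have := hb hmem
    rw [mem_closedBall_zero_iff, Real.norm_eq_abs] at this
    linarith
  have hg0 : ∀ t, t ≤ 0 → g t = 0 := fun t ht =>
    image_eq_zero_of_notMem_tsupport fun hmem => not_lt.2 ht (hgU hmem)
  set B := max b 0 + 1 with hB
  -- The primitive of `g` that vanishes for large times, so that its value at `0` is `-∫ g`.
  set P : ℝ → ℝ := fun t => ∫ s in B..t, g s with hP
  have hPd : ∀ t, HasDerivAt P (g t) t := fun t =>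
    intervalIntegral.integral_hasDerivAt_right (hg.continuous.intervalIntegrable _ _)
      hg.continuous.stronglyMeasurable.stronglyMeasurableAtFilter hg.continuous.continuousAt
  have hPs : ContDiff ℝ ∞ P := by
    refine contDiff_infty_iff_deriv.2 ⟨fun t => (hPd t).differentiableAt, ?_⟩
    rwa [show deriv P = g from funext fun t => (hPd t).deriv]
  have hPB : ∀ t, B ≤ t → P t = 0 := fun t ht => by
    rw [hP]
    simp only
    rw [intervalIntegral.integral_congr (g := fun _ => (0 : ℝ)), intervalIntegral.integral_zero]
    intro s hs
    rw [uIcc_of_le ht] at hs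
    refine hgb s ?_
    have h1 : b < s := by linarith [hs.1, le_max_left b 0]
    exact h1.trans_le (le_abs_self s)
  -- Cutting off only between `-1` and `0` gives compact support without changing `P` on `[0, ∞)`.
  -- Testing with `β` yields `∫ g q = Q ∫ g`.
  set β : ℝ → ℝ := fun t => Real.smoothTransition (t + 1) * P t with hβ
  have hβs : ContDiff ℝ ∞ β :=
    (Real.smoothTransition.contDiff.comp (contDiff_id.add contDiff_const)).mul hPs
  have hβc : HasCompactSupport β := by
    refine HasCompactSupport.intro (isCompact_Icc (a := -1) (b := B)) fun t ht => ?_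
    rw [mem_Icc, not_and_or, not_le, not_le] at ht
    rcases ht with ht | ht
    · simp only [hβ]
      rw [Real.smoothTransition.zero_of_nonpos (by linarith), zero_mul]
    · simp only [hβ]
      rw [hPB t ht.le, mul_zero]
  have hβd : ∀ t ∈ Ioi (0 : ℝ), deriv β t = g t := fun t ht => by
    have : β =ᶠ[𝓝 t] P := by
      filter_upwards [Ioi_mem_nhds (mem_Ioi.1 ht)] with s hs
      simp only [hβ]
      rw [Real.smoothTransition.one_of_one_le (by linarith [mem_Ioi.1 hs]), one_mul]
    rw [this.deriv_eq, (hPd t).deriv]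
  have h1 := h β hβs hβc
  have h2 := hβc.integral_Ioi_deriv_eq (hβs.of_le (by simp)) 0
  rw [setIntegral_congr_fun measurableSet_Ioi hβd] at h2
  rw [setIntegral_congr_fun (g := fun t => g t * q t) measurableSet_Ioi fun t ht => by
    simp only [hβd t ht]] at h1
  have hgq : IntegrableOn (fun t => g t * q t) (Ioi 0) := by
    obtain ⟨m, hm⟩ := hg.continuous.bounded_above_of_compact_support hgc
    have h3 : IntegrableOn (fun t => g t * q t) (Ioo 0 B) :=
      (hq B).bdd_mul hg.continuous.aestronglyMeasurable (ae_of_all _ hm)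
    refine h3.of_forall_sdiff_eq_zero measurableSet_Ioi fun t ht => ?_
    have h4 : B ≤ t := le_of_not_gt fun h' => ht.2 ⟨ht.1, h'⟩
    rw [hgb t ((by linarith [le_max_left b 0] : b < t).trans_le (le_abs_self t)), zero_mul]
  calc ∫ t, g t • (q t - Q) = ∫ t in Ioi 0, g t • (q t - Q) := by
        refine (setIntegral_eq_integral_of_forall_compl_eq_zero fun t ht => ?_).symm
        rw [hg0 t (not_lt.1 ht), zero_smul]
    _ = (∫ t in Ioi 0, g t * q t) - ∫ t in Ioi 0, g t * Q := by
        simp only [smul_eq_mul, mul_sub]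
        exact integral_sub hgq
          ((hg.continuous.integrable_of_hasCompactSupport hgc).mul_const Q).integrableOn
    _ = 0 := by
        rw [integral_mul_const, h2]
        linarith

section Weak

variable {d : ℕ} {u : ℝ → Sp d → Sp d} {θ₀ : Sp d → ℝ} {θ : ℝ → Sp d → ℝ}

theorem restrict_prod_eq (s : Set ℝ) (t : Set (Sp d)) :
    (volume : Measure (ℝ × Sp d)).restrict (s ×ˢ t) =
      (volume.restrict s).prod (volume.restrict t) := by
  rw [Measure.prod_restrict]
  rfl

theorem IsWeakSolution.aestronglyMeasurable_restrict (hθ : IsWeakSolution u θ₀ θ) (T R : ℝ) :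
    AEStronglyMeasurable (fun p : ℝ × Sp d => θ p.1 p.2)
      (volume.restrict (Ioo 0 T ×ˢ Metric.ball (0 : Sp d) R)) :=
  hθ.meas.mono_set (prod_mono (fun _ h => h.1) (subset_univ _))

/-- Hölder's inequality between `L^∞` in time with values in `L¹` and `L¹` in time with values in
`L^∞`: a weight depending on time alone comes out of the space integral. -/
theorem lintegral_mul_le_of_bound {T R K : ℝ}
    (hm : AEStronglyMeasurable (fun p : ℝ × Sp d => θ p.1 p.2)
      (volume.restrict (Ioo 0 T ×ˢ Metric.ball (0 : Sp d) R)))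
    (hK : ∀ᵐ t ∂(volume.restrict (Ioo 0 T)),
      ∫⁻ x in Metric.ball (0 : Sp d) R, ‖θ t x‖ₑ ≤ ENNReal.ofReal K)
    {E : ℝ → ℝ≥0∞} (hE : AEMeasurable E) :
    ∫⁻ p in Ioo 0 T ×ˢ Metric.ball (0 : Sp d) R, ‖θ p.1 p.2‖ₑ * E p.1 ≤
      ENNReal.ofReal K * ∫⁻ t in Ioo 0 T, E t := by
  rw [restrict_prod_eq] at hm ⊢
  have hpm : AEMeasurable (fun p : ℝ × Sp d => ‖θ p.1 p.2‖ₑ * E p.1)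
      ((volume.restrict (Ioo 0 T)).prod (volume.restrict (Metric.ball (0 : Sp d) R))) :=
    hm.enorm.mul hE.restrict.comp_fst
  rw [lintegral_prod _ hpm, ← lintegral_const_mul'' _ hE.restrict]
  refine lintegral_mono_ae ?_
  filter_upwards [hK, hm.prodMk_left] with t ht htm
  rw [lintegral_mul_const'' _ htm.enorm]
  exact mul_le_mul_left ht _

theorem IsWeakSolution.lintegral_mul_le (hθ : IsWeakSolution u θ₀ θ) (T R : ℝ) :
    ∃ K : ℝ, 0 ≤ K ∧ ∀ E : ℝ → ℝ≥0∞, AEMeasurable E →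
      ∫⁻ p in Ioo 0 T ×ˢ Metric.ball (0 : Sp d) R, ‖θ p.1 p.2‖ₑ * E p.1 ≤
        ENNReal.ofReal K * ∫⁻ t in Ioo 0 T, E t := by
  obtain ⟨K, hK⟩ := hθ.bound T R
  exact ⟨max K 0, le_max_right _ _, fun E hE =>
    lintegral_mul_le_of_bound (hθ.aestronglyMeasurable_restrict T R)
      (hK.mono fun t ht => ht.trans (ENNReal.ofReal_le_ofReal (le_max_left _ _))) hE⟩

theorem IsWeakSolution.integrableOn (hθ : IsWeakSolution u θ₀ θ) (T R : ℝ) :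
    IntegrableOn (fun p : ℝ × Sp d => θ p.1 p.2) (Ioo 0 T ×ˢ Metric.ball (0 : Sp d) R) := by
  refine ⟨hθ.aestronglyMeasurable_restrict T R, ?_⟩
  obtain ⟨K, hK0, hK⟩ := hθ.lintegral_mul_le T R
  have := hK (fun _ => 1) aemeasurable_const
  simp only [mul_one, setLIntegral_one, Real.volume_Ioo] at this
  exact this.trans_lt (ENNReal.mul_lt_top ENNReal.ofReal_lt_top ENNReal.ofReal_lt_top)

/-- Products of a weak solution with bounded functions of compact support are integrable. -/
theorem IsWeakSolution.integrableOn_mul (hθ : IsWeakSolution u θ₀ θ) {f : ℝ × Sp d → ℝ}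
    (hf : AEStronglyMeasurable f) {T R m : ℝ} (hm : ∀ p, ‖f p‖ ≤ m)
    (hT : ∀ p, T ≤ p.1 → f p = 0) (hR : ∀ p, 0 < p.1 → R ≤ ‖p.2‖ → f p = 0) :
    IntegrableOn (fun p : ℝ × Sp d => θ p.1 p.2 * f p) (Ioi (0 : ℝ) ×ˢ univ) := by
  have h1 : IntegrableOn (fun p : ℝ × Sp d => θ p.1 p.2 * f p)
      (Ioo 0 T ×ˢ Metric.ball (0 : Sp d) R) :=
    (hθ.integrableOn T R).mul_bdd hf.restrict (ae_of_all _ hm)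
  refine h1.of_forall_sdiff_eq_zero (measurableSet_Ioi.prod MeasurableSet.univ) fun p hp => ?_
  have hp0 : 0 < p.1 := hp.1.1
  rcases le_or_gt T p.1 with h | h
  · rw [hT p h, mul_zero]
  · rw [hR p hp0 (not_lt.1 fun h' => hp.2 ⟨⟨hp0, h⟩, mem_ball_zero_iff.2 h'⟩), mul_zero]

/-- For passing between the given field and its extension by zero to nonpositive times. -/
theorem IsWeakSolution.congr_velocity (hθ : IsWeakSolution u θ₀ θ) {v : ℝ → Sp d → Sp d}
    (h : ∀ t, 0 < t → ∀ x, u t x = v t x) : IsWeakSolution v θ₀ θ where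
  meas := hθ.meas
  bound := hθ.bound
  integrable ψ hψ hψc := (hθ.integrable ψ hψ hψc).congr_fun
    (fun p hp => by simp only [h p.1 hp.1 p.2]) (measurableSet_Ioi.prod MeasurableSet.univ)
  eqn ψ hψ hψc := by
    have e : ∫ p in Ioi (0 : ℝ) ×ˢ univ, θ p.1 p.2 * fderiv ℝ ψ p (1, v p.1 p.2) =
        ∫ p in Ioi (0 : ℝ) ×ˢ univ, θ p.1 p.2 * fderiv ℝ ψ p (1, u p.1 p.2) :=
      setIntegral_congr_fun (measurableSet_Ioi.prod MeasurableSet.univ)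
        fun p hp => by rw [h p.1 hp.1 p.2]
    rw [e]
    exact hθ.eqn ψ hψ hψc

end Weak


/-! ### Duality with transported test functions -/

section Duality

variable {d : ℕ} {u : ℝ → Sp d → Sp d} {C Λ : ℝ → ℝ} {θ₀ : Sp d → ℝ} {θ : ℝ → Sp d → ℝ}

theorem OsgoodField.flow_of_nonpos (F : OsgoodField u C Λ) {t : ℝ} (ht : t ≤ 0) (x : Sp d) :
    F.flow t x = x :=
  F.flowMap_of_nonpos ht x

theorem OsgoodField.flow_symm_of_nonpos (F : OsgoodField u C Λ) {t : ℝ} (ht : t ≤ 0) (x : Sp d) :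
    (F.flow t).symm x = x := by
  rw [Homeomorph.symm_apply_eq, F.flow_of_nonpos ht]

theorem exists_forall_le_abs_eq_zero {β : ℝ → ℝ} (hβc : HasCompactSupport β) :
    ∃ T > 0, ∀ t, T ≤ |t| → β t = 0 ∧ deriv β t = 0 := by
  obtain ⟨b, hb⟩ := hβc.isCompact.isBounded.subset_closedBall 0
  refine ⟨max b 0 + 1, by positivity, fun t ht => ?_⟩
  have hn : t ∉ tsupport β := fun hmem => by
    have := hb hmem
    rw [mem_closedBall_zero_iff, Real.norm_eq_abs] at this
    linarith [le_max_left b 0]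
  exact ⟨image_eq_zero_of_notMem_tsupport hn, Function.notMem_support.1 fun h =>
    hn (support_deriv_subset h)⟩

theorem fderiv_fst_mul {β : ℝ → ℝ} (hβ : Differentiable ℝ β) {Ψ : ℝ × Sp d → ℝ}
    (hΨ : Differentiable ℝ Ψ) (p v : ℝ × Sp d) :
    fderiv ℝ (fun q : ℝ × Sp d => β q.1 * Ψ q) p v =
      β p.1 * fderiv ℝ Ψ p v + Ψ p * (deriv β p.1 * v.1) := by
  have h1 : HasFDerivAt (fun q : ℝ × Sp d => β q.1)
      ((deriv β p.1) • ContinuousLinearMap.fst ℝ ℝ (Sp d)) p :=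
    (hβ p.1).hasDerivAt.comp_hasFDerivAt p hasFDerivAt_fst
  have h2 : HasFDerivAt (fun q : ℝ × Sp d => β q.1 * Ψ q) _ p := h1.mul (hΨ p).hasFDerivAt
  rw [h2.fderiv]
  simp

/-- A weak solution, tested against functions transported by the flow, is conserved. -/
theorem IsWeakSolution.integral_transport (F : OsgoodField u C Λ) (hθ : IsWeakSolution u θ₀ θ)
    (hθ₀ : LocallyIntegrable θ₀) {χ : Sp d → ℝ} (hχ : Continuous χ) (hχc : HasCompactSupport χ)
    {β : ℝ → ℝ} (hβ : ContDiff ℝ ∞ β) (hβc : HasCompactSupport β) :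
    (∫ p in Ioi (0 : ℝ) ×ˢ (univ : Set (Sp d)),
      θ p.1 p.2 * (deriv β p.1 * χ ((F.flow p.1).symm p.2))) + β 0 * ∫ x, θ₀ x * χ x = 0 := by
  obtain ⟨T, hT, hβT⟩ := exists_forall_le_abs_eq_zero hβc
  obtain ⟨R, hR, hχR, happ⟩ := F.exists_smooth_approx_transport hχ hχc hT.le
  obtain ⟨m0, hm0⟩ := hβ.continuous.bounded_above_of_compact_support hβc
  obtain ⟨m1, hm1⟩ := (hβ.continuous_deriv (by simp)).bounded_above_of_compact_support hβc.deriv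
  obtain ⟨mχ, hmχ⟩ := hχ.bounded_above_of_compact_support hχc
  have hm00 : 0 ≤ m0 := (norm_nonneg _).trans (hm0 0)
  have hm10 : 0 ≤ m1 := (norm_nonneg _).trans (hm1 0)
  have hmχ0 : 0 ≤ mχ := (norm_nonneg _).trans (hmχ 0)
  obtain ⟨K, hK0, hK⟩ := hθ.lintegral_mul_le T (R + 1)
  have hfc : Continuous fun p : ℝ × Sp d => deriv β p.1 * χ ((F.flow p.1).symm p.2) :=
    ((hβ.continuous_deriv (by simp)).comp continuous_fst).mul (hχ.comp F.continuous_flow_symm)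
  have hf : IntegrableOn (fun p : ℝ × Sp d =>
      θ p.1 p.2 * (deriv β p.1 * χ ((F.flow p.1).symm p.2))) (Ioi (0 : ℝ) ×ˢ univ) := by
    refine hθ.integrableOn_mul (T := T) (R := R) (m := m1 * mχ) hfc.aestronglyMeasurable
      (fun p => ?_) (fun p hp => ?_) fun p hp0 hp => ?_
    · rw [norm_mul]
      exact mul_le_mul (hm1 _) (hmχ _) (norm_nonneg _) hm10
    · rw [(hβT p.1 (hp.trans (le_abs_self _))).2, zero_mul]
    · rcases le_total T p.1 with h | h
      · rw [(hβT p.1 (h.trans (le_abs_self _))).2, zero_mul]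
      · rw [hχR p.1 h p.2 hp, mul_zero]
  set I0 := ∫ x in Metric.closedBall (0 : Sp d) R, ‖θ₀ x‖ with hI0
  have hI : IntegrableOn θ₀ (Metric.closedBall (0 : Sp d) R) :=
    hθ₀.integrableOn_isCompact (isCompact_closedBall _ _)
  set D := (∫ p in Ioi (0 : ℝ) ×ˢ (univ : Set (Sp d)),
      θ p.1 p.2 * (deriv β p.1 * χ ((F.flow p.1).symm p.2))) + β 0 * ∫ x, θ₀ x * χ x with hD
  -- The constants do not depend on `κ`, since the radius `R` was obtained before the approximation.
  suffices h : ∀ κ > 0, |D| ≤ (K * (m1 * T + m0) + m0 * I0) * κ by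
    have hlim : Tendsto (fun κ : ℝ => (K * (m1 * T + m0) + m0 * I0) * κ) (𝓝[>] 0) (𝓝 0) := by
      have : Tendsto (fun κ : ℝ => (K * (m1 * T + m0) + m0 * I0) * κ) (𝓝 0)
          (𝓝 ((K * (m1 * T + m0) + m0 * I0) * 0)) := (continuous_const.mul continuous_id).tendsto 0
      rw [mul_zero] at this
      exact this.mono_left nhdsWithin_le_nhds
    exact abs_nonpos_iff.1 (ge_of_tendsto hlim (eventually_mem_nhdsWithin.mono fun κ hκ => h κ hκ))
  intro κ hκ
  obtain ⟨Ψ, E, hΨs, hΨχ, hΨR, hEm, hE, hEκ⟩ := happ κ hκ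
  have hβd := hβ.differentiable (by simp)
  have hΨd := hΨs.differentiable (by simp)
  -- `Ψ` vanishes for large `y` only up to time `T`; the factor `β`, supported in `[-T, T]`,
  -- supplies compact support in space-time.
  set ψ : ℝ × Sp d → ℝ := fun q => β q.1 * Ψ q with hψ
  have hψs : ContDiff ℝ ∞ ψ := (hβ.comp contDiff_fst).mul hΨs
  have hψc : HasCompactSupport ψ := by
    refine HasCompactSupport.intro
      ((isCompact_Icc (a := -T) (b := T)).prod (isCompact_closedBall (0 : Sp d) R)) fun p hp => ?_
    rcases le_or_gt T |p.1| with h | h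
    · simp only [hψ, (hβT p.1 h).1, zero_mul]
    · have h1 : R ≤ ‖p.2‖ := by
        by_contra h'
        exact hp ⟨⟨(abs_lt.1 h).1.le, (abs_lt.1 h).2.le⟩,
          mem_closedBall_zero_iff.2 (not_le.1 h').le⟩
      have : Ψ p = 0 := hΨR p.1 (abs_lt.1 h).2.le p.2 h1
      simp only [hψ, this, mul_zero]
  have heq := hθ.eqn ψ hψs hψc
  have hint := hθ.integrable ψ hψs hψc
  -- the initial data
  have hini : |(∫ x, θ₀ x * (β 0 * χ x)) - ∫ x, θ₀ x * ψ (0, x)| ≤ m0 * I0 * κ := by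
    have hz : ∀ x, x ∉ Metric.closedBall (0 : Sp d) R → χ x = 0 ∧ Ψ (0, x) = 0 := fun x hx => by
      rw [mem_closedBall_zero_iff, not_le] at hx
      have h1 := hχR 0 hT.le x hx.le
      rw [F.flow_symm_of_nonpos le_rfl] at h1
      exact ⟨h1, hΨR 0 hT.le x hx.le⟩
    rw [← setIntegral_eq_integral_of_forall_compl_eq_zero
        (s := Metric.closedBall (0 : Sp d) R) (f := fun x => θ₀ x * (β 0 * χ x))
        (fun x hx => by rw [(hz x hx).1, mul_zero, mul_zero]),
      ← setIntegral_eq_integral_of_forall_compl_eq_zero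
        (s := Metric.closedBall (0 : Sp d) R) (f := fun x => θ₀ x * ψ (0, x))
        (fun x hx => by simp only [hψ, (hz x hx).2, mul_zero]),
      ← integral_sub]
    · rw [← Real.norm_eq_abs]
      refine (norm_integral_le_of_norm_le (hI.norm.mul_const (m0 * κ)) (ae_of_all _ fun x => ?_)).trans
        (le_of_eq ?_)
      · rw [← mul_sub, norm_mul]
        refine mul_le_mul_of_nonneg_left ?_ (norm_nonneg _)
        simp only [hψ]
        rw [← mul_sub, norm_mul]
        refine mul_le_mul (hm0 0) ?_ (norm_nonneg _) hm00
        have := hΨχ 0 ⟨by linarith, hT.le⟩ x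
        rw [F.flow_symm_of_nonpos le_rfl] at this
        rwa [Real.norm_eq_abs, abs_sub_comm]
      · rw [integral_mul_const]
        ring
    · refine hI.mul_bdd (c := m0 * mχ) (continuous_const.mul hχ).aestronglyMeasurable
        (ae_of_all _ fun x => ?_)
      rw [norm_mul]
      exact mul_le_mul (hm0 0) (hmχ x) (norm_nonneg _) hm00
    · obtain ⟨m2, hm2⟩ := hψs.continuous.bounded_above_of_compact_support hψc
      exact hI.mul_bdd (c := m2)
        (hψs.continuous.comp (continuous_const.prodMk continuous_id)).aestronglyMeasurable
        (ae_of_all _ fun x => hm2 _)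
  -- the evolution
  set E' : ℝ → ℝ≥0∞ := fun t => ENNReal.ofReal (m1 * κ) + ENNReal.ofReal m0 * E t with hE'
  have hpt : ∀ p ∈ Ioi (0 : ℝ) ×ˢ (univ : Set (Sp d)),
      ‖θ p.1 p.2 * (deriv β p.1 * χ ((F.flow p.1).symm p.2)) -
        θ p.1 p.2 * fderiv ℝ ψ p (1, u p.1 p.2)‖ₑ ≤
      (Ioo 0 T ×ˢ Metric.ball (0 : Sp d) (R + 1)).indicator
        (fun p => ‖θ p.1 p.2‖ₑ * E' p.1) p := by
    rintro ⟨t, y⟩ ⟨ht0, -⟩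
    simp only [mem_Ioi] at ht0
    rw [hψ, fderiv_fst_mul hβd hΨd]
    simp only
    rcases le_or_gt T t with h | h
    · have := hβT t (h.trans (le_abs_self _))
      rw [this.1, this.2]
      simp
    have hdiff := hΨχ t ⟨by linarith, h.le⟩ y
    rcases le_or_gt ‖y‖ R with hy | hy
    · rw [indicator_of_mem (show (t, y) ∈ Ioo 0 T ×ˢ Metric.ball (0 : Sp d) (R + 1) from
        ⟨⟨ht0, h⟩, mem_ball_zero_iff.2 (by linarith)⟩), ← mul_sub, enorm_mul]
      refine mul_le_mul_right ?_ _
      -- Two errors: `Ψ` against `χ ∘ φ_t⁻¹`, uniformly at most `κ`, and the derivative of `Ψ` along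
      -- `(1, u)`, whose bound `E` is small in `L¹` in time.
      rw [show deriv β t * χ ((F.flow t).symm y) -
          (β t * fderiv ℝ Ψ (t, y) (1, u t y) + Ψ (t, y) * (deriv β t * 1)) =
          -(deriv β t * (Ψ (t, y) - χ ((F.flow t).symm y))) -
            β t * fderiv ℝ Ψ (t, y) (1, u t y) by ring]
      refine (enorm_sub_le).trans (add_le_add ?_ ?_)
      · rw [← ofReal_norm, norm_neg, norm_mul]
        exact ENNReal.ofReal_le_ofReal (mul_le_mul (hm1 t) hdiff (norm_nonneg _) hm10)
      · rw [enorm_mul, ← ofReal_norm (β t)]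
        exact mul_le_mul' (ENNReal.ofReal_le_ofReal (hm0 t)) (hE t y hy)
    · have h1 : Ψ =ᶠ[𝓝 (t, y)] fun _ => 0 := by
        have : ∀ᶠ q : ℝ × Sp d in 𝓝 (t, y), q.1 < T ∧ R < ‖q.2‖ :=
          (continuous_fst.continuousAt.eventually (gt_mem_nhds h)).and
            (continuous_snd.norm.continuousAt.eventually (lt_mem_nhds hy))
        filter_upwards [this] with q hq using hΨR q.1 hq.1.le q.2 hq.2.le
      rw [h1.fderiv_eq, h1.eq_of_nhds, hχR t h.le y hy.le]
      simp
  have hevo : |(∫ p in Ioi (0 : ℝ) ×ˢ (univ : Set (Sp d)),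
      θ p.1 p.2 * (deriv β p.1 * χ ((F.flow p.1).symm p.2))) -
      ∫ p in Ioi (0 : ℝ) ×ˢ (univ : Set (Sp d)), θ p.1 p.2 * fderiv ℝ ψ p (1, u p.1 p.2)| ≤
      K * (m1 * T + m0) * κ := by
    rw [← integral_sub hf hint, ← Real.norm_eq_abs,
      ← ENNReal.ofReal_le_ofReal_iff (by positivity), ofReal_norm]
    calc _ ≤ ∫⁻ p in Ioi (0 : ℝ) ×ˢ (univ : Set (Sp d)), _ := enorm_integral_le_lintegral_enorm _
      _ ≤ ∫⁻ p in Ioi (0 : ℝ) ×ˢ (univ : Set (Sp d)),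
          (Ioo 0 T ×ˢ Metric.ball (0 : Sp d) (R + 1)).indicator
            (fun p => ‖θ p.1 p.2‖ₑ * E' p.1) p :=
        setLIntegral_mono' (measurableSet_Ioi.prod MeasurableSet.univ) hpt
      _ ≤ ∫⁻ p, (Ioo 0 T ×ˢ Metric.ball (0 : Sp d) (R + 1)).indicator
            (fun p => ‖θ p.1 p.2‖ₑ * E' p.1) p := setLIntegral_le_lintegral _ _
      _ = ∫⁻ p in Ioo 0 T ×ˢ Metric.ball (0 : Sp d) (R + 1), ‖θ p.1 p.2‖ₑ * E' p.1 :=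
        lintegral_indicator (measurableSet_Ioo.prod Metric.isOpen_ball.measurableSet) _
      _ ≤ ENNReal.ofReal K * ∫⁻ t in Ioo 0 T, E' t :=
        hK E' (aemeasurable_const.add (hEm.const_mul _))
      _ ≤ ENNReal.ofReal K * (ENNReal.ofReal (m1 * κ) * ENNReal.ofReal T +
            ENNReal.ofReal m0 * ENNReal.ofReal κ) := by
        refine mul_le_mul_right ?_ _
        rw [hE', lintegral_add_left measurable_const, lintegral_const_mul'' _ hEm.restrict,
          setLIntegral_const, Real.volume_Ioo, sub_zero]
        exact add_le_add le_rfl (mul_le_mul_right hEκ _)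
      _ = ENNReal.ofReal (K * (m1 * T + m0) * κ) := by
        rw [← ENNReal.ofReal_mul (by positivity), ← ENNReal.ofReal_mul (by positivity),
          ← ENNReal.ofReal_add (by positivity) (by positivity), ← ENNReal.ofReal_mul hK0]
        congr 1
        ring
  have h1 : β 0 * ∫ x, θ₀ x * χ x = ∫ x, θ₀ x * (β 0 * χ x) := by
    rw [← integral_const_mul]
    exact integral_congr_ae (ae_of_all _ fun x => by ring)
  rw [hD, h1]
  have h2 := abs_add_le ((∫ p in Ioi (0 : ℝ) ×ˢ (univ : Set (Sp d)),
      θ p.1 p.2 * (deriv β p.1 * χ ((F.flow p.1).symm p.2))) -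
      ∫ p in Ioi (0 : ℝ) ×ˢ (univ : Set (Sp d)), θ p.1 p.2 * fderiv ℝ ψ p (1, u p.1 p.2))
      ((∫ x, θ₀ x * (β 0 * χ x)) - ∫ x, θ₀ x * ψ (0, x))
  rw [sub_add_sub_comm, heq, sub_zero] at h2
  linarith

/-- At almost every time, a weak solution tested against a transported function takes the initial
value. -/
theorem IsWeakSolution.ae_integral_transport (F : OsgoodField u C Λ) (hθ : IsWeakSolution u θ₀ θ)
    (hθ₀ : LocallyIntegrable θ₀) {χ : Sp d → ℝ} (hχ : Continuous χ) (hχc : HasCompactSupport χ) :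
    ∀ᵐ t ∂(volume.restrict (Ioi (0 : ℝ))),
      ∫ y, θ t y * χ ((F.flow t).symm y) = ∫ x, θ₀ x * χ x := by
  obtain ⟨mχ, hmχ⟩ := hχ.bounded_above_of_compact_support hχc
  have hcomp : Continuous fun p : ℝ × Sp d => χ ((F.flow p.1).symm p.2) :=
    hχ.comp F.continuous_flow_symm
  refine ae_eq_of_forall_integral_deriv (fun T => ?_) fun β hβ hβc => ?_
  · rcases le_or_gt T 0 with hT | hT
    · rw [Ioo_eq_empty (not_lt.2 hT)]
      exact integrableOn_empty
    obtain ⟨R, hR, hχR, -⟩ := F.exists_smooth_approx_transport hχ hχc hT.le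
    -- Integrability is needed only on `(0, T)`; the indicator of `t < T` supplies the vanishing at
    -- later times.
    have h1 : IntegrableOn (fun p : ℝ × Sp d => θ p.1 p.2 *
        ((Iio T).indicator (fun _ => (1 : ℝ)) p.1 * χ ((F.flow p.1).symm p.2)))
        (Ioi (0 : ℝ) ×ˢ univ) := by
      refine hθ.integrableOn_mul (T := T) (R := R) (m := mχ)
        (((measurable_const.indicator measurableSet_Iio).comp
          measurable_fst).aestronglyMeasurable.mul hcomp.aestronglyMeasurable)
        (fun p => ?_) (fun p hp => ?_) fun p hp0 hp => ?_
      · by_cases h : p.1 ∈ Iio T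
        · rw [indicator_of_mem h, one_mul]
          exact hmχ _
        · rw [indicator_of_notMem h, zero_mul, norm_zero]
          exact (norm_nonneg _).trans (hmχ 0)
      · rw [indicator_of_notMem (show p.1 ∉ Iio T from not_lt.2 hp), zero_mul]
      · by_cases h : p.1 ∈ Iio T
        · rw [hχR p.1 (le_of_lt h) p.2 hp, mul_zero]
        · rw [indicator_of_notMem h, zero_mul]
    have h2 : IntegrableOn (fun p : ℝ × Sp d => θ p.1 p.2 * χ ((F.flow p.1).symm p.2))
        (Ioo (0 : ℝ) T ×ˢ univ) := by
      refine (h1.mono_set (prod_mono (fun _ h => h.1) le_rfl)).congr_fun (fun p hp => ?_)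
        (measurableSet_Ioo.prod MeasurableSet.univ)
      simp only
      rw [indicator_of_mem (show p.1 ∈ Iio T from hp.1.2), one_mul]
    rw [IntegrableOn, restrict_prod_eq, Measure.restrict_univ] at h2
    exact h2.integral_prod_left
  · obtain ⟨T, hT, hβT⟩ := exists_forall_le_abs_eq_zero hβc
    obtain ⟨m1, hm1⟩ := (hβ.continuous_deriv (by simp)).bounded_above_of_compact_support hβc.deriv
    obtain ⟨R, hR, hχR, -⟩ := F.exists_smooth_approx_transport hχ hχc hT.le
    have key := hθ.integral_transport F hθ₀ hχ hχc hβ hβc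
    have hfc : Continuous fun p : ℝ × Sp d => deriv β p.1 * χ ((F.flow p.1).symm p.2) :=
      ((hβ.continuous_deriv (by simp)).comp continuous_fst).mul hcomp
    have hf : IntegrableOn (fun p : ℝ × Sp d =>
        θ p.1 p.2 * (deriv β p.1 * χ ((F.flow p.1).symm p.2))) (Ioi (0 : ℝ) ×ˢ univ) := by
      refine hθ.integrableOn_mul (T := T) (R := R) (m := m1 * mχ) hfc.aestronglyMeasurable
        (fun p => ?_) (fun p hp => ?_) fun p hp0 hp => ?_
      · rw [norm_mul]
        exact mul_le_mul (hm1 _) (hmχ _) (norm_nonneg _) ((norm_nonneg _).trans (hm1 0))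
      · rw [(hβT p.1 (hp.trans (le_abs_self _))).2, zero_mul]
      · rcases le_total T p.1 with h | h
        · rw [(hβT p.1 (h.trans (le_abs_self _))).2, zero_mul]
        · rw [hχR p.1 h p.2 hp, mul_zero]
    rw [IntegrableOn, restrict_prod_eq, Measure.restrict_univ] at hf
    rw [restrict_prod_eq, Measure.restrict_univ, integral_prod _ hf] at key
    have e : ∫ t in Ioi (0 : ℝ), deriv β t * ∫ y, θ t y * χ ((F.flow t).symm y) =
        ∫ t in Ioi (0 : ℝ), ∫ y, θ t y * (deriv β t * χ ((F.flow t).symm y)) := by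
      refine integral_congr_ae (ae_of_all _ fun t => ?_)
      simp only
      rw [← integral_const_mul]
      exact integral_congr_ae (ae_of_all _ fun y => by simp only; ring)
    rw [e]
    exact key

end Duality


/-! ### Preservation of volume -/

section Volume

variable {d : ℕ} {u : ℝ → Sp d → Sp d} {C Λ : ℝ → ℝ}

theorem exists_forall_eq_zero_of_hasCompactSupport {ψ : ℝ × Sp d → ℝ} (hψc : HasCompactSupport ψ) :
    ∃ R > 0, ∀ p : ℝ × Sp d, R ≤ |p.1| ∨ R ≤ ‖p.2‖ → fderiv ℝ ψ p = 0 ∧ ψ p = 0 := by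
  obtain ⟨b, hb⟩ := hψc.isCompact.isBounded.subset_closedBall 0
  refine ⟨max b 0 + 1, by positivity, fun p hp => ?_⟩
  have hn : p ∉ tsupport ψ := fun hmem => by
    have h1 := hb hmem
    rw [mem_closedBall_zero_iff, Prod.norm_def, Real.norm_eq_abs, max_le_iff] at h1
    rcases hp with hp | hp <;> linarith [le_max_left b 0, h1.1, h1.2]
  exact ⟨Function.notMem_support.1 fun h => hn (support_fderiv_subset ℝ h),
    image_eq_zero_of_notMem_tsupport hn⟩

namespace OsgoodField

variable (F : OsgoodField u C Λ)

include F

theorem measurable_fderiv_apply {ψ : ℝ × Sp d → ℝ} (hψ : ContDiff ℝ ∞ ψ) :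
    Measurable fun p : ℝ × Sp d => fderiv ℝ ψ p (1, u p.1 p.2) := by
  have h1 : Continuous fun q : (ℝ × Sp d) × (ℝ × Sp d) => fderiv ℝ ψ q.1 q.2 :=
    ((hψ.continuous_fderiv (by simp)).comp continuous_fst).clm_apply continuous_snd
  exact h1.measurable.comp (measurable_id.prodMk (measurable_const.prodMk F.meas))

/-- On the bounded support of `ψ`, the linear growth of `u` gives a bound by a locally integrable
function of time alone, the kind of weight that pairs with `L^∞` in time and `L¹` in space. -/
theorem exists_fderiv_apply_le {ψ : ℝ × Sp d → ℝ} (hψ : ContDiff ℝ ∞ ψ)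
    (hψc : HasCompactSupport ψ) :
    ∃ h : ℝ → ℝ, (∀ a b, IntervalIntegrable h volume a b) ∧
      ∀ t y, ‖fderiv ℝ ψ (t, y) (1, u t y)‖ ≤ h t := by
  obtain ⟨g, hg0, hgi, hg⟩ := F.exists_growth
  obtain ⟨R, hR, hψR⟩ := exists_forall_eq_zero_of_hasCompactSupport hψc
  obtain ⟨M, hM⟩ := (hψ.continuous_fderiv (by simp)).bounded_above_of_compact_support
    (hψc.fderiv ℝ)
  have hM0 : 0 ≤ M := (norm_nonneg _).trans (hM 0)
  refine ⟨fun t => M * (1 + g t * (1 + R)), fun a b =>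
    (intervalIntegrable_const.add ((hgi a b).mul_const _)).const_mul _, fun t y => ?_⟩
  rcases le_total R ‖y‖ with hy | hy
  · rw [(hψR (t, y) (Or.inr hy)).1, zero_apply, norm_zero]
    have := hg0 t
    positivity
  · refine (ContinuousLinearMap.le_opNorm _ _).trans
      (mul_le_mul (hM _) ?_ (norm_nonneg _) hM0)
    have h1 := (hg t y).trans (mul_le_mul_of_nonneg_left (by linarith : 1 + ‖y‖ ≤ 1 + R) (hg0 t))
    rw [Prod.norm_def, max_le_iff, norm_one]
    constructor
    · linarith [norm_nonneg (u t y)]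
    · linarith

theorem integrableOn_mul_fderiv {θ : ℝ → Sp d → ℝ}
    (hm : AEStronglyMeasurable (fun p : ℝ × Sp d => θ p.1 p.2)
      (volume.restrict (Ioi (0 : ℝ) ×ˢ (univ : Set (Sp d)))))
    (hb : ∀ T R : ℝ, ∃ K : ℝ, ∀ᵐ t ∂(volume.restrict (Ioo 0 T)),
      ∫⁻ x in Metric.ball (0 : Sp d) R, ‖θ t x‖ₑ ≤ ENNReal.ofReal K)
    {ψ : ℝ × Sp d → ℝ} (hψ : ContDiff ℝ ∞ ψ) (hψc : HasCompactSupport ψ) :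
    IntegrableOn (fun p : ℝ × Sp d => θ p.1 p.2 * fderiv ℝ ψ p (1, u p.1 p.2))
      (Ioi (0 : ℝ) ×ˢ (univ : Set (Sp d))) := by
  refine ⟨hm.mul (F.measurable_fderiv_apply hψ).aestronglyMeasurable, ?_⟩
  obtain ⟨h, hhi, hh⟩ := F.exists_fderiv_apply_le hψ hψc
  obtain ⟨R, hR, hψR⟩ := exists_forall_eq_zero_of_hasCompactSupport hψc
  obtain ⟨K, hK⟩ := hb R R
  have hhm : AEMeasurable h :=
    (locallyIntegrable_of_forall_intervalIntegrable hhi).aestronglyMeasurable.aemeasurable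
  calc ∫⁻ p in Ioi (0 : ℝ) ×ˢ (univ : Set (Sp d)),
        ‖θ p.1 p.2 * fderiv ℝ ψ p (1, u p.1 p.2)‖ₑ
      ≤ ∫⁻ p in Ioi (0 : ℝ) ×ˢ (univ : Set (Sp d)),
          (Ioo 0 R ×ˢ Metric.ball (0 : Sp d) R).indicator
            (fun p => ‖θ p.1 p.2‖ₑ * ‖h p.1‖ₑ) p := by
        refine setLIntegral_mono' (measurableSet_Ioi.prod MeasurableSet.univ) fun p hp => ?_
        by_cases hpR : p ∈ Ioo 0 R ×ˢ Metric.ball (0 : Sp d) R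
        · rw [indicator_of_mem hpR, enorm_mul]
          refine mul_le_mul_right ?_ _
          rw [enorm_le_iff_norm_le]
          exact (hh p.1 p.2).trans (le_abs_self _)
        · have : R ≤ |p.1| ∨ R ≤ ‖p.2‖ := by
            by_contra! h'
            exact hpR ⟨⟨hp.1, (abs_lt.1 h'.1).2⟩, mem_ball_zero_iff.2 h'.2⟩
          rw [(hψR p this).1, zero_apply, mul_zero, enorm_zero]
          exact zero_le
    _ ≤ ∫⁻ p, (Ioo 0 R ×ˢ Metric.ball (0 : Sp d) R).indicator
            (fun p => ‖θ p.1 p.2‖ₑ * ‖h p.1‖ₑ) p := setLIntegral_le_lintegral _ _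
    _ = ∫⁻ p in Ioo 0 R ×ˢ Metric.ball (0 : Sp d) R, ‖θ p.1 p.2‖ₑ * ‖h p.1‖ₑ :=
        lintegral_indicator (measurableSet_Ioo.prod Metric.isOpen_ball.measurableSet) _
    _ ≤ ENNReal.ofReal K * ∫⁻ t in Ioo 0 R, ‖h t‖ₑ :=
        lintegral_mul_le_of_bound
          (hm.mono_set (prod_mono (fun _ h => h.1) (subset_univ _))) hK hhm.enorm
    _ < ⊤ := ENNReal.mul_lt_top ENNReal.ofReal_lt_top
        (((intervalIntegrable_iff_integrableOn_Ioo_of_le hR.le).1 (hhi 0 R)).2)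

/-- Constants are weak solutions for divergence free fields. -/
theorem isWeakSolution_one (hdiv : ∀ t, 0 < t → IsDivFree (u t)) :
    IsWeakSolution u (fun _ => 1) fun _ _ => 1 := by
  have hm : AEStronglyMeasurable (fun _ : ℝ × Sp d => (1 : ℝ))
      (volume.restrict (Ioi (0 : ℝ) ×ˢ (univ : Set (Sp d)))) := aestronglyMeasurable_const
  have hb : ∀ T R : ℝ, ∃ K : ℝ, ∀ᵐ t : ℝ ∂(volume.restrict (Ioo 0 T)),
      ∫⁻ _ in Metric.ball (0 : Sp d) R, ‖(1 : ℝ)‖ₑ ≤ ENNReal.ofReal K := fun T R => by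
    refine ⟨(volume (Metric.ball (0 : Sp d) R)).toReal, ae_of_all _ fun t => ?_⟩
    rw [ENNReal.ofReal_toReal measure_ball_lt_top.ne]
    simp
  have hint := fun (ψ : ℝ × Sp d → ℝ) (hψ : ContDiff ℝ ∞ ψ) (hψc : HasCompactSupport ψ) =>
    F.integrableOn_mul_fderiv (θ := fun _ _ => 1) hm hb hψ hψc
  refine ⟨hm, hb, hint, fun ψ hψ hψc => ?_⟩
  have htot := hint ψ hψ hψc
  simp only [one_mul] at htot ⊢
  have hψd := hψ.differentiable (by simp)
  have hAc : Continuous fun p : ℝ × Sp d => fderiv ℝ ψ p (1, 0) :=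
    (hψ.continuous_fderiv (by simp)).clm_apply continuous_const
  have hAi : Integrable fun p : ℝ × Sp d => fderiv ℝ ψ p (1, 0) :=
    hAc.integrable_of_hasCompactSupport (hψc.fderiv_apply ℝ _)
  -- The spatial part integrates to zero on each time slice because `u t` is divergence free; the
  -- time part is integrated first in `t` and leaves the initial value.
  have hsplit : ∀ p : ℝ × Sp d, fderiv ℝ ψ p (1, u p.1 p.2) - fderiv ℝ ψ p (1, 0) =
      fderiv ℝ ψ p (0, u p.1 p.2) := fun p => by
    rw [← map_sub]
    simp
  have hBi := htot.sub hAi.integrableOn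
  have hB : ∫ p in Ioi (0 : ℝ) ×ˢ (univ : Set (Sp d)),
      (fderiv ℝ ψ p (1, u p.1 p.2) - fderiv ℝ ψ p (1, 0)) = 0 := by
    rw [IntegrableOn, restrict_prod_eq, Measure.restrict_univ] at hBi
    rw [restrict_prod_eq, Measure.restrict_univ]
    have e := integral_prod _ hBi
    simp only [Pi.sub_apply] at e
    rw [e, setIntegral_congr_fun (g := fun _ => (0 : ℝ)) measurableSet_Ioi, integral_zero]
    intro t ht
    have hs : ContDiff ℝ ∞ fun y : Sp d => ψ (t, y) := hψ.comp (contDiff_const.prodMk contDiff_id)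
    have hsc : HasCompactSupport fun y : Sp d => ψ (t, y) := by
      obtain ⟨R, hR, hψR⟩ := exists_forall_eq_zero_of_hasCompactSupport hψc
      refine HasCompactSupport.intro (isCompact_closedBall (0 : Sp d) R) fun y hy => ?_
      rw [mem_closedBall_zero_iff, not_le] at hy
      exact (hψR (t, y) (Or.inr hy.le)).2
    refine Eq.trans ?_ (hdiv t ht _ hs hsc)
    refine integral_congr_ae (ae_of_all _ fun y => ?_)
    simp only
    rw [hsplit]
    have h1 : HasFDerivAt (fun y : Sp d => ψ (t, y))
        ((fderiv ℝ ψ (t, y)).comp (ContinuousLinearMap.inr ℝ ℝ (Sp d))) y :=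
      (hψd (t, y)).hasFDerivAt.comp y (hasFDerivAt_prodMk_right t y)
    rw [h1.fderiv]
    simp
  have hA : ∫ p in Ioi (0 : ℝ) ×ˢ (univ : Set (Sp d)), fderiv ℝ ψ p (1, 0) =
      -∫ x, ψ (0, x) := by
    have hAi' := hAi.integrableOn (s := Ioi (0 : ℝ) ×ˢ (univ : Set (Sp d)))
    rw [IntegrableOn, restrict_prod_eq, Measure.restrict_univ] at hAi'
    rw [restrict_prod_eq, Measure.restrict_univ, integral_prod_symm _ hAi', ← integral_neg]
    refine integral_congr_ae (ae_of_all _ fun y => ?_)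
    have hs : ContDiff ℝ 1 fun t : ℝ => ψ (t, y) :=
      (hψ.comp (contDiff_id.prodMk contDiff_const)).of_le (by simp)
    have hsc : HasCompactSupport fun t : ℝ => ψ (t, y) := by
      obtain ⟨R, hR, hψR⟩ := exists_forall_eq_zero_of_hasCompactSupport hψc
      refine HasCompactSupport.intro (isCompact_closedBall (0 : ℝ) R) fun t ht => ?_
      rw [mem_closedBall_zero_iff, not_le] at ht
      exact (hψR (t, y) (Or.inl ht.le)).2
    simp only
    rw [← hsc.integral_Ioi_deriv_eq hs 0]
    refine integral_congr_ae (ae_of_all _ fun t => ?_)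
    have h1 : HasDerivAt (fun t : ℝ => ψ (t, y)) (fderiv ℝ ψ (t, y) (1, 0)) t :=
      (hψd (t, y)).hasFDerivAt.comp_hasDerivAt t ((hasDerivAt_id t).prodMk (hasDerivAt_const t y))
    exact h1.deriv.symm
  rw [integral_sub htot hAi.integrableOn, hA] at hB
  linarith

/-- Duality for the solution `1`. It gives the identity at almost every time, and continuity in time
of the left-hand side extends it to every positive time. -/
theorem integral_comp_flow_symm (hdiv : ∀ t, 0 < t → IsDivFree (u t)) {χ : Sp d → ℝ}
    (hχ : Continuous χ) (hχc : HasCompactSupport χ) {t : ℝ} (ht : 0 < t) :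
    ∫ y, χ ((F.flow t).symm y) = ∫ x, χ x := by
  have h1 := (F.isWeakSolution_one hdiv).ae_integral_transport F
    (locallyIntegrable_const 1) hχ hχc
  simp only [one_mul] at h1
  obtain ⟨R, hR, hχR, -⟩ := F.exists_smooth_approx_transport hχ hχc (T := t + 1) (by linarith)
  have hcont : ContinuousOn (fun s => ∫ y, χ ((F.flow s).symm y)) (Ioo 0 (t + 1)) := by
    refine continuousOn_integral_of_compact_support (isCompact_closedBall (0 : Sp d) R)
      (hχ.comp F.continuous_flow_symm).continuousOn fun s y hs hy => ?_
    rw [mem_closedBall_zero_iff, not_le] at hy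
    exact hχR s hs.2.le y hy.le
  exact Measure.eqOn_open_of_ae_eq
    (ae_mono (Measure.restrict_mono (fun _ h => h.1) le_rfl) h1 :
      (fun s => ∫ y, χ ((F.flow s).symm y)) =ᵐ[volume.restrict (Ioo 0 (t + 1))]
        fun _ => ∫ x, χ x) isOpen_Ioo hcont continuousOn_const ⟨ht, lt_add_one t⟩

/-- The flow of a divergence free field preserves volume. -/
theorem measurePreserving_flow (hdiv : ∀ t, 0 < t → IsDivFree (u t)) (t : ℝ) :
    MeasurePreserving (F.flow t) volume volume := by
  rcases le_or_gt t 0 with ht | ht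
  · have : (F.flow t : Sp d → Sp d) = id := funext fun x => F.flow_of_nonpos ht x
    rw [this]
    exact MeasurePreserving.id _
  -- The integral identity describes the image measure under the inverse map; two regular measures
  -- with equal integrals of compactly supported continuous functions coincide.
  suffices h : MeasurePreserving (F.flow t).symm.toMeasurableEquiv volume volume from h.symm
  refine ⟨(F.flow t).symm.continuous.measurable, ?_⟩
  have : (Measure.map (F.flow t).symm.toMeasurableEquiv volume).Regular := Measure.Regular.map _
  refine Measure.ext_of_integral_eq_on_compactlySupported fun χ => ?_
  refine Eq.trans ?_ (F.integral_comp_flow_symm hdiv χ.continuous χ.hasCompactSupport ht)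
  exact integral_map_equiv (F.flow t).symm.toMeasurableEquiv χ

end OsgoodField

end Volume


/-! ### The Lagrangian solution and uniqueness -/

section Lagrangian

variable {d : ℕ} {u : ℝ → Sp d → Sp d} {C Λ : ℝ → ℝ} {θ₀ : Sp d → ℝ}

namespace OsgoodField

variable (F : OsgoodField u C Λ)

/-- The flow as a homeomorphism of space-time. -/
noncomputable def spaceTimeFlow : ℝ × Sp d ≃ₜ ℝ × Sp d where
  toFun p := (p.1, F.flow p.1 p.2)
  invFun p := (p.1, (F.flow p.1).symm p.2)
  left_inv p := Prod.ext rfl ((F.flow p.1).symm_apply_apply p.2)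
  right_inv p := Prod.ext rfl ((F.flow p.1).apply_symm_apply p.2)
  continuous_toFun := continuous_fst.prodMk F.continuous_flow
  continuous_invFun := continuous_fst.prodMk F.continuous_flow_symm

include F

theorem measurePreserving_spaceTimeFlow (hdiv : ∀ t, 0 < t → IsDivFree (u t)) :
    MeasurePreserving F.spaceTimeFlow
      ((volume.restrict (Ioi 0)).prod volume) ((volume.restrict (Ioi 0)).prod volume) :=
  (MeasurePreserving.id _).skew_product (g := fun t x => F.flow t x) F.continuous_flow.measurable
    (ae_of_all _ fun t => (F.measurePreserving_flow hdiv t).map_eq)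

theorem exists_flow_symm_image_subset (T R : ℝ) :
    ∃ R', ∀ t ∈ Icc 0 T, ∀ y, ‖y‖ ≤ R → ‖(F.flow t).symm y‖ ≤ R' := by
  obtain ⟨R', hR'⟩ := ((isCompact_Icc (a := (0 : ℝ)) (b := T)).prod
    (isCompact_closedBall (0 : Sp d) R)).exists_bound_of_continuousOn
    F.continuous_flow_symm.continuousOn
  exact ⟨R', fun t ht y hy => hR' (t, y) ⟨ht, mem_closedBall_zero_iff.2 hy⟩⟩

/-- The integrand is the derivative of `t ↦ ψ (t, φ_t x)` along an absolutely continuous curve, and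
`ψ` vanishes at late times. -/
theorem integral_fderiv_along_flow {ψ : ℝ × Sp d → ℝ} (hψ : ContDiff ℝ ∞ ψ)
    (hψc : HasCompactSupport ψ) (x : Sp d) :
    ∫ t in Ioi (0 : ℝ), fderiv ℝ ψ (t, F.flow t x) (1, u t (F.flow t x)) = -ψ (0, x) := by
  obtain ⟨R, hR, hψR⟩ := exists_forall_eq_zero_of_hasCompactSupport hψc
  rw [setIntegral_eq_of_subset_of_forall_sdiff_eq_zero (s := Ioc 0 R) measurableSet_Ioi
    (fun _ h => h.1) fun t ht => ?_, ← intervalIntegral.integral_of_le hR.le]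
  · have hui := F.flowMap_integrable x 0 R
    have hw : IntervalIntegrable (fun t => ((1 : ℝ), u t (F.flowMap t x))) volume 0 R := by
      rw [intervalIntegrable_iff] at hui ⊢
      exact Integrable.prodMk (intervalIntegrable_iff.1 intervalIntegrable_const) hui
    rw [show (∫ t in (0 : ℝ)..R, fderiv ℝ ψ (t, F.flow t x) (1, u t (F.flow t x))) =
        ψ (R, F.flowMap R x) - ψ (0, F.flowMap 0 x) from
      integral_fderiv_comp_primitive (c := fun t => (t, F.flowMap t x)) (hψ.of_le (by simp)) hw
        fun t ht => ?_]
    · rw [(hψR (R, F.flowMap R x) (Or.inl (le_abs_self R))).2, F.flowMap_of_nonpos le_rfl, zero_sub]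
    · have hw' : IntervalIntegrable (fun t => ((1 : ℝ), u t (F.flowMap t x))) volume 0 t :=
        hw.mono_set (uIcc_subset_uIcc left_mem_uIcc ht)
      have h1 := (ContinuousLinearMap.fst ℝ ℝ (Sp d)).intervalIntegral_comp_comm hw'
      have h2 := (ContinuousLinearMap.snd ℝ ℝ (Sp d)).intervalIntegral_comp_comm hw'
      simp only [ContinuousLinearMap.coe_fst', ContinuousLinearMap.coe_snd',
        intervalIntegral.integral_const, sub_zero, smul_eq_mul, mul_one] at h1 h2
      refine Prod.ext ?_ ?_
      · exact h1.trans (zero_add _).symm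
      · refine Eq.trans ?_ (congrArg (F.flowMap 0 x + ·) h2)
        simp only
        rw [← F.flowMap_sub]
        abel
  · have h : R < t := not_le.1 fun h => ht.2 ⟨ht.1, h⟩
    rw [(hψR (t, F.flow t x) (Or.inl (h.le.trans (le_abs_self t)))).1, zero_apply]

/-- The Lagrangian function is a weak solution of the transport equation. -/
theorem isWeakSolution_lagrangian (hdiv : ∀ t, 0 < t → IsDivFree (u t))
    (hθ₀ : LocallyIntegrable θ₀) : IsWeakSolution u θ₀ (lagrangian F.flow θ₀) := by
  have mp := F.measurePreserving_spaceTimeFlow hdiv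
  have mps : MeasurePreserving F.spaceTimeFlow.toMeasurableEquiv.symm
      ((volume.restrict (Ioi 0)).prod volume) ((volume.restrict (Ioi 0)).prod volume) :=
    MeasurePreserving.symm F.spaceTimeFlow.toMeasurableEquiv mp
  have hm : AEStronglyMeasurable (fun p : ℝ × Sp d => lagrangian F.flow θ₀ p.1 p.2)
      (volume.restrict (Ioi (0 : ℝ) ×ˢ (univ : Set (Sp d)))) := by
    rw [restrict_prod_eq, Measure.restrict_univ]
    exact (hθ₀.aestronglyMeasurable.comp_snd (μ := volume.restrict (Ioi (0 : ℝ)))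
      ).comp_measurePreserving mps
  have hb : ∀ T R : ℝ, ∃ K : ℝ, ∀ᵐ t ∂(volume.restrict (Ioo 0 T)),
      ∫⁻ x in Metric.ball (0 : Sp d) R, ‖lagrangian F.flow θ₀ t x‖ₑ ≤ ENNReal.ofReal K := by
    intro T R
    obtain ⟨R', hR'⟩ := F.exists_flow_symm_image_subset T R
    have hfin : ∫⁻ x in Metric.closedBall (0 : Sp d) R', ‖θ₀ x‖ₑ ≠ ⊤ :=
      (hθ₀.integrableOn_isCompact (isCompact_closedBall _ _)).2.ne
    refine ⟨(∫⁻ x in Metric.closedBall (0 : Sp d) R', ‖θ₀ x‖ₑ).toReal, ?_⟩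
    rw [ENNReal.ofReal_toReal hfin]
    filter_upwards [ae_restrict_mem measurableSet_Ioo] with t ht
    have hms : MeasurePreserving (F.flow t).toMeasurableEquiv.symm volume volume :=
      MeasurePreserving.symm (F.flow t).toMeasurableEquiv (F.measurePreserving_flow hdiv t)
    rw [← hms.setLIntegral_comp_preimage_emb (MeasurableEquiv.measurableEmbedding _)
      (fun x => ‖θ₀ x‖ₑ) (Metric.closedBall (0 : Sp d) R')]
    exact lintegral_mono_set fun y hy =>
      mem_closedBall_zero_iff.2 (hR' t ⟨ht.1.le, ht.2.le⟩ y (mem_ball_zero_iff.1 hy).le)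
  refine ⟨hm, hb, fun ψ hψ hψc => F.integrableOn_mul_fderiv hm hb hψ hψc, fun ψ hψ hψc => ?_⟩
  have hint := F.integrableOn_mul_fderiv hm hb hψ hψc
  rw [IntegrableOn, restrict_prod_eq, Measure.restrict_univ] at hint
  rw [restrict_prod_eq, Measure.restrict_univ]
  have hemb := F.spaceTimeFlow.measurableEmbedding
  have hint' := (mp.integrable_comp_emb hemb).2 hint
  -- In the coordinates `(t, φ_t x)` the Lagrangian function becomes `θ₀ x`, constant in time, so
  -- the time integral for fixed `x` is `-θ₀ x * ψ (0, x)`.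
  rw [← mp.integral_comp hemb]
  have hfun : ∀ p : ℝ × Sp d, lagrangian F.flow θ₀ (F.spaceTimeFlow p).1 (F.spaceTimeFlow p).2 =
      θ₀ p.2 := fun p => by
    simp [lagrangian, spaceTimeFlow, - flow_apply]
  simp only [hfun, Function.comp_def] at hint' ⊢
  rw [integral_prod_symm _ hint', ← integral_add]
  · refine (integral_congr_ae (ae_of_all _ fun x => ?_)).trans (integral_zero _ _)
    simp only
    rw [integral_const_mul]
    have := F.integral_fderiv_along_flow hψ hψc x
    rw [show (∫ t in Ioi (0 : ℝ), fderiv ℝ ψ (F.spaceTimeFlow (t, x))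
      (1, u (F.spaceTimeFlow (t, x)).1 (F.spaceTimeFlow (t, x)).2)) = -ψ (0, x) from this]
    simp
  · exact hint'.integral_prod_right
  · obtain ⟨R, hR, hψR⟩ := exists_forall_eq_zero_of_hasCompactSupport hψc
    have hsc : HasCompactSupport fun y : Sp d => ψ (0, y) := by
      refine HasCompactSupport.intro (isCompact_closedBall (0 : Sp d) R) fun y hy => ?_
      rw [mem_closedBall_zero_iff, not_le] at hy
      exact (hψR (0, y) (Or.inr hy.le)).2
    have := hθ₀.integrable_smul_right_of_hasCompactSupport
      (hψ.continuous.comp (continuous_const.prodMk continuous_id)) hsc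
    simpa [mul_comm] using this

end OsgoodField

/-- A locally integrable function vanishes if it integrates to zero against the translates of
an approximate identity by a dense set of points. -/
theorem ae_eq_zero_of_forall_integral_bump {h : Sp d → ℝ} (hh : LocallyIntegrable h)
    {b : ℕ → ContDiffBump (0 : Sp d)} (hb : Tendsto (fun n => (b n).rOut) atTop (𝓝 0)) {K : ℝ}
    (hK : ∀ n, (b n).rOut ≤ K * (b n).rIn)
    (h0 : ∀ n m, ∫ x, h x * (b n).normed volume (TopologicalSpace.denseSeq (Sp d) m - x) = 0) :
    h =ᵐ[volume] 0 := by
  filter_upwards [ContDiffBump.ae_convolution_tendsto_right_of_locallyIntegrable hb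
    (Eventually.of_forall hK) hh] with x hx
  refine tendsto_nhds_unique hx ?_
  have hz : ∀ n, convolution ((b n).normed volume) h (ContinuousLinearMap.lsmul ℝ ℝ) volume =
      fun _ => 0 := fun n => by
    -- The regularized function is continuous and vanishes at the dense centres, hence everywhere;
    -- it also converges to `h` almost everywhere.
    refine Continuous.ext_on (TopologicalSpace.denseRange_denseSeq (Sp d))
      ((b n).hasCompactSupport_normed.continuous_convolution_left _
        ((b n).contDiff_normed (n := 0)).continuous hh) continuous_const ?_
    rintro - ⟨m, rfl⟩
    rw [convolution_eq_swap]
    simp only [ContinuousLinearMap.lsmul_apply, smul_eq_mul]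
    rw [← h0 n m]
    exact integral_congr_ae (ae_of_all _ fun y => mul_comm _ _)
  simp only [hz]
  exact tendsto_const_nhds

/-- The transport equation has at most one weak solution. -/
theorem IsWeakSolution.ae_eq_lagrangian (F : OsgoodField u C Λ) {θ : ℝ → Sp d → ℝ}
    (hdiv : ∀ t, 0 < t → IsDivFree (u t)) (hθ : IsWeakSolution u θ₀ θ)
    (hθ₀ : LocallyIntegrable θ₀) :
    ∀ᵐ t ∂(volume.restrict (Ioi (0 : ℝ))), θ t =ᵐ[volume] lagrangian F.flow θ₀ t := by
  have hloc : ∀ᵐ t ∂(volume.restrict (Ioi (0 : ℝ))), LocallyIntegrable (θ t) := by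
    have hm := hθ.meas
    rw [restrict_prod_eq, Measure.restrict_univ] at hm
    have hb : ∀ n m : ℕ, ∀ᵐ t ∂(volume : Measure ℝ), t ∈ Ioo (0 : ℝ) n →
        ∫⁻ x in Metric.ball (0 : Sp d) m, ‖θ t x‖ₑ < ⊤ := fun n m => by
      obtain ⟨K, hK⟩ := hθ.bound n m
      rw [ae_restrict_iff' measurableSet_Ioo] at hK
      exact hK.mono fun t ht h => (ht h).trans_lt ENNReal.ofReal_lt_top
    filter_upwards [hm.prodMk_left, ae_restrict_mem measurableSet_Ioi,
      ae_restrict_of_ae (ae_all_iff.2 fun n => ae_all_iff.2 fun m => hb n m)] with t h1 h2 h3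
    obtain ⟨n, hn⟩ := exists_nat_gt t
    refine locallyIntegrable_iff.2 fun S hS => ?_
    obtain ⟨r, hr⟩ := hS.isBounded.subset_ball (0 : Sp d)
    obtain ⟨m, hm⟩ := exists_nat_gt r
    have : IntegrableOn (θ t) (Metric.ball (0 : Sp d) m) :=
      ⟨AEStronglyMeasurable.restrict h1, h3 n m ⟨h2, hn⟩⟩
    exact this.mono_set (hr.trans (Metric.ball_subset_ball hm.le))
  -- The null set of bad times depends on the test function, so a countable family is used:
  -- shrinking bumps centred at a dense sequence. The ratio `2` of the radii keeps the bumps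
  -- comparable to balls.
  let b : ℕ → ContDiffBump (0 : Sp d) := fun n =>
    ⟨1 / ((n : ℝ) + 1), 2 * (1 / ((n : ℝ) + 1)), by positivity, by
      have : (0 : ℝ) < 1 / ((n : ℝ) + 1) := by positivity
      linarith⟩
  have hb : Tendsto (fun n => (b n).rOut) atTop (𝓝 0) := by
    have := (tendsto_one_div_add_atTop_nhds_zero_nat (𝕜 := ℝ)).const_mul 2
    rwa [mul_zero] at this
  have hχ : ∀ n m, Continuous fun x =>
      (b n).normed volume (TopologicalSpace.denseSeq (Sp d) m - x) := fun n m =>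
    ((b n).contDiff_normed (n := 0)).continuous.comp (continuous_const.sub continuous_id)
  have hχc : ∀ n m, HasCompactSupport fun x =>
      (b n).normed volume (TopologicalSpace.denseSeq (Sp d) m - x) := fun n m =>
    (b n).hasCompactSupport_normed.comp_homeomorph
      (Homeomorph.subLeft (TopologicalSpace.denseSeq (Sp d) m))
  filter_upwards [hloc, ae_all_iff.2 fun n => ae_all_iff.2 fun m =>
    hθ.ae_integral_transport F hθ₀ (hχ n m) (hχc n m)] with t hl ht
  have mp := F.measurePreserving_flow hdiv t
  have hemb := (F.flow t).measurableEmbedding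
  have hl' : LocallyIntegrable fun x => θ t (F.flow t x) := by
    refine locallyIntegrable_iff.2 fun S hS => ?_
    exact (mp.integrableOn_image hemb).1 (hl.integrableOn_isCompact (hS.image (F.flow t).continuous))
  -- Volume preservation moves the test function back from `χ ∘ φ_t⁻¹` to `χ`, so `θ t ∘ φ_t` and
  -- `θ₀` have the same integrals against the whole family.
  have key : (fun x => θ t (F.flow t x) - θ₀ x) =ᵐ[volume] 0 := by
    refine ae_eq_zero_of_forall_integral_bump (hl'.sub hθ₀) hb (K := 2) (fun n => le_rfl)
      fun n m => ?_
    have i1 := hl'.integrable_smul_right_of_hasCompactSupport (hχ n m) (hχc n m)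
    have i2 := hθ₀.integrable_smul_right_of_hasCompactSupport (hχ n m) (hχc n m)
    simp only [smul_eq_mul] at i1 i2
    have e := ht n m
    rw [← mp.integral_comp hemb] at e
    simp only [Homeomorph.symm_apply_apply] at e
    simp only [sub_mul]
    rw [integral_sub (by simpa [mul_comm] using i1) (by simpa [mul_comm] using i2), e, sub_self]
  have hms : MeasurePreserving (F.flow t).toMeasurableEquiv.symm volume volume :=
    MeasurePreserving.symm (F.flow t).toMeasurableEquiv mp
  filter_upwards [hms.quasiMeasurePreserving.ae key] with y hy
  have : θ t (F.flow t ((F.flow t).symm y)) - θ₀ ((F.flow t).symm y) = 0 := hy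
  rw [Homeomorph.apply_symm_apply] at this
  exact sub_eq_zero.1 this

end Lagrangian


/-! ### Reduction to a continuous modulus -/

section OsgoodModulus

variable {L : ℝ → ℝ} (hL : IsOsgoodModulus L)

include hL

theorem IsOsgoodModulus.intervalIntegrable {a b : ℝ} (ha : 0 < a) (hab : a ≤ b) (hb : b < 1) :
    IntervalIntegrable (fun r => (L r)⁻¹) volume a b :=
  (hL.integrable a ⟨ha, hab.trans_lt hb⟩).mono_set (by
    rw [uIcc_of_le hab, uIcc_of_le (hab.trans hb.le)]
    exact Icc_subset_Icc_right hb.le)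

theorem IsOsgoodModulus.integral_eq {a b : ℝ} (ha : 0 < a) (hab : a ≤ b) (hb : b < 1) :
    ∫ r in a..b, (L r)⁻¹ = osgoodM L a - osgoodM L b := by
  have := intervalIntegral.integral_add_adjacent_intervals (hL.intervalIntegrable ha hab hb)
    (hL.integrable b ⟨ha.trans_le hab, hb⟩)
  rw [osgoodM, osgoodM, ← this, add_sub_cancel_right]

/-- Measurability is assumed only through integrability of `1 / L`; `L` is recovered as the
reciprocal of its reciprocal. -/
theorem IsOsgoodModulus.aestronglyMeasurable_inv_add {a b : ℝ} (ha : 0 < a) (hab : a ≤ b)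
    (hb : b < 1) (ε : ℝ) :
    AEStronglyMeasurable (fun r => (L r + ε)⁻¹) (volume.restrict (uIoc a b)) := by
  have h1 : AEMeasurable (fun r => ((L r)⁻¹)⁻¹) (volume.restrict (uIoc a b)) :=
    (intervalIntegrable_iff.1 (hL.intervalIntegrable ha hab hb)).1.aemeasurable.inv
  simp only [inv_inv] at h1
  exact (h1.add_const ε).inv.aestronglyMeasurable

theorem IsOsgoodModulus.norm_inv_add_le {r ε : ℝ} (hr : r ∈ Ioo (0 : ℝ) 1) (hε : 0 ≤ ε) :
    ‖(L r + ε)⁻¹‖ ≤ (L r)⁻¹ := by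
  have h := hL.pos r hr
  rw [Real.norm_eq_abs, abs_of_nonneg (by positivity)]
  exact inv_anti₀ h (by linarith)

theorem IsOsgoodModulus.tendsto_integral_inv_add {a b : ℝ} (ha : 0 < a) (hab : a ≤ b)
    (hb : b < 1) :
    Tendsto (fun ε => ∫ r in a..b, (L r + ε)⁻¹) (𝓝[>] 0) (𝓝 (osgoodM L a - osgoodM L b)) := by
  rw [← hL.integral_eq ha hab hb]
  have hmem : ∀ r ∈ uIoc a b, r ∈ Ioo (0 : ℝ) 1 := fun r hr => by
    rw [uIoc_of_le hab] at hr
    exact ⟨ha.trans hr.1, hr.2.trans_lt hb⟩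
  refine intervalIntegral.tendsto_integral_filter_of_dominated_convergence (fun r => (L r)⁻¹)
    (Eventually.of_forall fun ε => hL.aestronglyMeasurable_inv_add ha hab hb ε)
    (eventually_mem_nhdsWithin.mono fun ε hε => ae_of_all _ fun r hr =>
      hL.norm_inv_add_le (hmem r hr) (le_of_lt hε))
    (hL.intervalIntegrable ha hab hb) (ae_of_all _ fun r hr => ?_)
  have h := hL.pos r (hmem r hr)
  have : Tendsto (fun ε => (L r + ε)⁻¹) (𝓝 0) (𝓝 (L r + 0)⁻¹) :=
    (tendsto_const_nhds.add tendsto_id).inv₀ (by simpa using h.ne')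
  rw [add_zero] at this
  exact this.mono_left nhdsWithin_le_nhds

/-- A smaller modulus has a larger reciprocal. This is the link between `M`, built on `L`, and the
regularized primitives, built on `Λ`. -/
theorem IsOsgoodModulus.integral_inv_add_le {Λ : ℝ → ℝ} (hc : Continuous Λ) (h0 : ∀ r, 0 ≤ Λ r)
    (hΛ : ∀ r ∈ Ioo (0 : ℝ) 1, Λ r ≤ L r) {a b ε : ℝ} (ha : 0 < a) (hab : a ≤ b) (hb : b < 1)
    (hε : 0 < ε) :
    ∫ r in a..b, (L r + ε)⁻¹ ≤ regPrimitive Λ ε b - regPrimitive Λ ε a := by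
  rw [regPrimitive_sub hc h0 hε]
  have hmem : ∀ r ∈ Icc a b, r ∈ Ioo (0 : ℝ) 1 := fun r hr =>
    ⟨ha.trans_le hr.1, hr.2.trans_lt hb⟩
  refine intervalIntegral.integral_mono_on hab ?_
    ((continuous_inv_add hc h0 hε).intervalIntegrable _ _) fun r hr => ?_
  · refine (hL.intervalIntegrable ha hab hb).mono_fun
      (hL.aestronglyMeasurable_inv_add ha hab hb ε) ?_
    rw [EventuallyLE, ae_restrict_iff' measurableSet_uIoc]
    refine ae_of_all _ fun r hr => ?_
    rw [uIoc_of_le hab] at hr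
    exact (hL.norm_inv_add_le (hmem r ⟨hr.1.le, hr.2⟩) hε.le).trans (le_abs_self _)
  · exact inv_anti₀ (add_pos_of_nonneg_of_pos (h0 r) hε) (by linarith [hΛ r (hmem r hr)])

/-- An Osgood modulus takes small values on a set of positive measure. -/
theorem IsOsgoodModulus.exists_measurableSet_lt {ε : ℝ} (hε : 0 < ε) :
    ∃ S ⊆ Ioo (0 : ℝ) 1, MeasurableSet S ∧ 0 < volume S ∧ ∀ r ∈ S, L r < ε := by
  obtain ⟨z, hzM, hz⟩ := ((hL.tendsto.eventually_gt_atTop ε⁻¹).and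
    (Ioo_mem_nhdsGT (show (0 : ℝ) < 1 from one_pos))).exists
  have hint : IntegrableOn (fun r => (L r)⁻¹) (Ioo z 1) :=
    (intervalIntegrable_iff_integrableOn_Ioo_of_le hz.2.le).1 (hL.integrable z hz)
  have hN : NullMeasurableSet ({r | ε⁻¹ < (L r)⁻¹} ∩ Ioo z 1) :=
    (nullMeasurableSet_restrict measurableSet_Ioo.nullMeasurableSet).1
      (nullMeasurableSet_lt aemeasurable_const hint.1.aemeasurable)
  -- Otherwise `1 / L ≤ 1 / ε` almost everywhere on `(z, 1)`, whence `M(z) ≤ (1 - z) / ε`, against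
  -- the choice of `z` with `M(z) > 1 / ε`.
  have hpos : volume ({r | ε⁻¹ < (L r)⁻¹} ∩ Ioo z 1) ≠ 0 := fun h0 => by
    have hae : ∀ᵐ r ∂(volume.restrict (Ioo z 1)), (L r)⁻¹ ≤ ε⁻¹ := by
      rw [ae_restrict_iff' measurableSet_Ioo]
      refine measure_mono_null (fun r hr => ?_) h0
      simp only [mem_compl_iff, mem_ofPred_eq, Classical.not_imp, not_le] at hr
      exact ⟨hr.2, hr.1⟩
    have h1 : osgoodM L z ≤ ∫ _ in Ioo z 1, ε⁻¹ := by
      rw [osgoodM, intervalIntegral.integral_of_le hz.2.le, integral_Ioc_eq_integral_Ioo]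
      exact integral_mono_ae hint (integrable_const _) hae
    rw [setIntegral_const, Real.volume_real_Ioo_of_le hz.2.le, smul_eq_mul] at h1
    have h2 : 0 < ε⁻¹ := inv_pos.2 hε
    nlinarith [hz.1]
  obtain ⟨S, hS, hSm, hSe⟩ := hN.exists_measurable_subset_ae_eq
  refine ⟨S, fun r hr => ⟨hz.1.trans (hS hr).2.1, (hS hr).2.2⟩, hSm, ?_, fun r hr => ?_⟩
  · rw [measure_congr hSe]
    exact pos_iff_ne_zero.2 hpos
  · exact (inv_lt_inv₀ hε (hL.pos r ⟨hz.1.trans (hS hr).2.1, (hS hr).2.2⟩)).1 (hS hr).1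

end OsgoodModulus

/-- The optimal spatial modulus of continuity of a velocity field, relative to the bound `C`. -/
noncomputable def spatialModulus {d : ℕ} (u : ℝ → Sp d → Sp d) (C : ℝ → ℝ) (r : ℝ) : ℝ :=
  ⨆ p : ℝ × Sp d × Sp d,
    if ‖p.2.1 - p.2.2‖ = |r| then ‖u p.1 p.2.1 - u p.1 p.2.2‖ / C p.1 else 0

section SpatialModulus

variable {d : ℕ} {u : ℝ → Sp d → Sp d} {C : ℝ → ℝ}

theorem spatialModulus_nonneg (hC : ∀ t, 0 ≤ C t) (r : ℝ) : 0 ≤ spatialModulus u C r :=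
  Real.iSup_nonneg fun p => by
    split_ifs
    · exact div_nonneg (norm_nonneg _) (hC _)
    · exact le_rfl

theorem spatialModulus_neg (r : ℝ) : spatialModulus u C (-r) = spatialModulus u C r := by
  simp only [spatialModulus, abs_neg]

theorem spatialModulus_le (hC : ∀ t, 0 ≤ C t) {r b : ℝ} (hb : 0 ≤ b)
    (h : ∀ t x y, ‖x - y‖ = |r| → ‖u t x - u t y‖ ≤ C t * b) : spatialModulus u C r ≤ b := by
  refine ciSup_le fun p => ?_
  split_ifs with hp
  · exact div_le_of_le_mul₀ (hC _) hb (by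
      rw [mul_comm]
      exact h _ _ _ hp)
  · exact hb

theorem spatialModulus_zero (hC : ∀ t, 0 ≤ C t) : spatialModulus u C 0 = 0 := by
  refine le_antisymm (spatialModulus_le hC le_rfl fun t x y h => ?_) (spatialModulus_nonneg hC 0)
  rw [abs_zero, norm_sub_eq_zero_iff] at h
  simp [h]

theorem spatialModulus_le_modulus (hC : ∀ t, 0 ≤ C t) {L : ℝ → ℝ}
    (hL : ∀ t x y, 0 < ‖x - y‖ → ‖x - y‖ < 1 → ‖u t x - u t y‖ ≤ C t * L ‖x - y‖)
    {r : ℝ} (hr : r ∈ Ioo (0 : ℝ) 1) (hLr : 0 ≤ L r) : spatialModulus u C r ≤ L r := by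
  refine spatialModulus_le hC hLr fun t x y hxy => ?_
  rw [abs_of_pos hr.1] at hxy
  have := hL t x y (hxy ▸ hr.1) (hxy ▸ hr.2)
  rwa [hxy] at this

variable {B : ℝ → ℝ} (hC : ∀ t, 0 ≤ C t)
  (hB : ∀ t x y, x ≠ y → ‖u t x - u t y‖ ≤ C t * B ‖x - y‖)

include hC hB

theorem norm_sub_le_spatialModulus (t : ℝ) (x y : Sp d) :
    ‖u t x - u t y‖ ≤ C t * spatialModulus u C ‖x - y‖ := by
  have hb : BddAbove (range fun p : ℝ × Sp d × Sp d =>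
      if ‖p.2.1 - p.2.2‖ = |‖x - y‖| then ‖u p.1 p.2.1 - u p.1 p.2.2‖ / C p.1 else 0) := by
    refine ⟨max (B ‖x - y‖) 0, ?_⟩
    rintro - ⟨p, rfl⟩
    simp only
    split_ifs with hp
    · rw [abs_norm] at hp
      rcases eq_or_ne p.2.1 p.2.2 with he | he
      · simp [he]
      · refine div_le_of_le_mul₀ (hC _) (le_max_right _ _) ?_
        rw [mul_comm]
        refine (hB p.1 _ _ he).trans (mul_le_mul_of_nonneg_left ?_ (hC _))
        rw [hp]
        exact le_max_left _ _
    · exact le_max_right _ _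
  have h1 := le_ciSup hb (t, x, y)
  simp only [abs_norm, if_true] at h1
  -- Where `C t = 0` the quotient in the supremum is `0` by convention, but then `hB` forces the
  -- increment itself to vanish.
  rcases (hC t).eq_or_lt with h0 | h0
  · rcases eq_or_ne x y with he | he
    · simp [he, ← h0]
    · have := hB t x y he
      rw [← h0, zero_mul] at this ⊢
      exact this
  · rw [div_le_iff₀ h0] at h1
    simp only [spatialModulus, abs_norm]
    linarith [mul_comm (C t) (⨆ p : ℝ × Sp d × Sp d,
      if ‖p.2.1 - p.2.2‖ = ‖x - y‖ then ‖u p.1 p.2.1 - u p.1 p.2.2‖ / C p.1 else 0)]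

/-- On the line through `x` and `y` there is a point at distance `|p|` from `x` and `|q|` from `y`,
outside the segment when `p` and `q` have the same sign and are nonzero. The even extension of the
modulus lets one computation cover sums and differences. -/
theorem spatialModulus_sub_le (p q : ℝ) :
    spatialModulus u C (p - q) ≤ spatialModulus u C p + spatialModulus u C q := by
  refine spatialModulus_le hC (add_nonneg (spatialModulus_nonneg hC p)
    (spatialModulus_nonneg hC q)) fun t x y hxy => ?_
  rcases eq_or_ne (p - q) 0 with h0 | h0
  · rw [h0, abs_zero, norm_sub_eq_zero_iff] at hxy
    rw [hxy, sub_self, norm_zero]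
    exact mul_nonneg (hC t) (add_nonneg (spatialModulus_nonneg hC p) (spatialModulus_nonneg hC q))
  set z := x + (p / (p - q)) • (y - x) with hz
  have e1 : ‖x - z‖ = |p| := by
    rw [hz, sub_add_cancel_left, norm_neg, norm_smul, norm_sub_rev y x, hxy, Real.norm_eq_abs,
      ← abs_mul, div_mul_cancel₀ _ h0]
  have e2 : ‖z - y‖ = |q| := by
    have : z - y = (q / (p - q)) • (y - x) := by
      have h2 : q / (p - q) = p / (p - q) - 1 := by
        field_simp
        ring
      rw [hz, h2, sub_smul, one_smul]
      abel
    rw [this, norm_smul, norm_sub_rev y x, hxy, Real.norm_eq_abs, ← abs_mul, div_mul_cancel₀ _ h0]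
  have h1 := norm_sub_le_spatialModulus hC hB t x z
  have h2 := norm_sub_le_spatialModulus hC hB t z y
  have h3 : ∀ r, spatialModulus u C |r| = spatialModulus u C r := fun r => by
    simp only [spatialModulus, abs_abs]
  rw [e1, h3] at h1
  rw [e2, h3] at h2
  calc ‖u t x - u t y‖ = ‖(u t x - u t z) + (u t z - u t y)‖ := by rw [sub_add_sub_cancel]
    _ ≤ _ := norm_add_le _ _
    _ ≤ _ := by linarith

theorem spatialModulus_add_le (p q : ℝ) :
    spatialModulus u C (p + q) ≤ spatialModulus u C p + spatialModulus u C q := by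
  have := spatialModulus_sub_le hC hB p (-q)
  rwa [sub_neg_eq_add, spatialModulus_neg] at this

theorem spatialModulus_nat_mul_le (n : ℕ) (r : ℝ) :
    spatialModulus u C (n * r) ≤ n * spatialModulus u C r := by
  induction n with
  | zero => simp [spatialModulus_zero hC]
  | succ n ih =>
    push_cast
    rw [add_mul, one_mul, add_mul, one_mul]
    linarith [spatialModulus_add_le hC hB (n * r) r]

/-- Steinhaus' theorem: `L`, hence the modulus, is small on a set `S` of positive measure, and `S -
S` is a neighbourhood of `0`. The bound for differences gives continuity at `0`, and subadditivity
carries it to every point. No regularity of `L` is needed. -/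
theorem continuous_spatialModulus {L : ℝ → ℝ} (hLO : IsOsgoodModulus L)
    (hL : ∀ t x y, 0 < ‖x - y‖ → ‖x - y‖ < 1 → ‖u t x - u t y‖ ≤ C t * L ‖x - y‖) :
    Continuous (spatialModulus u C) := by
  have hz : ∀ ε > 0, ∀ᶠ h in 𝓝 (0 : ℝ), spatialModulus u C h < ε := fun ε hε => by
    obtain ⟨S, hS, hSm, hS0, hSL⟩ := hLO.exists_measurableSet_lt (half_pos hε)
    have hfin : volume S ≠ ⊤ := ((measure_mono hS).trans_lt (by simp)).ne
    filter_upwards [Measure.sub_mem_nhds_zero_of_addHaar_pos_ne_top volume S hSm hS0 hfin] with h hh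
    obtain ⟨p, hp, q, hq, rfl⟩ := Set.mem_sub.1 hh
    have h1 := spatialModulus_le_modulus hC hL (hS hp) (hLO.pos p (hS hp)).le
    have h2 := spatialModulus_le_modulus hC hL (hS hq) (hLO.pos q (hS hq)).le
    linarith [spatialModulus_sub_le hC hB p q, hSL p hp, hSL q hq]
  refine continuous_iff_continuousAt.2 fun r => Metric.tendsto_nhds.2 fun ε hε => ?_
  have ht : Tendsto (fun s => s - r) (𝓝 r) (𝓝 0) := by
    have : Tendsto (fun s => s - r) (𝓝 r) (𝓝 (r - r)) := (continuous_id.sub continuous_const).tendsto r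
    rwa [sub_self] at this
  filter_upwards [ht.eventually (hz ε hε)] with s hs
  rw [Real.dist_eq, abs_lt]
  have h1 := spatialModulus_add_le hC hB r (s - r)
  have h2 := spatialModulus_sub_le hC hB s (s - r)
  rw [add_sub_cancel] at h1
  rw [sub_sub_cancel] at h2
  constructor <;> linarith

end SpatialModulus

/-- A bound for increments of length `s` gives a bound for increments of length `n s`. -/
theorem norm_sub_le_nat_mul {d : ℕ} {f : Sp d → Sp d} {s b : ℝ} (hs : 0 < s)
    (h : ∀ x y, ‖x - y‖ = s → ‖f x - f y‖ ≤ b) (n : ℕ) :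
    ∀ x y, ‖x - y‖ = n * s → ‖f x - f y‖ ≤ n * b := by
  induction n with
  | zero =>
    intro x y hxy
    rw [Nat.cast_zero, zero_mul, norm_sub_eq_zero_iff] at hxy
    simp [hxy]
  | succ n ih =>
    intro x y hxy
    push_cast at hxy ⊢
    have hn : (0 : ℝ) < n + 1 := by positivity
    set z := x + ((1 : ℝ) / (n + 1)) • (y - x) with hz
    have e1 : ‖x - z‖ = s := by
      rw [hz, sub_add_cancel_left, norm_neg, norm_smul, norm_sub_rev y x, hxy, Real.norm_eq_abs,
        abs_of_pos (by positivity)]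
      field_simp
    have e2 : ‖z - y‖ = n * s := by
      have : z - y = (-(n : ℝ) / (n + 1)) • (y - x) := by
        have h2 : -(n : ℝ) / (n + 1) = 1 / (n + 1) - 1 := by
          field_simp
          ring
        rw [hz, h2, sub_smul, one_smul]
        abel
      rw [this, norm_smul, norm_sub_rev y x, hxy, Real.norm_eq_abs, abs_div, abs_neg,
        abs_of_nonneg (Nat.cast_nonneg n), abs_of_pos hn]
      field_simp
    calc ‖f x - f y‖ = ‖(f x - f z) + (f z - f y)‖ := by rw [sub_add_sub_cancel]
      _ ≤ _ := norm_add_le _ _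
      _ ≤ _ := by linarith [h x z e1, ih z y e2]

theorem intervalIntegrable_indicator_Ioi {E : Type*} [NormedAddCommGroup E] {g : ℝ → E}
    (hg : LocallyIntegrableOn g (Ici 0)) (a b : ℝ) :
    IntervalIntegrable ((Ioi (0 : ℝ)).indicator g) volume a b := by
  rw [intervalIntegrable_iff, integrableOn_indicator_iff measurableSet_Ioi]
  refine (hg.integrableOn_compact_subset (t := Icc 0 (max a b)) Icc_subset_Ici_self
    isCompact_Icc).mono_set fun t ht => ⟨le_of_lt ht.1, ht.2.2⟩

/-- A velocity field with an Osgood modulus of continuity, extended by zero to nonpositive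
times. -/
theorem osgoodField_indicator {d : ℕ} {L C : ℝ → ℝ} {u : ℝ → Sp d → Sp d}
    (hL : IsOsgoodModulus L) (hC : LocallyIntegrableOn C (Ici 0))
    (hu_meas : Measurable fun p : ℝ × Sp d => u p.1 p.2)
    (hu_int : ∀ x, LocallyIntegrableOn (fun t => u t x) (Ici 0)) (hu_mod : HasModulus L C u) :
    ∃ Λ : ℝ → ℝ, OsgoodField ((Ioi (0 : ℝ)).indicator u)
      ((Ioi (0 : ℝ)).indicator fun t => |C t|) Λ ∧ ∀ r ∈ Ioo (0 : ℝ) 1, Λ r ≤ L r := by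
  set v := (Ioi (0 : ℝ)).indicator u with hv
  set D := (Ioi (0 : ℝ)).indicator fun t => |C t| with hD
  have hD0 : ∀ t, 0 ≤ D t := fun t => indicator_nonneg (fun s _ => abs_nonneg _) t
  have hvL : ∀ t x y, 0 < ‖x - y‖ → ‖x - y‖ < 1 → ‖v t x - v t y‖ ≤ D t * L ‖x - y‖ := by
    intro t x y h0 h1
    by_cases ht : t ∈ Ioi (0 : ℝ)
    · rw [hv, hD, indicator_of_mem ht, indicator_of_mem ht]
      exact (hu_mod t ht x y h0 h1).trans
        (mul_le_mul_of_nonneg_right (le_abs_self _) (hL.pos _ ⟨h0, h1⟩).le)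
    · rw [hv, hD, indicator_of_notMem ht, indicator_of_notMem ht]
      simp
  obtain ⟨B, hvB⟩ : ∃ B : ℝ → ℝ, ∀ t x y, x ≠ y → ‖v t x - v t y‖ ≤ D t * B ‖x - y‖ := by
    -- A segment of length `r` is cut into `⌊r⌋ + 1` equal pieces, each shorter than `1`. This bound
    -- makes the supremum defining the modulus finite at every distance.
    refine ⟨fun r => ((⌊r⌋₊ + 1 : ℕ) : ℝ) * L (r / ((⌊r⌋₊ + 1 : ℕ) : ℝ)), fun t x y hxy => ?_⟩
    have h0 : 0 < ‖x - y‖ := norm_sub_pos_iff.2 hxy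
    have hn : (0 : ℝ) < ((⌊‖x - y‖⌋₊ + 1 : ℕ) : ℝ) := by positivity
    have hs : 0 < ‖x - y‖ / ((⌊‖x - y‖⌋₊ + 1 : ℕ) : ℝ) := by positivity
    have hs1 : ‖x - y‖ / ((⌊‖x - y‖⌋₊ + 1 : ℕ) : ℝ) < 1 := by
      rw [div_lt_one hn]
      exact_mod_cast Nat.lt_floor_add_one ‖x - y‖
    have := norm_sub_le_nat_mul hs (f := v t)
      (b := D t * L (‖x - y‖ / ((⌊‖x - y‖⌋₊ + 1 : ℕ) : ℝ)))
      (fun x' y' h => by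
        rw [← h] at hs hs1 ⊢
        exact hvL t x' y' hs hs1)
      (⌊‖x - y‖⌋₊ + 1) x y (mul_div_cancel₀ _ hn.ne').symm
    linarith
  have hcont := continuous_spatialModulus hD0 hvB hL hvL
  have hle : ∀ r ∈ Ioo (0 : ℝ) 1, spatialModulus v D r ≤ L r := fun r hr =>
    spatialModulus_le_modulus hD0 hvL hr (hL.pos r hr).le
  have hnn := spatialModulus_nonneg (u := v) hD0
  refine ⟨spatialModulus v D, ⟨hcont, hnn, spatialModulus_zero hD0, ?_, ?_, hD0, ?_, ?_, ?_,
    norm_sub_le_spatialModulus hD0 hvB, ?_⟩, hle⟩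
  · obtain ⟨K, hK⟩ := (isCompact_Icc (a := (-1 : ℝ)) (b := 1)).exists_bound_of_continuousOn
      hcont.continuousOn
    refine ⟨K, fun r => ?_⟩
    have hn : (0 : ℝ) < ((⌊|r|⌋₊ + 1 : ℕ) : ℝ) := by positivity
    -- Subadditivity with `⌊|r|⌋ + 1` steps reduces linear growth to the maximum of the continuous
    -- modulus on `[-1, 1]`.
    have h1 := spatialModulus_nat_mul_le hD0 hvB (⌊|r|⌋₊ + 1) (r / ((⌊|r|⌋₊ + 1 : ℕ) : ℝ))
    rw [mul_div_cancel₀ _ hn.ne'] at h1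
    have h2 : |r / ((⌊|r|⌋₊ + 1 : ℕ) : ℝ)| ≤ 1 := by
      rw [abs_div, abs_of_pos hn, div_le_one hn]
      exact_mod_cast (Nat.lt_floor_add_one |r|).le
    have h3 := (le_abs_self _).trans (hK _ (abs_le.1 h2))
    have hK0 : 0 ≤ K := (norm_nonneg _).trans (hK 0 (by simp))
    have h4 : ((⌊|r|⌋₊ + 1 : ℕ) : ℝ) ≤ 1 + |r| := by
      push_cast
      linarith [Nat.floor_le (abs_nonneg r)]
    calc _ ≤ _ := h1
      _ ≤ ((⌊|r|⌋₊ + 1 : ℕ) : ℝ) * K := mul_le_mul_of_nonneg_left h3 hn.le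
      _ ≤ (1 + |r|) * K := mul_le_mul_of_nonneg_right h4 hK0
      _ = K * (1 + |r|) := mul_comm _ _
  · intro r hr N
    -- Comparison with `L` is available only inside `(0, 1)`. There `A_ε(r')` is at least `∫ 1/(L +
    -- ε)` over `(z, r')`, which tends to `M(z) - M(r')` and exceeds any bound for small `z`.
    set r' := min r (1 / 2) with hr'
    have hr'0 : 0 < r' := lt_min hr (by norm_num)
    have hr'1 : r' < 1 := (min_le_right _ _).trans_lt (by norm_num)
    obtain ⟨z, hzM, hz⟩ := ((hL.tendsto.eventually_gt_atTop (N + osgoodM L r')).and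
      (Ioo_mem_nhdsGT hr'0)).exists
    obtain ⟨ε, h1, hε⟩ := (((hL.tendsto_integral_inv_add hz.1 hz.2.le hr'1).eventually
      (lt_mem_nhds (show N < osgoodM L z - osgoodM L r' by linarith))).and
      eventually_mem_nhdsWithin).exists
    have hε0 : 0 < ε := hε
    refine ⟨ε, hε0, ?_⟩
    have h2 := hL.integral_inv_add_le hcont hnn hle hz.1 hz.2.le hr'1 hε0
    have h3 := regPrimitive_nonneg hcont hnn hε0 hz.1.le
    have h4 := regPrimitive_mono hcont hnn hε0 (min_le_left r (1 / 2))
    linarith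
  · exact intervalIntegrable_indicator_Ioi (g := fun t => |C t|) (fun t ht => (hC t ht).norm)
  · have : (fun p : ℝ × Sp d => v p.1 p.2) =
        (Ioi (0 : ℝ) ×ˢ (univ : Set (Sp d))).indicator fun p => u p.1 p.2 := by
      funext p
      by_cases ht : p.1 ∈ Ioi (0 : ℝ)
      · rw [hv, indicator_of_mem ht, indicator_of_mem (show p ∈ Ioi (0 : ℝ) ×ˢ univ from ⟨ht, mem_univ _⟩)]
      · rw [hv, indicator_of_notMem ht, indicator_of_notMem (show p ∉ Ioi (0 : ℝ) ×ˢ univ from fun h => ht h.1)]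
        rfl
    rw [this]
    exact hu_meas.indicator (measurableSet_Ioi.prod MeasurableSet.univ)
  · intro a b
    have : (fun t => v t 0) = (Ioi (0 : ℝ)).indicator fun t => u t 0 := by
      funext t
      by_cases ht : t ∈ Ioi (0 : ℝ)
      · rw [hv, indicator_of_mem ht, indicator_of_mem ht]
      · rw [hv, indicator_of_notMem ht, indicator_of_notMem ht]
        rfl
    rw [this]
    exact intervalIntegrable_indicator_Ioi (hu_int 0) a b
  · intro t ht x
    rw [hv, indicator_of_notMem (show t ∉ Ioi (0 : ℝ) from not_lt.2 ht)]
    rfl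


/-! ### Invariance of the seminorms -/

section Seminorm

variable {d : ℕ} {L : ℝ → ℝ}

/-- Increments of `M` are limits of integrals of `1/(L + ε)`, which are dominated by increments of
the regularized primitives; a bound uniform in `ε` passes to the limit. -/
theorem IsOsgoodModulus.abs_osgoodM_sub_le (hL : IsOsgoodModulus L) {Λ : ℝ → ℝ}
    (hc : Continuous Λ) (h0 : ∀ r, 0 ≤ Λ r) (hΛ : ∀ r ∈ Ioo (0 : ℝ) 1, Λ r ≤ L r) {a b K : ℝ}
    (ha : a ∈ Ioo (0 : ℝ) 1) (hb : b ∈ Ioo (0 : ℝ) 1)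
    (h : ∀ ε, 0 < ε → |regPrimitive Λ ε a - regPrimitive Λ ε b| ≤ K) :
    |osgoodM L a - osgoodM L b| ≤ K := by
  wlog hab : a ≤ b generalizing a b
  · rw [abs_sub_comm]
    exact this hb ha (fun ε hε => by
      rw [abs_sub_comm]
      exact h ε hε) (le_of_not_ge hab)
  rw [abs_of_nonneg]
  · refine le_of_tendsto (hL.tendsto_integral_inv_add ha.1 hab hb.2)
      (eventually_mem_nhdsWithin.mono fun ε hε => ?_)
    refine (hL.integral_inv_add_le hc h0 hΛ ha.1 hab hb.2 hε).trans ?_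
    exact (le_abs_self _).trans (by
      rw [abs_sub_comm]
      exact h ε hε)
  · rw [← hL.integral_eq ha.1 hab hb.2]
    exact intervalIntegral.integral_nonneg hab fun r hr =>
      inv_nonneg.2 (hL.pos r ⟨ha.1.trans_le hr.1, hr.2.trans_lt hb.2⟩).le

section Comp

variable {Φ : Sp d → Sp d} {K : ℝ} (hL : IsOsgoodModulus L) (hinj : Function.Injective Φ)
  (hcont : ∀ r > 0, ∃ δ > 0, ∀ x y, ‖x - y‖ < δ → ‖Φ x - Φ y‖ < r)
  (hM : ∀ x y, ‖x - y‖ ∈ Ioo (0 : ℝ) 1 → ‖Φ x - Φ y‖ ∈ Ioo (0 : ℝ) 1 →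
    |osgoodM L ‖Φ x - Φ y‖ - osgoodM L ‖x - y‖| ≤ K)

include hL hinj hcont hM

/-- `M` changes by at most `K` under `Φ` while it is huge at small distances, so the ratio of its
values is close to `1`, and so is its power `γ` of either sign. The scale `δ` does not depend on `f`
or on the points. -/
theorem exists_quot_comp_le (γ : ℝ) {η r : ℝ} (hη : 1 < η) (hr : 0 < r) :
    ∃ δ > 0, ∀ (f : Sp d → ℝ) x y, 0 < ‖x - y‖ → ‖x - y‖ < δ →
      0 < ‖Φ x - Φ y‖ ∧ ‖Φ x - Φ y‖ < r ∧
        quot L γ (f ∘ Φ) x y ≤ ENNReal.ofReal η * quot L γ f (Φ x) (Φ y) := by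
  have hpow : ∀ᶠ q in 𝓝 (1 : ℝ), q ^ γ < η :=
    (Real.continuousAt_rpow_const 1 γ (Or.inl one_ne_zero)).eventually_lt_const
      (by simpa using hη)
  obtain ⟨τ, hτ, hpow⟩ := Metric.eventually_nhds_iff.1 hpow
  -- Above `K / τ` the ratio differs from `1` by less than `τ`; the maximum with `0` ensures
  -- positivity, needed for real powers.
  obtain ⟨ρ, hρ, hρM⟩ := mem_nhdsGT_iff_exists_Ioo_subset.1
    (hL.tendsto.eventually_gt_atTop (max (K / τ) 0))
  have hρ0 : 0 < ρ := hρ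
  obtain ⟨δ, hδ, hδΦ⟩ := hcont (min r (min ρ 1)) (by positivity)
  refine ⟨min δ (min ρ 1), by positivity, fun f x y h0 h1 => ?_⟩
  have hb0 : 0 < ‖Φ x - Φ y‖ := norm_sub_pos_iff.2 fun h => norm_sub_pos_iff.1 h0 (hinj h)
  have hb := hδΦ x y (h1.trans_le (min_le_left _ _))
  rw [lt_min_iff, lt_min_iff] at hb
  rw [lt_min_iff, lt_min_iff] at h1
  refine ⟨hb0, hb.1, ?_⟩
  have hMa : max (K / τ) 0 < osgoodM L ‖x - y‖ := hρM ⟨h0, h1.2.1⟩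
  have hMb : max (K / τ) 0 < osgoodM L ‖Φ x - Φ y‖ := hρM ⟨hb0, hb.2.1⟩
  have hd := hM x y ⟨h0, h1.2.2⟩ ⟨hb0, hb.2.2⟩
  rw [max_lt_iff] at hMa hMb
  rw [quot, quot, ← ENNReal.ofReal_mul (by linarith)]
  refine ENNReal.ofReal_le_ofReal ?_
  set A := osgoodM L ‖x - y‖
  set B := osgoodM L ‖Φ x - Φ y‖
  have hq : (B / A) ^ γ < η := hpow (by
    rw [Real.dist_eq, div_sub_one hMa.2.ne', abs_div, abs_of_pos hMa.2, div_lt_iff₀ hMa.2]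
    have := (div_lt_iff₀ hτ).1 hMa.1
    linarith)
  rw [Real.div_rpow hMb.2.le hMa.2.le] at hq
  have hAp := Real.rpow_pos_of_pos hMa.2 γ
  have hBp := Real.rpow_pos_of_pos hMb.2 γ
  rw [div_lt_iff₀ hAp] at hq
  rw [← mul_div_assoc, div_le_div_iff₀ hAp hBp]
  simp only [Function.comp_apply]
  nlinarith [abs_nonneg (f (Φ x) - f (Φ y))]

/-- The quotient loses only a factor `η > 1` at small scales, and `η → 1`. -/
theorem seminorm_comp_le (γ : ℝ) (f : Sp d → ℝ) : seminorm L γ (f ∘ Φ) ≤ seminorm L γ f := by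
  have h1 : ∀ η > 1, seminorm L γ (f ∘ Φ) ≤ ENNReal.ofReal η * seminorm L γ f := fun η hη => by
    refine ge_of_tendsto (ENNReal.Tendsto.const_mul (tendsto_supQuot L γ f)
      (Or.inr ENNReal.ofReal_ne_top)) (eventually_mem_nhdsWithin.mono fun r hr => ?_)
    obtain ⟨δ, hδ, h⟩ := exists_quot_comp_le hL hinj hcont hM γ hη hr
    refine (iInf₂_le δ hδ).trans ?_
    refine iSup_le fun x => iSup_le fun y => iSup_le fun hxy => ?_
    obtain ⟨h2, h3, h4⟩ := h f x y hxy.1 hxy.2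
    refine h4.trans (mul_le_mul_right ?_ _)
    exact le_iSup_of_le (Φ x) (le_iSup_of_le (Φ y) (le_iSup_of_le ⟨h2, h3⟩ le_rfl))
  have h2 : Tendsto (fun η => ENNReal.ofReal η * seminorm L γ f) (𝓝[>] 1)
      (𝓝 (ENNReal.ofReal 1 * seminorm L γ f)) :=
    ENNReal.Tendsto.mul_const ((ENNReal.continuous_ofReal.tendsto 1).mono_left nhdsWithin_le_nhds)
      (Or.inl (by simp))
  rw [ENNReal.ofReal_one, one_mul] at h2
  exact ge_of_tendsto h2 (eventually_mem_nhdsWithin.mono fun η hη => h1 η hη)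

theorem seminormAt_comp_le (γ : ℝ) (f : Sp d → ℝ) (x : Sp d) :
    seminormAt L γ (f ∘ Φ) x ≤ seminormAt L γ f (Φ x) := by
  have h1 : ∀ η > 1, seminormAt L γ (f ∘ Φ) x ≤
      ENNReal.ofReal η * seminormAt L γ f (Φ x) := fun η hη => by
    refine ge_of_tendsto (ENNReal.Tendsto.const_mul (tendsto_supQuotAt L γ f (Φ x))
      (Or.inr ENNReal.ofReal_ne_top)) (eventually_mem_nhdsWithin.mono fun r hr => ?_)
    obtain ⟨δ, hδ, h⟩ := exists_quot_comp_le hL hinj hcont hM γ hη hr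
    refine (iInf₂_le δ hδ).trans ?_
    refine iSup_le fun y => iSup_le fun hxy => ?_
    obtain ⟨h2, h3, h4⟩ := h f x y hxy.1 hxy.2
    refine h4.trans (mul_le_mul_right ?_ _)
    exact le_iSup_of_le (Φ y) (le_iSup_of_le ⟨h2, h3⟩ le_rfl)
  have h2 : Tendsto (fun η => ENNReal.ofReal η * seminormAt L γ f (Φ x)) (𝓝[>] 1)
      (𝓝 (ENNReal.ofReal 1 * seminormAt L γ f (Φ x))) :=
    ENNReal.Tendsto.mul_const ((ENNReal.continuous_ofReal.tendsto 1).mono_left nhdsWithin_le_nhds)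
      (Or.inl (by simp))
  rw [ENNReal.ofReal_one, one_mul] at h2
  exact ge_of_tendsto h2 (eventually_mem_nhdsWithin.mono fun η hη => h1 η hη)

end Comp

variable {u : ℝ → Sp d → Sp d} {C Λ : ℝ → ℝ} (F : OsgoodField u C Λ) (hL : IsOsgoodModulus L)
  (hΛ : ∀ r ∈ Ioo (0 : ℝ) 1, Λ r ≤ L r)

include hL hΛ

theorem OsgoodField.abs_osgoodM_flow_sub_le {t : ℝ} (ht : 0 ≤ t) (x y : Sp d)
    (h : ‖x - y‖ ∈ Ioo (0 : ℝ) 1) (h' : ‖F.flow t x - F.flow t y‖ ∈ Ioo (0 : ℝ) 1) :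
    |osgoodM L ‖F.flow t x - F.flow t y‖ - osgoodM L ‖x - y‖| ≤ ∫ σ in (0 : ℝ)..t, C σ :=
  hL.abs_osgoodM_sub_le F.modulus_cont F.modulus_nonneg hΛ h' h fun _ hε =>
    F.abs_regPrimitive_flowMap_sub_le_zero hε ht le_rfl x y

theorem OsgoodField.abs_osgoodM_flow_symm_sub_le {t : ℝ} (ht : 0 ≤ t) (x y : Sp d)
    (h : ‖x - y‖ ∈ Ioo (0 : ℝ) 1)
    (h' : ‖(F.flow t).symm x - (F.flow t).symm y‖ ∈ Ioo (0 : ℝ) 1) :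
    |osgoodM L ‖(F.flow t).symm x - (F.flow t).symm y‖ - osgoodM L ‖x - y‖| ≤
      ∫ σ in (0 : ℝ)..t, C σ := by
  have := F.abs_osgoodM_flow_sub_le hL hΛ ht ((F.flow t).symm x) ((F.flow t).symm y) h'
    (by rwa [Homeomorph.apply_symm_apply, Homeomorph.apply_symm_apply])
  rwa [Homeomorph.apply_symm_apply, Homeomorph.apply_symm_apply, abs_sub_comm] at this

/-- The one-sided comparison is applied twice, to `θ₀` with the inverse flow map and to `θ(t)` with
the flow map, since both maps satisfy its hypotheses. -/
theorem OsgoodField.seminorm_lagrangian (γ : ℝ) {t : ℝ} (ht : 0 ≤ t) (θ₀ : Sp d → ℝ) :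
    seminorm L γ (lagrangian F.flow θ₀ t) = seminorm L γ θ₀ ∧
      ∀ x, seminormAt L γ (lagrangian F.flow θ₀ t) (F.flow t x) = seminormAt L γ θ₀ x := by
  have h1 : ∀ r > 0, ∃ δ > 0, ∀ x y, ‖x - y‖ < δ → ‖F.flow t x - F.flow t y‖ < r := fun r hr => by
    obtain ⟨δ, hδ, h⟩ := F.exists_flowMap_modulus ht hr
    exact ⟨δ, hδ, fun x y => (h t le_rfl x y).1⟩
  have h2 : ∀ r > 0, ∃ δ > 0, ∀ x y, ‖x - y‖ < δ →
      ‖(F.flow t).symm x - (F.flow t).symm y‖ < r := fun r hr => by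
    obtain ⟨δ, hδ, h⟩ := F.exists_flowMap_modulus ht hr
    refine ⟨δ, hδ, fun x y hxy => (h t le_rfl _ _).2 ?_⟩
    rwa [← F.flow_apply, ← F.flow_apply, Homeomorph.apply_symm_apply,
      Homeomorph.apply_symm_apply]
  have e1 : lagrangian F.flow θ₀ t = θ₀ ∘ (F.flow t).symm := rfl
  have e2 : lagrangian F.flow θ₀ t ∘ F.flow t = θ₀ := funext fun x => by
    simp only [Function.comp_apply, lagrangian, Homeomorph.symm_apply_apply]
  have hM1 := F.abs_osgoodM_flow_sub_le hL hΛ ht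
  have hM2 := F.abs_osgoodM_flow_symm_sub_le hL hΛ ht
  refine ⟨le_antisymm ?_ ?_, fun x => le_antisymm ?_ ?_⟩
  · exact seminorm_comp_le hL (F.flow t).symm.injective h2 hM2 γ θ₀
  · have := seminorm_comp_le hL (F.flow t).injective h1 hM1 γ (lagrangian F.flow θ₀ t)
    rwa [e2] at this
  · have := seminormAt_comp_le hL (F.flow t).symm.injective h2 hM2 γ θ₀ (F.flow t x)
    rwa [Homeomorph.symm_apply_apply] at this
  · have := seminormAt_comp_le hL (F.flow t).injective h1 hM1 γ (lagrangian F.flow θ₀ t) x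
    rwa [e2] at this

end Seminorm

/-- Trajectories on a time interval do not depend on the values of the field at nonpositive
times. -/
theorem IsTrajectory.congr_velocity {d : ℕ} {u v : ℝ → Sp d → Sp d} {T : ℝ} {x : Sp d}
    {c : ℝ → Sp d} (hc : IsTrajectory u T x c) (h : ∀ t, 0 < t → ∀ x, u t x = v t x)
    (hT : 0 ≤ T) : IsTrajectory v T x c where
  cont := hc.cont
  integrable := hc.integrable.congr (by
    rw [uIoc_of_le hT]
    exact fun s hs => h s hs.1 _)
  eqn t ht := by
    rw [hc.eqn t ht]
    congr 1
    refine intervalIntegral.integral_congr_ae (ae_of_all _ fun s hs => ?_)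
    rw [uIoc_of_le ht.1] at hs
    exact h s hs.1 _

end OsgoodTransport

/-! ### The main theorem -/

theorem mainTheorem3 {d : ℕ} (L C : ℝ → ℝ) (u : ℝ → OsgoodTransport.Sp d → OsgoodTransport.Sp d)
    (hL : OsgoodTransport.IsOsgoodModulus L)
    (hC : LocallyIntegrableOn C (Ici 0))
    (hu_meas : Measurable (fun p : ℝ × OsgoodTransport.Sp d => u p.1 p.2))
    (hu_int : ∀ x, LocallyIntegrableOn (fun t => u t x) (Ici 0))
    (hu_mod : OsgoodTransport.HasModulus L C u)
    (hu_div : ∀ t, 0 < t → OsgoodTransport.IsDivFree (u t)) :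
    ∃ φ : ℝ → OsgoodTransport.Sp d ≃ₜ OsgoodTransport.Sp d,
      OsgoodTransport.IsFlow u (fun t x => φ t x) ∧
      (∀ t, 0 ≤ t → MeasurePreserving (φ t) volume volume) ∧
      ∀ θ₀ : OsgoodTransport.Sp d → ℝ, LocallyIntegrable θ₀ →
        OsgoodTransport.IsWeakSolution u θ₀ (OsgoodTransport.lagrangian φ θ₀) ∧
        (∀ θ : ℝ → OsgoodTransport.Sp d → ℝ, OsgoodTransport.IsWeakSolution u θ₀ θ →
          ∀ᵐ t ∂(volume.restrict (Ioi (0 : ℝ))),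
            θ t =ᵐ[volume] OsgoodTransport.lagrangian φ θ₀ t) ∧
        ∀ γ t : ℝ, 0 ≤ t →
          OsgoodTransport.seminorm L γ (OsgoodTransport.lagrangian φ θ₀ t)
              = OsgoodTransport.seminorm L γ θ₀ ∧
          ∀ x, OsgoodTransport.seminormAt L γ (OsgoodTransport.lagrangian φ θ₀ t) (φ t x)
              = OsgoodTransport.seminormAt L γ θ₀ x := by
  -- All work is done for the extension of `u` by zero to nonpositive times; trajectories and weak
  -- solutions see only positive times, so the conclusions carry over to `u`.
  obtain ⟨Λ, F, hΛ⟩ := OsgoodTransport.osgoodField_indicator hL hC hu_meas hu_int hu_mod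
  have hv : ∀ t, 0 < t → ∀ x, (Ioi (0 : ℝ)).indicator u t x = u t x := fun t ht x => by
    rw [indicator_of_mem (mem_Ioi.2 ht)]
  have hdiv : ∀ t, 0 < t → OsgoodTransport.IsDivFree ((Ioi (0 : ℝ)).indicator u t) :=
    fun t ht => by
      rw [indicator_of_mem (mem_Ioi.2 ht)]
      exact hu_div t ht
  refine ⟨F.flow, fun T hT x => ⟨(F.isTrajectory_flowMap T x).congr_velocity hv hT,
    fun c hc t ht => ?_⟩, fun t _ => F.measurePreserving_flow hdiv t, fun θ₀ hθ₀ =>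
    ⟨(F.isWeakSolution_lagrangian hdiv hθ₀).congr_velocity hv, fun θ hθ => ?_, fun γ t ht =>
      F.seminorm_lagrangian hL hΛ γ ht θ₀⟩⟩
  · exact F.eq_of_isTrajectory
      (hc.congr_velocity (fun t ht x => (hv t ht x).symm) hT) (F.isTrajectory_flowMap T x) t ht
  · exact (hθ.congr_velocity fun t ht x => (hv t ht x).symm).ae_eq_lagrangian F hdiv hθ₀
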